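/- Conventions. Everything is smooth, indices run from $1$ to $4$, $n=4$, repeated indices are summed, and a metric is a nondegenerate symmetric $(0,2)$-tensor field of any signature. A metric $g$ lies in the projective class of a symmetric (torsion-free) affine connection $\Gamma$ if every geodesic of $g$ is a reparameterized geodesic of $\Gamma$, i.e. satisfies $\ddot\gamma^a+\Gamma^a_{bc}\dot\gamma^b\dot\gamma^c=f\,\dot\gamma^a$ for some function $f$ along $\gamma$. With $R_{jk}=R^a{}_{jka}$ and $P_{jk}=\frac{1}{15}(4R_{jk}+R_{kj})$, the projective Weyl tensor of $\Gamma$ is $$W^i{}_{jkl}=R^i{}_{jkl}-(\delta^i_lP_{jk}-\delta^i_kP_{jl})-\delta^i_j(P_{lk}-P_{kl}),$$ which is $R^i{}_{jkl}-\frac13(\delta^i_lR_{jk}-\delta^i_kR_{jl})$ if $R_{jk}$ is symmetric. Consider the equations $$(1)\quad h_{ia}W^a{}_{jkm}+h_{ja}W^a{}_{ikm}=0,\qquad h_{ia}W^a{}_{jkm}-h_{ka}W^a{}_{mij}=0$$ for a symmetric tensor $h_{ij}$; the equations $$(2)\quad n\,S^{a(i}W^{j)}{}_{akl}=S^{ab}W^{(i}{}_{ab[l}\delta^{j)}_{k]}$$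 for a symmetric tensor $S^{ij}$ (brackets denote symmetrization and skew-symmetrization without division); and $$(3)\quad \nabla_a\sigma^{bc}-\tfrac15\left(\nabla_i\sigma^{ib}\delta^c_a+\nabla_i\sigma^{ic}\delta^b_a\right)=0,\qquad \nabla_a\sigma^{bc}=\partial_a\sigma^{bc}+\Gamma^b_{ad}\sigma^{dc}+\Gamma^c_{da}\sigma^{bd}-\tfrac25\Gamma^d_{da}\sigma^{bc}.$$ For a metric $a_{ij}$ with inverse $a^{ij}$ put $A^{ij}=|\det a|^{1/5}a^{ij}$. Substituting $\sigma=e^{\lambda}A$ in (3) gives at each point the inhomogeneous linear system $$(4)\quad \ell_aA^{bc}-\tfrac15\left(\ell_iA^{ib}\delta^c_a+\ell_iA^{ic}\delta^b_a\right)=-\left(\nabla_aA^{bc}-\tfrac15(\nabla_iA^{ib}\delta^c_a+\nabla_iA^{ic}\delta^b_a)\right)$$ on $\ell_i=\partial\lambda/\partial x^i$. Theorem. (A) Let $\Gamma$ be a symmetric affine connection, $a$ a metric and $\lambda$ a function on a 4-manifold. Then the following are equivalent: $d\lambda$ solves (4) at every point; $\sigma=e^{\lambda}A$ solves (3); the metric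 $e^{-5\lambda}a$ lies in the projective class of $\Gamma$. (B) (Ricci-flat reconstruction.) Let $\Gamma$ be a symmetric affine connection on a connected 4-manifold whose projective Weyl tensor satisfies $W^a{}_{jkl}\xi_a\neq0$ for every nonzero covector $\xi$ at every point, and let $g$ be a Ricci-flat metric in the projective class of $\Gamma$. Then at every point the solutions of the linear system (1) are exactly the multiples of $g_{ij}$. Let $a_{ij}$ be any nowhere vanishing symmetric tensor field that solves (1) at every point. Then $a$ is a metric, $g=fa$ for a smooth nowhere vanishing function $f$, the linear system (4) has exactly one solution $\ell$ at every point, there is a function $\lambda$ with $d\lambda=\ell$, and for each such $\lambda$ there is a constant $c\ne0$ with $g=c\,e^{-5\lambda}a$. (C) (Generic metrics.) Let $U\subset\mathbb R^4$ be open, $x_0\in U$, let $g_0$ be a metric on $U$ and $\varepsilon>0$. There are a metric $g_1$ on $U$ that is $\varepsilon$-close to $g_0$ on $U$ in the $C^2$-sense (components and their first and second partial derivatives), a connected open neighbourhood $V\subset U$ of $x_0$ and $\varepsilon'>0$ such that for every metric $g$ on $V$ that is $\varepsilon'$-close to $g_1$ on $V$ in the $C^2$-sense and every symmetric affine connection $\Gamma$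 on $V$ whose projective class contains $g$ the following holds. At every point of $V$ the solutions of the linear system (2) are exactly the multiples of $g^{ij}$, and every metric on $V$ in the projective class of $\Gamma$ is a constant nonzero multiple of $g$ (in particular conformal to $g$). Let $S^{ij}$ be any nowhere vanishing symmetric tensor field on $V$ that solves (2) at every point. Then $S$ is nondegenerate, and with $a=S^{-1}$ one has $g=fa$ for a smooth nowhere vanishing function $f$, the system (4) has exactly one solution $\ell$ at every point of $V$, there is a function $\lambda$ on $V$ with $d\lambda=\ell$, and for each such $\lambda$ there is a constant $c\neq0$ with $g=c\,e^{-5\lambda}a$. -/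

import Mathlib

open scoped Manifold ContDiff

noncomputable section

namespace ProjRec

/-! ## Tensor calculus in coordinates, in dimension `n = 4` -/

/-- The coordinate space `ℝ⁴`. -/
abbrev E4 := EuclideanSpace ℝ (Fin 4)

/-- Symmetric `(0,2)`- or `(2,0)`-tensors at a point are written as matrices. -/
abbrev Mat4 := Matrix (Fin 4) (Fin 4) ℝ

/-- Components `Γ x a b c = Γ^a_{bc}(x)` of an affine connection. -/
abbrev Symbols := E4 → Fin 4 → Fin 4 → Fin 4 → ℝ

/-- The coordinate vector `∂_i`. -/
def coordVec (i : Fin 4) : E4 := EuclideanSpace.single i 1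

/-- The `a`-th component of a vector. -/
def coord (a : Fin 4) (v : E4) : ℝ := v a

/-- The partial derivative `∂f/∂x^i` at `x`. -/
def pd (i : Fin 4) (f : E4 → ℝ) (x : E4) : ℝ := fderiv ℝ f x (coordVec i)

/-- Kronecker's delta. -/
def kd (i j : Fin 4) : ℝ := if i = j then 1 else 0

/-- Smooth symmetric connection coefficients on an open set `O`. -/
structure IsSymbolsOn (O : Set E4) (Γ : Symbols) : Prop where
  smooth : ∀ a b c, ContDiffOn ℝ ∞ (fun x => Γ x a b c) O
  symm : ∀ x ∈ O, ∀ a b c, Γ x a b c = Γ x a c b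

/-- Smooth fields of symmetric matrices on `O`. -/
structure IsSymFieldOn (O : Set E4) (h : E4 → Mat4) : Prop where
  smooth : ∀ i j, ContDiffOn ℝ ∞ (fun x => h x i j) O
  symm : ∀ x ∈ O, (h x).IsSymm

/-- `g` gives the components `g_{ij}` of a smooth metric of arbitrary signature on `O`. -/
structure IsMetricOn (O : Set E4) (g : E4 → Mat4) : Prop extends IsSymFieldOn O g where
  nondeg : ∀ x ∈ O, (g x).det ≠ 0

/-- The Levi-Civita connection
`Γ^a_{bc} = ½ g^{ad} (∂_b g_{dc} + ∂_c g_{db} - ∂_d g_{bc})`. -/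
def leviCivita (g : E4 → Mat4) : Symbols := fun x a b c =>
  (1 / 2) * ∑ d, (g x)⁻¹ a d *
    (pd b (fun y => g y d c) x + pd c (fun y => g y d b) x - pd d (fun y => g y b c) x)

/-- The curvature tensor `R^i_{jkl}`, with the sign for which `R_{jk} = R^a_{jka}` is the usual
Ricci tensor. -/
def curv (Γ : Symbols) (x : E4) (i j k l : Fin 4) : ℝ :=
  pd l (fun y => Γ y i k j) x - pd k (fun y => Γ y i l j) x
    + ∑ a, (Γ x i l a * Γ x a k j - Γ x i k a * Γ x a l j)

/-- The Ricci tensor `R_{jk} = R^a_{jka}`. -/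
def ricci (Γ : Symbols) (x : E4) (j k : Fin 4) : ℝ := ∑ a, curv Γ x a j k a

/-- The projective Schouten tensor `P_{jk} = (n R_{jk} + R_{kj}) / (n² - 1)`, `n = 4`. -/
def schouten (Γ : Symbols) (x : E4) (j k : Fin 4) : ℝ :=
  (4 * ricci Γ x j k + ricci Γ x k j) / 15

/-- The projective Weyl tensor `W^i_{jkl}` of a symmetric connection: the totally trace-free part
of the curvature. The Ricci tensor of a symmetric connection need not be symmetric; when it is, this
is `R^i_{jkl} - (δ^i_l R_{jk} - δ^i_k R_{jl}) / 3`, see `weyl_eq_of_ricci_symm`. -/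
def weyl (Γ : Symbols) (x : E4) (i j k l : Fin 4) : ℝ :=
  curv Γ x i j k l - (kd i l * schouten Γ x j k - kd i k * schouten Γ x j l)
    - kd i j * (schouten Γ x l k - schouten Γ x k l)

theorem weyl_eq_of_ricci_symm (Γ : Symbols) (x : E4)
    (h : ∀ j k, ricci Γ x j k = ricci Γ x k j) (i j k l : Fin 4) :
    weyl Γ x i j k l =
      curv Γ x i j k l - (1 / 3) * (kd i l * ricci Γ x j k - kd i k * ricci Γ x j l) := by
  simp only [weyl, schouten]
  rw [h k j, h l j, h l k]
  ring

/-- `γ` is, for `t ∈ (α, β)`, a geodesic of `Γ` in `O`, affinely parameterized. -/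
def IsGeodesic (O : Set E4) (Γ : Symbols) (γ : ℝ → E4) (α β : ℝ) : Prop :=
  ContDiffOn ℝ 2 γ (Set.Ioo α β) ∧ ∀ t ∈ Set.Ioo α β, γ t ∈ O ∧
    ∀ a, deriv (deriv γ) t a + ∑ b, ∑ c, Γ (γ t) a b c * deriv γ t b * deriv γ t c = 0

/-- `γ` is, for `t ∈ (α, β)`, a geodesic of `Γ` in `O` in an arbitrary parameter:
`γ'' + Γ(γ', γ') = f γ'`. -/
def IsReparamGeodesic (O : Set E4) (Γ : Symbols) (γ : ℝ → E4) (α β : ℝ) : Prop :=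
  ContDiffOn ℝ 2 γ (Set.Ioo α β) ∧ ∀ t ∈ Set.Ioo α β, γ t ∈ O ∧ ∃ f : ℝ,
    ∀ a, deriv (deriv γ) t a + ∑ b, ∑ c, Γ (γ t) a b c * deriv γ t b * deriv γ t c
      = f * deriv γ t a

/-- The metric `g` lies in the projective class of `Γ` on `O`: every geodesic of `g` is a
reparameterized geodesic of `Γ`. -/
def InProjClassOn (O : Set E4) (Γ : Symbols) (g : E4 → Mat4) : Prop :=
  ∀ (γ : ℝ → E4) (α β : ℝ), IsGeodesic O (leviCivita g) γ α β → IsReparamGeodesic O Γ γ α β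

/-! ## The three systems of equations -/

/-- The linear system on a symmetric matrix `h = (h_{ij})`:
`h_{ia} W^a_{jkm} + h_{ja} W^a_{ikm} = 0` and `h_{ia} W^a_{jkm} - h_{ka} W^a_{mij} = 0`. -/
def RiemannSystem (W : Fin 4 → Fin 4 → Fin 4 → Fin 4 → ℝ) (h : Mat4) : Prop :=
  (∀ i j k m, ∑ a, h i a * W a j k m + ∑ a, h j a * W a i k m = 0) ∧
  (∀ i j k m, ∑ a, h i a * W a j k m - ∑ a, h k a * W a m i j = 0)

/-- The linear system on a symmetric matrix `S = (S^{ij})`: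
`n S^{a(i} W^{j)}_{akl} = S^{ab} W^{(i}_{ab[l} δ^{j)}_{k]}`, `n = 4`, where `( )` and `[ ]` denote
symmetrization and skew-symmetrization without division. -/
def TractorSystem (W : Fin 4 → Fin 4 → Fin 4 → Fin 4 → ℝ) (S : Mat4) : Prop :=
  ∀ i j k l,
    4 * (∑ a, S a i * W j a k l + ∑ a, S a j * W i a k l) =
      ∑ a, ∑ b, S a b * (W i a b l * kd j k - W i a b k * kd j l
        + W j a b l * kd i k - W j a b k * kd i l)

/-- The weighted tensor `σ^{ij} = g^{ij} |det g|^{1/(n+1)}`, `n = 4`. -/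
def weighted (g : E4 → Mat4) : E4 → Mat4 := fun x => |(g x).det| ^ ((1 : ℝ) / 5) • (g x)⁻¹

/-- The covariant derivative `∇_a σ^{bc}` of a weighted tensor. -/
def covDeriv (Γ : Symbols) (σ : E4 → Mat4) (x : E4) (a b c : Fin 4) : ℝ :=
  pd a (fun y => σ y b c) x + ∑ d, Γ x b a d * σ x d c + ∑ d, Γ x c d a * σ x b d
    - (2 / 5) * (∑ d, Γ x d d a) * σ x b c

/-- `∇_a σ^{bc} - (∇_i σ^{ib} δ^c_a + ∇_i σ^{ic} δ^b_a) / (n+1)`, `n = 4`. -/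
def metrizability (Γ : Symbols) (σ : E4 → Mat4) (x : E4) (a b c : Fin 4) : ℝ :=
  covDeriv Γ σ x a b c
    - (1 / 5) * ∑ i, (covDeriv Γ σ x i i b * kd c a + covDeriv Γ σ x i i c * kd b a)

/-- `σ` solves the metrizability equations of `Γ` on `O`. -/
def SolvesMetrizabilityOn (O : Set E4) (Γ : Symbols) (σ : E4 → Mat4) : Prop :=
  ∀ x ∈ O, ∀ a b c, metrizability Γ σ x a b c = 0

/-- The inhomogeneous linear system at `x` on `ℓ = (ℓ_i)` which arises from the metrizability
equations by the ansatz `σ = e^λ A`, `ℓ_i = ∂λ/∂x^i`. -/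
def FactorSystem (Γ : Symbols) (A : E4 → Mat4) (x : E4) (ℓ : Fin 4 → ℝ) : Prop :=
  ∀ a b c, ℓ a * A x b c
      - (1 / 5) * ∑ i, (ℓ i * A x i b * kd c a + ℓ i * A x i c * kd b a)
    = - metrizability Γ A x a b c

/-- The differential of `lam` solves the linear system at every point of `O`. -/
def SolvesFactorOn (O : Set E4) (Γ : Symbols) (A : E4 → Mat4) (lam : E4 → ℝ) : Prop :=
  ∀ x ∈ O, FactorSystem Γ A x (fun i => pd i lam x)

/-- The components of `g` and `g'` and their first and second partial derivatives are `ε`-close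
at every point of `O`. -/
def C2CloseOn (O : Set E4) (ε : ℝ) (g g' : E4 → Mat4) : Prop :=
  ∀ x ∈ O, ∀ i j,
    |g x i j - g' x i j| < ε ∧
    (∀ k, |pd k (fun y => g y i j) x - pd k (fun y => g' y i j) x| < ε) ∧
    (∀ k l, |pd l (fun z => pd k (fun y => g y i j) z) x
      - pd l (fun z => pd k (fun y => g' y i j) z) x| < ε)

/-! ## Connections and metrics on a 4-manifold -/

section Manifold

variable {M : Type*} [TopologicalSpace M] [ChartedSpace E4 M]

/-- The coordinate vector field `∂_i` of the chart `e` (meaningful on the domain of `e`). -/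
def coordField (e : OpenPartialHomeomorph M E4) (i : Fin 4) (p : M) : TangentSpace (𝓡 4) p :=
  VectorField.mpullback (𝓡 4) 𝓘(ℝ, E4) e (fun _ => coordVec i) p

/-- Fields of bilinear forms on the tangent spaces of `M`. -/
abbrev BilinField (M : Type*) [TopologicalSpace M] [ChartedSpace E4 M] :=
  (p : M) → TangentSpace (𝓡 4) p →L[ℝ] TangentSpace (𝓡 4) p →L[ℝ] ℝ

/-- The components `T_{ij} = T(∂_i, ∂_j)` of `T` in the chart `e`. -/
def comp (T : BilinField M) (e : OpenPartialHomeomorph M E4) : E4 → Mat4 := fun x =>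
  Matrix.of fun i j => T (e.symm x) (coordField e i (e.symm x)) (coordField e j (e.symm x))

/-- The smooth charts of `M`. -/
abbrev charts (M : Type*) [TopologicalSpace M] [ChartedSpace E4 M] :
    Set (OpenPartialHomeomorph M E4) := IsManifold.maximalAtlas (𝓡 4) ∞ M

variable [IsManifold (𝓡 4) ∞ M]

/-- Affine connections on `M`, i.e. covariant derivatives on the tangent bundle. -/
abbrev Connection (M : Type*) [TopologicalSpace M] [ChartedSpace E4 M] [IsManifold (𝓡 4) ∞ M] :=
  CovariantDerivative (𝓡 4) E4 (TangentSpace (𝓡 4) : M → Type _)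

/-- The symbols of `cov` in the chart `e`: `∇_{∂_b} ∂_c = Γ^a_{bc} ∂_a`. -/
def christoffel (cov : Connection M) (e : OpenPartialHomeomorph M E4) : Symbols := fun x a b c =>
  coord a (mfderiv (𝓡 4) 𝓘(ℝ, E4) e (e.symm x)
    (cov (coordField e c) (e.symm x) (coordField e b (e.symm x))))

/-- Smooth symmetric affine connections. -/
def IsSymmConnection (cov : Connection M) : Prop :=
  ∀ e ∈ charts M, IsSymbolsOn e.target (christoffel cov e)

/-- Smooth symmetric `(0,2)`-tensor fields. -/
def IsSymTensor (T : BilinField M) : Prop :=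
  (∀ p v w, T p v w = T p w v) ∧ ∀ e ∈ charts M, IsSymFieldOn e.target (comp T e)

/-- Smooth metrics of arbitrary signature. -/
def IsMetric (g : BilinField M) : Prop :=
  IsSymTensor g ∧ ∀ p v, (∀ w, g p v w = 0) → v = 0

/-- `g` lies in the projective class of `cov`. Being a (reparameterized) geodesic is a local
property of a curve, so it is tested in charts. -/
def InProjClass (cov : Connection M) (g : BilinField M) : Prop :=
  ∀ e ∈ charts M, InProjClassOn e.target (christoffel cov e) (comp g e)

/-- The Ricci tensor of `g` vanishes. -/
def IsRicciFlat (g : BilinField M) : Prop :=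
  ∀ e ∈ charts M, ∀ x ∈ e.target, ∀ j k, ricci (leviCivita (comp g e)) x j k = 0

/-- `W^a_{jkl} ξ_a ≠ 0` for every point and every covector `ξ ≠ 0`. -/
def WeylNondegenerate (cov : Connection M) : Prop :=
  ∀ e ∈ charts M, ∀ x ∈ e.target, ∀ ξ : Fin 4 → ℝ, ξ ≠ 0 →
    ∃ j k l, ∑ a, weyl (christoffel cov e) x a j k l * ξ a ≠ 0

/-- `a` solves the linear system `RiemannSystem` of `cov` at every point. -/
def SolvesRiemann (cov : Connection M) (a : BilinField M) : Prop :=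
  ∀ e ∈ charts M, ∀ x ∈ e.target, RiemannSystem (weyl (christoffel cov e) x) (comp a e x)

/-- `e^lam` times the weighted tensor of `a` solves the metrizability equations of `cov`. -/
def SolvesMetrizability (cov : Connection M) (a : BilinField M) (lam : M → ℝ) : Prop :=
  ∀ e ∈ charts M, SolvesMetrizabilityOn e.target (christoffel cov e)
    (fun x => Real.exp (lam (e.symm x)) • weighted (comp a e) x)

/-- The differential of `lam` solves the linear system `FactorSystem`, in every chart, for the
ansatz `σ = e^lam A` with `A` the weighted tensor of `a`. -/
def SolvesFactor (cov : Connection M) (a : BilinField M) (lam : M → ℝ) : Prop :=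
  ∀ e ∈ charts M, SolvesFactorOn e.target (christoffel cov e) (weighted (comp a e))
    (fun x => lam (e.symm x))

end Manifold

end ProjRec

end

noncomputable section

namespace ProjRec

open scoped Matrix

/-! ## Kronecker's delta -/

/-! Two invariance facts reduce all three parts to pointwise algebra. First, a connection `Γ` has
every geodesic of `g` among its unparameterized geodesics iff it differs from the Levi-Civita
connection by a pure trace `δ^a_b φ_c + δ^a_c φ_b`: a geodesic leaves every point in every
direction, so the difference `D` satisfies `D(v,v) ∥ v` for all `v` (`eq_kd_of_parallel`). Because
`|det g|^{1/5} g⁻¹` is parallel for `g`, a pure trace difference is also exactly what equation (3)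
asks for (`IsMetricOn.metrizability_eq_zero_iff`). Since `e^λ A` is the weighted tensor of `e^{-5λ}
a`, (A) is then the Leibniz rule. Second, the projective Weyl tensor is unchanged under such a
difference (`IsProjChangeOn.weyl_eq`), so (1) and (2) may be studied with the Levi-Civita connection
of `g`.

For (B), the Weyl tensor of a Ricci-flat `g` is its curvature. A solution `h` of (1) gives an
endomorphism `L = g⁻¹h` that acts equally on all four slots of the curvature `C` with raised
indices. In dimension four a trace-free double form satisfies `C ∧ δ = 0` (`wedgeDelta_eq_zero`);
contracting this identity with `L` gives `tr(L) C = 4 L C`. Nondegeneracy of the Weyl tensor then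
forces `h = (tr L / 4) g` (`eq_smul_of_riemannSystem`).

For (C), `g⁻¹` always solves (2) (`IsMetricOn.tractorSystem_inv`). That it is the only solution up
to scale follows from the nonvanishing of one polynomial, `genericity`, in the 2-jet of `g`. The
polynomial is nonzero at an explicit model jet (`genericity_model`), hence at points arbitrarily
near the start of any segment ending there. A bump function realizes this segment by metrics
(`exists_generic_perturbation`), and continuity on jet space gives the neighbourhood and the
`C²`-stability (`exists_generic_nhd`).

In both cases `g = f a` with `a` known. Then `-(1/5) log |f|` solves (4), whose solution is unique
at each point (`FactorSystem.unique`); on a connected domain `λ` is therefore determined up to an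
additive constant, and `g` up to a constant factor. -/

theorem kd_comm (i j : Fin 4) : kd i j = kd j i := by simp [kd, eq_comm]

theorem sum_kd_mul (i : Fin 4) (f : Fin 4 → ℝ) : ∑ a, kd i a * f a = f i := by simp [kd]

theorem sum_kd_mul' (i : Fin 4) (f : Fin 4 → ℝ) : ∑ a, kd a i * f a = f i := by simp [kd]

theorem sum_mul_kd' (i : Fin 4) (f : Fin 4 → ℝ) : ∑ a, f a * kd a i = f i := by simp [kd]

theorem sum_kd_self : ∑ a : Fin 4, kd a a = 4 := by simp [kd]

theorem one_apply_eq_kd (i j : Fin 4) : (1 : Mat4) i j = kd i j := by simp [Matrix.one_apply, kd]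

/-! ## Double forms in dimension four -/

/-- The third exterior power of a four-dimensional space has one independent component for each
omitted index. -/
theorem eq_zero_of_alternating_three (f : Fin 4 → Fin 4 → Fin 4 → ℝ)
    (h12 : ∀ a b c, f a b c = - f b a c) (h23 : ∀ a b c, f a b c = - f a c b)
    (h0 : f 1 2 3 = 0) (h1 : f 0 2 3 = 0) (h2 : f 0 1 3 = 0) (h3 : f 0 1 2 = 0)
    (a b c : Fin 4) : f a b c = 0 := by
  have e1 : ∀ a c, f a a c = 0 := fun a c => by linarith [h12 a a c]
  have e2 : ∀ a c, f a c c = 0 := fun a c => by linarith [h23 a c c]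
  have e3 : ∀ a c, f a c a = 0 := fun a c => by rw [h12, e2, neg_zero]
  have s1 : ∀ {a b c}, f a b c = 0 → f b a c = 0 := fun {a b c} h => by rw [h12, h, neg_zero]
  have s2 : ∀ {a b c}, f a b c = 0 → f a c b = 0 := fun {a b c} h => by rw [h23, h, neg_zero]
  have key : ∀ {a b c}, f a b c = 0 →
      f a b c = 0 ∧ f b a c = 0 ∧ f a c b = 0 ∧ f b c a = 0 ∧ f c a b = 0 ∧ f c b a = 0 :=
    fun h => ⟨h, s1 h, s2 h, s2 (s1 h), s1 (s2 h), s1 (s2 (s1 h))⟩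
  obtain ⟨_, _, _, _, _, _⟩ := key h0
  obtain ⟨_, _, _, _, _, _⟩ := key h1
  obtain ⟨_, _, _, _, _, _⟩ := key h2
  obtain ⟨_, _, _, _, _, _⟩ := key h3
  fin_cases a <;> fin_cases b <;> fin_cases c <;> first | exact e1 _ _ | exact e2 _ _ | exact e3 _ _ | assumption

/-- The exterior product of a double form with the identity, up to a factor. -/
def wedgeDelta (C : Fin 4 → Fin 4 → Fin 4 → Fin 4 → ℝ) (a b e c d f : Fin 4) : ℝ :=
  C a b c d * kd e f + C a b d f * kd e c + C a b f c * kd e d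
    + C b e c d * kd a f + C b e d f * kd a c + C b e f c * kd a d
    + C e a c d * kd b f + C e a d f * kd b c + C e a f c * kd b d

/-- Triples of indices in dimension four are dual to single indices, so the (3,3)-form `C ∧ δ` has
16 independent components, and each of them is a combination of the traces of `C`. No Bianchi
identity is needed. -/
theorem wedgeDelta_eq_zero (C : Fin 4 → Fin 4 → Fin 4 → Fin 4 → ℝ)
    (h1 : ∀ a b c d, C a b c d = - C b a c d) (h2 : ∀ a b c d, C a b c d = - C a b d c)
    (tr : ∀ b d, ∑ a, C a b a d = 0) (a b e c d f : Fin 4) : wedgeDelta C a b e c d f = 0 := by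
  have z1 : ∀ a c d, C a a c d = 0 := fun a c d => by linarith [h1 a a c d]
  have z2 : ∀ a b c, C a b c c = 0 := fun a b c => by linarith [h2 a b c c]
  -- The second triple is fixed to be increasing while alternation disposes of the first;
  -- alternation in the second triple follows at the end.
  have lower : ∀ c d f : Fin 4, (c = 1 ∧ d = 2 ∧ f = 3 ∨ c = 0 ∧ d = 2 ∧ f = 3 ∨
      c = 0 ∧ d = 1 ∧ f = 3 ∨ c = 0 ∧ d = 1 ∧ f = 2) → ∀ a b e, wedgeDelta C a b e c d f = 0 := by
    intro c d f hcdf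
    have T := fun b d => Fin.sum_univ_four (fun a => C a b a d) ▸ tr b d
    refine eq_zero_of_alternating_three _ ?_ ?_ ?_ ?_ ?_ ?_
    · intro a b e
      simp only [wedgeDelta]
      rw [h1 a b c d, h1 a b d f, h1 a b f c, h1 b e c d, h1 b e d f, h1 b e f c,
        h1 e a c d, h1 e a d f, h1 e a f c]
      ring
    · intro a b e
      simp only [wedgeDelta]
      rw [h1 a b c d, h1 a b d f, h1 a b f c, h1 b e c d, h1 b e d f, h1 b e f c,
        h1 e a c d, h1 e a d f, h1 e a f c]
      ring
    -- The 16 components: after sorting index pairs by skew-symmetry, each is linear in the trace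
    -- relations.
    all_goals
      rcases hcdf with ⟨rfl, rfl, rfl⟩ | ⟨rfl, rfl, rfl⟩ | ⟨rfl, rfl, rfl⟩ | ⟨rfl, rfl, rfl⟩ <;>
      simp only [wedgeDelta, kd, Fin.isValue, Fin.reduceEq, if_true, if_false, mul_one, mul_zero, add_zero, zero_add] <;>
      have t00 := T 0 0 <;> have t11 := T 1 1 <;> have t22 := T 2 2 <;> have t33 := T 3 3 <;>
      have t01 := T 0 1 <;> have t02 := T 0 2 <;> have t03 := T 0 3 <;>
      have t10 := T 1 0 <;> have t12 := T 1 2 <;> have t13 := T 1 3 <;>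
      have t20 := T 2 0 <;> have t21 := T 2 1 <;> have t23 := T 2 3 <;>
      have t30 := T 3 0 <;> have t31 := T 3 1 <;> have t32 := T 3 2 <;>
      simp only [z1, z2] at t00 t11 t22 t33 t01 t02 t03 t10 t12 t13 t20 t21 t23 t30 t31 t32 <;>
      simp only [h1 1 0, h1 2 0, h1 3 0, h1 2 1, h1 3 1, h1 3 2, h2 _ _ 1 0, h2 _ _ 2 0, h2 _ _ 3 0,
        h2 _ _ 2 1, h2 _ _ 3 1, h2 _ _ 3 2] at t00 t11 t22 t33 t01 t02 t03 t10 t12 t13 t20 t21 t23 t30 t31 t32 ⊢ <;>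
      linarith
  refine eq_zero_of_alternating_three (fun c d f => wedgeDelta C a b e c d f) ?_ ?_ (lower _ _ _ (by simp) _ _ _) (lower _ _ _ (by simp) _ _ _) (lower _ _ _ (by simp) _ _ _) (lower _ _ _ (by simp) _ _ _) c d f
  · intro c d f
    simp only [wedgeDelta]
    rw [h2 a b c d, h2 a b d f, h2 a b f c, h2 b e c d, h2 b e d f, h2 b e f c,
      h2 e a c d, h2 e a d f, h2 e a f c]
    ring
  · intro c d f
    simp only [wedgeDelta]
    rw [h2 a b c d, h2 a b d f, h2 a b f c, h2 b e c d, h2 b e d f, h2 b e f c,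
      h2 e a c d, h2 e a d f, h2 e a f c]
    ring

/-- The trace of an endomorphism that acts equally on all four slots of a trace-free double
form determines this action. -/
theorem trace_mul_doubleForm (C : Fin 4 → Fin 4 → Fin 4 → Fin 4 → ℝ) (L : Mat4)
    (h1 : ∀ a b c d, C a b c d = - C b a c d) (h2 : ∀ a b c d, C a b c d = - C a b d c)
    (tr : ∀ b d, ∑ a, C a b a d = 0)
    (s2 : ∀ a b c d, ∑ e, L b e * C a e c d = ∑ e, L a e * C e b c d)
    (s3 : ∀ a b c d, ∑ f, L f c * C a b f d = ∑ e, L a e * C e b c d) (a b c d : Fin 4) :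
    L.trace * C a b c d = 4 * ∑ e, L a e * C e b c d := by
  have tr' : ∀ e d, ∑ f, C e f d f = 0 := fun e d => by
    rw [← tr e d]; exact Finset.sum_congr rfl fun f _ => by rw [h1, h2]; ring
  have s4 : ∀ a b c d, ∑ f, L f d * C a b c f = ∑ e, L a e * C e b c d := fun a b c d => by
    calc ∑ f, L f d * C a b c f = - ∑ f, L f d * C a b f c := by
          rw [← Finset.sum_neg_distrib]; exact Finset.sum_congr rfl fun f _ => by rw [h2]; ring
      _ = - ∑ e, L a e * C e b d c := by rw [s3]
      _ = _ := by
          rw [← Finset.sum_neg_distrib]; exact Finset.sum_congr rfl fun f _ => by rw [h2]; ring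
  -- Moving `L` by `s2` onto a slot that is not summed leaves a plain trace of `C`.
  have Y : ∀ b d, ∑ f, ∑ e, L f e * C b e d f = 0 := fun b d => by
    calc ∑ f, ∑ e, L f e * C b e d f = ∑ f, ∑ e, L b e * C e f d f :=
          Finset.sum_congr rfl fun f _ => s2 _ _ _ _
      _ = ∑ e, L b e * ∑ f, C e f d f := by
          rw [Finset.sum_comm]; simp only [Finset.mul_sum]
      _ = 0 := by simp [tr']
  -- Contraction of `C ∧ δ` with `L` in the slots `e`, `f`: of the nine terms one gives `tr(L) C`,
  -- four give `-L C`, and the four with `δ` between free indices vanish by `Y`.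
  have key : ∑ f, ∑ e, L f e * wedgeDelta C a b e c d f = 0 := by
    simp [wedgeDelta_eq_zero C h1 h2 tr]
  have t1 : ∑ f, ∑ e, L f e * (C a b c d * kd e f) = L.trace * C a b c d := by
    simp [kd, Matrix.trace, Finset.sum_mul]
  have t2 : ∑ f, ∑ e, L f e * (C a b d f * kd e c) = - ∑ e, L a e * C e b c d := by
    rw [← s3, ← Finset.sum_neg_distrib]
    exact Finset.sum_congr rfl fun f _ => by simp [kd, h2 a b d f]
  have t3 : ∑ f, ∑ e, L f e * (C a b f c * kd e d) = - ∑ e, L a e * C e b c d := by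
    rw [← s4, ← Finset.sum_neg_distrib]
    exact Finset.sum_congr rfl fun f _ => by simp [kd, h2 a b c f]
  have t4 : ∑ f, ∑ e, L f e * (C b e c d * kd a f) = - ∑ e, L a e * C e b c d := by
    simp [kd, ← Finset.sum_neg_distrib, h1 b]
  have t7 : ∑ f, ∑ e, L f e * (C e a c d * kd b f) = - ∑ e, L a e * C e b c d := by
    rw [← s2]; simp [kd, ← Finset.sum_neg_distrib, h1 a]
  have t5 : ∑ f, ∑ e, L f e * (C b e d f * kd a c) = 0 := by
    simp only [← mul_assoc, ← Finset.sum_mul, Y, zero_mul]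
  have t6 : ∑ f, ∑ e, L f e * (C b e f c * kd a d) = 0 := by
    simp only [h2 b _ _ c, mul_neg, neg_mul, Finset.sum_neg_distrib, ← mul_assoc, ← Finset.sum_mul,
      Y, zero_mul, neg_zero]
  have t8 : ∑ f, ∑ e, L f e * (C e a d f * kd b c) = 0 := by
    simp only [h1 _ a, mul_neg, neg_mul, Finset.sum_neg_distrib, ← mul_assoc, ← Finset.sum_mul,
      Y, zero_mul, neg_zero]
  have t9 : ∑ f, ∑ e, L f e * (C e a f c * kd b d) = 0 := by
    have : ∀ e f, C e a f c = C a e c f := fun e f => by rw [h1, h2]; ring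
    simp only [this, ← mul_assoc, ← Finset.sum_mul, Y, zero_mul]
  simp only [wedgeDelta, mul_add, Finset.sum_add_distrib, t1, t2, t3, t4, t5, t6, t7, t8, t9] at key
  linarith

/-- The symmetries of a Riemann curvature tensor with lowered index, except Bianchi's. -/
structure IsCurvatureLike (R : Fin 4 → Fin 4 → Fin 4 → Fin 4 → ℝ) : Prop where
  anti_left : ∀ i j k l, R i j k l = - R j i k l
  anti_right : ∀ i j k l, R i j k l = - R i j l k
  pair : ∀ i j k l, R i j k l = R k l i j

/-! ### Solutions of the system (1) for a tensor with curvature symmetries -/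

theorem symm_inv {g : Mat4} (hg : g.IsSymm) : (g⁻¹).IsSymm := by
  rw [Matrix.IsSymm, Matrix.transpose_nonsing_inv, hg]

/-- The first half of (1) makes `g⁻¹h` act equally on the first two slots of the curvature; the
second half, compared with the pair symmetry, carries this action to the last two.
`trace_mul_doubleForm` then makes the action scalar. -/
theorem eq_smul_of_riemannSystem {g h : Mat4} (hg : g.IsSymm) (hdet : g.det ≠ 0) (hh : h.IsSymm)
    {W : Fin 4 → Fin 4 → Fin 4 → Fin 4 → ℝ}
    (hR : IsCurvatureLike (fun i j k l => ∑ a, g i a * W a j k l))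
    (tr : ∀ j k, ∑ a, W a j k a = 0)
    (nd : ∀ ξ : Fin 4 → ℝ, ξ ≠ 0 → ∃ j k l, ∑ a, W a j k l * ξ a ≠ 0)
    (hS : RiemannSystem W h) : ∃ c : ℝ, h = c • g := by
  have hu : IsUnit g.det := isUnit_iff_ne_zero.mpr hdet
  set H := g⁻¹ with hH
  have HS : Hᵀ = H := symm_inv hg
  have gH : g * H = 1 := Matrix.mul_nonsing_inv _ hu
  have Hg : H * g = 1 := Matrix.nonsing_inv_mul _ hu
  let w : Fin 4 → Fin 4 → Mat4 := fun k l => Matrix.of fun a j => W a j k l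
  have gw : ∀ i j k l, (g * w k l) i j = ∑ a, g i a * W a j k l := fun _ _ _ _ => rfl
  have hw : ∀ i j k l, (h * w k l) i j = ∑ a, h i a * W a j k l := fun _ _ _ _ => rfl
  have a1 : ∀ k l, (w k l)ᵀ * g = - (g * w k l) := fun k l => by
    have : (g * w k l)ᵀ = - (g * w k l) := by
      ext i j; rw [Matrix.transpose_apply, Matrix.neg_apply, gw, gw]; exact hR.anti_left _ _ _ _
    rwa [Matrix.transpose_mul, hg] at this
  have a2 : ∀ k l, w k l = - w l k := fun k l => by
    have : g * w k l = g * - w l k := by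
      ext i j; rw [mul_neg, Matrix.neg_apply, gw, gw]; exact hR.anti_right _ _ _ _
    calc w k l = H * (g * w k l) := by rw [← mul_assoc, Hg, one_mul]
      _ = _ := by rw [this, ← mul_assoc, Hg, one_mul]
  have a3 : ∀ k l, (w k l)ᵀ * h = - (h * w k l) := fun k l => by
    have : (h * w k l)ᵀ = - (h * w k l) := by
      ext i j; rw [Matrix.transpose_apply, Matrix.neg_apply, hw, hw]; linarith [hS.1 i j k l]
    rwa [Matrix.transpose_mul, hh] at this
  have a4 : ∀ k l, H * (w k l)ᵀ = - (w k l * H) := fun k l => by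
    calc H * (w k l)ᵀ = H * ((w k l)ᵀ * g) * H := by rw [mul_assoc, mul_assoc, gH, mul_one]
      _ = _ := by rw [a1, mul_neg, ← mul_assoc, Hg, one_mul, neg_mul]
  -- Raising the second index gives a tensor skew in its first two slots, on which the mixed tensor
  -- `L` acts uniformly.
  let C : Fin 4 → Fin 4 → Fin 4 → Fin 4 → ℝ := fun a b c d => (w c d * H) a b
  set L := H * h with hL
  have X : ∀ a b c d, ∑ e, L a e * C e b c d = (H * h * w c d * H) a b := fun a b c d => by
    rw [mul_assoc]; rfl
  have h1 : ∀ a b c d, C a b c d = - C b a c d := fun a b c d => by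
    have : (w c d * H)ᵀ = - (w c d * H) := by rw [Matrix.transpose_mul, HS, a4]
    exact congrFun (congrFun this b) a
  have h2 : ∀ a b c d, C a b c d = - C a b d c := fun a b c d => by
    change (w c d * H) a b = - (w d c * H) a b
    rw [a2 c d, neg_mul, Matrix.neg_apply]
  have T : ∀ b d, ∑ a, C a b a d = 0 := fun b d => by
    change ∑ a, ∑ j, W a j a d * H j b = 0
    rw [Finset.sum_comm]
    have : ∀ j a, W a j a d = - W a j d a := fun j a => congrFun (congrFun (a2 a d) a) j
    simp only [this, neg_mul, Finset.sum_neg_distrib, ← Finset.sum_mul, tr, zero_mul,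
      Finset.sum_const_zero, neg_zero]
  have s2 : ∀ a b c d, ∑ e, L b e * C a e c d = ∑ e, L a e * C e b c d := fun a b c d => by
    rw [X]
    have e1 : ∑ e, L b e * C a e c d = (w c d * H * Lᵀ) a b := by
      rw [Matrix.mul_apply]; exact Finset.sum_congr rfl fun e _ => mul_comm _ _
    have e2 : w c d * H * Lᵀ = H * h * w c d * H := by
      have := congrArg (fun m => H * m * H) (a3 c d)
      simp only [mul_neg, neg_mul, ← mul_assoc, a4] at this
      rw [hL, Matrix.transpose_mul, hh, HS, ← mul_assoc]
      exact neg_injective this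
    rw [e1, e2]
  -- Pair symmetry of the lowered tensor turns the action of `L` on the third slot into a product
  -- with `h`, where the second half of (1) applies.
  have s3 : ∀ a b c d, ∑ f, L f c * C a b f d = ∑ e, L a e * C e b c d := fun a b c d => by
    rw [X]
    have e1 : ∑ f, L f c • (g * w f d) = h * w c d := by
      ext m j
      have : ∀ f, (g * w f d) m j = (g * w m j) f d := fun f => by rw [gw, gw]; exact hR.pair _ _ _ _
      simp only [Matrix.sum_apply, Matrix.smul_apply, smul_eq_mul, this]
      have e3 : ∑ f, L f c * (g * w m j) f d = (Lᵀ * (g * w m j)) c d := rfl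
      rw [e3, hL, Matrix.transpose_mul, hh, HS, mul_assoc, ← mul_assoc H, Hg, one_mul, hw, hw]
      linarith [hS.2 c d m j]
    have e2 : ∑ f, L f c • (w f d * H) = H * h * w c d * H := by
      rw [mul_assoc H, ← e1, Finset.mul_sum, Finset.sum_mul]
      exact Finset.sum_congr rfl fun f _ => by
        rw [mul_smul_comm, smul_mul_assoc, ← mul_assoc H, Hg, one_mul]
    rw [← e2, Matrix.sum_apply]; rfl
  refine ⟨L.trace / 4, ?_⟩
  have main : ∀ k l, (h - (L.trace / 4) • g) * w k l = 0 := fun k l => by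
    have e : H * h * w k l * H = (L.trace / 4) • (w k l * H) := by
      ext a b
      have := trace_mul_doubleForm C L h1 h2 T s2 s3 a b k l
      rw [X] at this
      rw [Matrix.smul_apply, smul_eq_mul]
      change L.trace * (w k l * H) a b = _ at this
      linarith
    have e' := congrArg (fun m => g * m * g) e
    simp only [mul_smul_comm, smul_mul_assoc, mul_assoc, Hg, mul_one] at e'
    rw [← mul_assoc g, gH, one_mul] at e'
    rw [sub_mul, e', smul_mul_assoc, sub_self]
  ext i a
  -- Each row of `h - (tr L / 4) g` is a covector annihilated by the Weyl tensor, hence zero.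
  by_contra hne
  obtain ⟨j, k, l, hx⟩ := nd (fun a => (h - (L.trace / 4) • g) i a) (fun h0 => hne (by
    have := congrFun h0 a
    simpa [sub_eq_zero] using this))
  apply hx
  have := congrFun (congrFun (main k l) i) j
  rw [Matrix.mul_apply] at this
  rw [← Matrix.zero_apply (α := ℝ) i j, ← this]
  exact Finset.sum_congr rfl fun a _ => mul_comm _ _

/-! ## Algebra of projective changes of connections -/

/-- A symmetric quadratic map `D` with `D(v,v)` proportional to `v` for all `v` is a product. -/
theorem eq_kd_of_parallel (D : Fin 4 → Fin 4 → Fin 4 → ℝ) (hs : ∀ a b c, D a b c = D a c b)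
    (hD : ∀ v : Fin 4 → ℝ, ∃ f : ℝ, ∀ a, ∑ b, ∑ c, D a b c * v b * v c = f * v a) (a b c : Fin 4) :
    D a b c = kd a b * (D c c c / 2) + kd a c * (D b b b / 2) := by
  have single : ∀ p a, a ≠ p → D a p p = 0 := fun p a hap => by
    obtain ⟨f, hf⟩ := hD (Pi.single p 1)
    simpa [Pi.single_apply, hap] using hf a
  -- Test vectors `e_p + s e_q`; the values `s = 1` and `s = -1` are enough to separate the mixed
  -- coefficients.
  have two : ∀ p q : Fin 4, p ≠ q → ∀ s : ℝ, ∃ f : ℝ, ∀ a,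
      D a p p + s * (2 * D a p q) + s ^ 2 * D a q q = f * (kd a p + s * kd a q) := fun p q hpq s => by
    obtain ⟨f, hf⟩ := hD (fun a => kd a p + s * kd a q)
    refine ⟨f, fun a => ?_⟩
    rw [← hf a]
    simp only [mul_add, add_mul, Finset.sum_add_distrib]
    have e : ∀ x y : Fin 4, ∀ u v : ℝ, ∑ b, ∑ c, D a b c * (u * kd b x) * (v * kd c y) = u * v * D a x y := by
      intro x y u v
      simp [kd]; ring
    have e1 := e p p 1 1
    have e2 := e p q 1 s
    have e3 := e q p s 1
    have e4 := e q q s s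
    simp only [one_mul] at e1 e2 e3 e4
    rw [e1, e2, e3, e4, hs a q p]; ring
  rcases eq_or_ne b c with rfl | hbc
  · rcases eq_or_ne a b with rfl | hab
    · simp [kd]
    · simp [kd, hab, single b a hab]
  · obtain ⟨f, hf⟩ := two b c hbc 1
    obtain ⟨f', hf'⟩ := two b c hbc (-1)
    have b1 := hf b
    have c1 := hf c
    have b2 := hf' b
    have c2 := hf' c
    simp only [kd, if_true, hbc, hbc.symm, if_false, single c b hbc, single b c hbc.symm] at b1 c1 b2 c2
    rcases eq_or_ne a b with rfl | hab
    · simp only [kd, if_true, hbc, if_false]; linarith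
    · rcases eq_or_ne a c with rfl | hac
      · simp only [kd, if_true, hab, if_false]; linarith
      · have := hf a
        simp only [kd, hab, hac, if_false, single c a hac, single b a hab] at this ⊢
        linarith

/-! ## Partial derivatives -/

theorem pd_congr {i : Fin 4} {f f' : E4 → ℝ} {x : E4} (h : f =ᶠ[nhds x] f') : pd i f x = pd i f' x := by
  rw [pd, pd, h.fderiv_eq]

theorem pd_congr_of_isOpen {O : Set E4} (hO : IsOpen O) {x : E4} (hx : x ∈ O) {f f' : E4 → ℝ}
    (h : ∀ y ∈ O, f y = f' y) (i : Fin 4) : pd i f x = pd i f' x :=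
  pd_congr (Filter.eventuallyEq_of_mem (hO.mem_nhds hx) h)

theorem pd_const (i : Fin 4) (c : ℝ) (x : E4) : pd i (fun _ => c) x = 0 := by simp [pd]

theorem pd_add {i : Fin 4} {f f' : E4 → ℝ} {x : E4} (hf : DifferentiableAt ℝ f x)
    (hf' : DifferentiableAt ℝ f' x) : pd i (fun y => f y + f' y) x = pd i f x + pd i f' x := by
  simp [pd, fderiv_fun_add hf hf']

theorem pd_sub {i : Fin 4} {f f' : E4 → ℝ} {x : E4} (hf : DifferentiableAt ℝ f x)
    (hf' : DifferentiableAt ℝ f' x) : pd i (fun y => f y - f' y) x = pd i f x - pd i f' x := by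
  simp [pd, fderiv_fun_sub hf hf']

theorem pd_mul {i : Fin 4} {f f' : E4 → ℝ} {x : E4} (hf : DifferentiableAt ℝ f x)
    (hf' : DifferentiableAt ℝ f' x) :
    pd i (fun y => f y * f' y) x = pd i f x * f' x + f x * pd i f' x := by
  simp [pd, fderiv_fun_mul hf hf']; ring

theorem pd_const_mul {i : Fin 4} {f : E4 → ℝ} {x : E4} (c : ℝ) :
    pd i (fun y => c * f y) x = c * pd i f x := by
  simp only [pd]
  rw [show (fun y => c * f y) = c • f from rfl, fderiv_const_smul_field]
  simp

theorem pd_sum {ι : Type*} (s : Finset ι) {i : Fin 4} {f : ι → E4 → ℝ} {x : E4}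
    (hf : ∀ a ∈ s, DifferentiableAt ℝ (f a) x) :
    pd i (fun y => ∑ a ∈ s, f a y) x = ∑ a ∈ s, pd i (f a) x := by
  simp [pd, fderiv_fun_sum hf]

theorem contDiffOn_pd {O : Set E4} (hO : IsOpen O) {f : E4 → ℝ} (hf : ContDiffOn ℝ ∞ f O)
    (i : Fin 4) : ContDiffOn ℝ ∞ (pd i f) O :=
  (hf.fderiv_of_isOpen hO (m := ∞) (by simp)).clm_apply contDiffOn_const

theorem differentiableAt_of_contDiffOn {O : Set E4} (hO : IsOpen O) {f : E4 → ℝ}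
    (hf : ContDiffOn ℝ ∞ f O) {x : E4} (hx : x ∈ O) : DifferentiableAt ℝ f x :=
  (hf.contDiffAt (hO.mem_nhds hx)).differentiableAt (by simp)

theorem pd_comm {O : Set E4} (hO : IsOpen O) {f : E4 → ℝ} (hf : ContDiffOn ℝ ∞ f O) {x : E4}
    (hx : x ∈ O) (k l : Fin 4) : pd l (pd k f) x = pd k (pd l f) x := by
  have h := hf.contDiffAt (hO.mem_nhds hx)
  have hsymm : IsSymmSndFDerivAt ℝ f x := h.isSymmSndFDerivAt (by
    rw [minSmoothness_of_isRCLikeNormedField]; 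
    exact WithTop.coe_le_coe.2 (le_top : (2 : ℕ∞) ≤ ⊤))
  have hd : DifferentiableAt ℝ (fderiv ℝ f) x :=
    (h.fderiv_right (m := ∞) (by simp)).differentiableAt (by simp)
  have e : ∀ k l, pd l (pd k f) x = fderiv ℝ (fderiv ℝ f) x (coordVec l) (coordVec k) := by
    intro k l
    change fderiv ℝ (fun y => fderiv ℝ f y (coordVec k)) x (coordVec l) = _
    rw [fderiv_clm_apply hd (differentiableAt_const _)]
    simp
  rw [e, e]
  exact hsymm _ _

/-! ## Smoothness of the inverse and of the Levi-Civita connection -/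

theorem contDiffOn_det {n : ℕ} {O : Set E4} {g : E4 → Matrix (Fin n) (Fin n) ℝ}
    (hg : ∀ i j, ContDiffOn ℝ ∞ (fun x => g x i j) O) : ContDiffOn ℝ ∞ (fun x => (g x).det) O := by
  simp only [Matrix.det_apply]
  exact ContDiffOn.sum fun σ _ => (contDiffOn_prod fun i _ => hg _ _).const_smul _

theorem contDiffOn_inv {O : Set E4} {g : E4 → Mat4} (hg : ∀ i j, ContDiffOn ℝ ∞ (fun x => g x i j) O)
    (hdet : ∀ x ∈ O, (g x).det ≠ 0) (i j : Fin 4) : ContDiffOn ℝ ∞ (fun x => (g x)⁻¹ i j) O := by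
  have e : ∀ x, (g x)⁻¹ i j = ((g x).det)⁻¹ * ((g x).updateRow j (Pi.single i 1)).det := fun x => by
    rw [Matrix.inv_def, Matrix.smul_apply, Ring.inverse_eq_inv', Matrix.adjugate_apply, smul_eq_mul]
  simp only [e]
  refine ((contDiffOn_det hg).inv hdet).mul (contDiffOn_det fun a b => ?_)
  simp only [Matrix.updateRow_apply]
  split_ifs
  · exact contDiffOn_const
  · exact hg a b

theorem IsMetricOn.isUnit_det {O : Set E4} {g : E4 → Mat4} (hg : IsMetricOn O g) {x : E4}
    (hx : x ∈ O) : IsUnit (g x).det := isUnit_iff_ne_zero.mpr (hg.nondeg x hx)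

theorem IsMetricOn.mul_inv {O : Set E4} {g : E4 → Mat4} (hg : IsMetricOn O g) {x : E4}
    (hx : x ∈ O) : g x * (g x)⁻¹ = 1 := Matrix.mul_nonsing_inv _ (hg.isUnit_det hx)

theorem IsMetricOn.inv_mul {O : Set E4} {g : E4 → Mat4} (hg : IsMetricOn O g) {x : E4}
    (hx : x ∈ O) : (g x)⁻¹ * g x = 1 := Matrix.nonsing_inv_mul _ (hg.isUnit_det hx)

theorem IsMetricOn.contDiffOn_inv {O : Set E4} {g : E4 → Mat4} (hg : IsMetricOn O g) (i j : Fin 4) :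
    ContDiffOn ℝ ∞ (fun x => (g x)⁻¹ i j) O := ProjRec.contDiffOn_inv hg.smooth hg.nondeg i j

theorem IsMetricOn.apply_comm {O : Set E4} {g : E4 → Mat4} (hg : IsMetricOn O g) {x : E4}
    (hx : x ∈ O) (i j : Fin 4) : g x i j = g x j i := (hg.symm x hx).apply _ _

/-- Christoffel symbols of the first kind of a metric with first derivatives `p k i j = ∂_k g_{ij}`. -/
def chr (p : Fin 4 → Fin 4 → Fin 4 → ℝ) (a b c : Fin 4) : ℝ :=
  (1 / 2) * (p b a c + p c a b - p a b c)

/-- The first partial derivatives `∂_k g_{ij}`. -/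
def jet1 (g : E4 → Mat4) (x : E4) (k i j : Fin 4) : ℝ := pd k (fun y => g y i j) x

/-- The second partial derivatives `∂_l ∂_k g_{ij}`. -/
def jet2 (g : E4 → Mat4) (x : E4) (l k i j : Fin 4) : ℝ := pd l (fun z => pd k (fun y => g y i j) z) x

theorem leviCivita_eq (g : E4 → Mat4) (x : E4) (a b c : Fin 4) :
    leviCivita g x a b c = ∑ d, (g x)⁻¹ a d * chr (jet1 g x) d b c := by
  simp only [leviCivita, chr, jet1, Finset.mul_sum]
  exact Finset.sum_congr rfl fun d _ => by ring

/-! ### The Riemann tensor of a metric in terms of its 2-jet -/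

section

variable {O : Set E4} {g : E4 → Mat4}

theorem IsMetricOn.jet1_comm (hO : IsOpen O) (hg : IsMetricOn O g) {x : E4} (hx : x ∈ O)
    (k i j : Fin 4) : jet1 g x k i j = jet1 g x k j i :=
  pd_congr_of_isOpen hO hx (fun _ hy => hg.apply_comm hy i j) k

theorem IsMetricOn.jet2_comm (hO : IsOpen O) (hg : IsMetricOn O g) {x : E4} (hx : x ∈ O)
    (l k i j : Fin 4) : jet2 g x l k i j = jet2 g x l k j i :=
  pd_congr_of_isOpen hO hx (fun _ hy => hg.jet1_comm hO hy k i j) l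

theorem IsMetricOn.jet2_swap (hO : IsOpen O) (hg : IsMetricOn O g) {x : E4} (hx : x ∈ O)
    (l k i j : Fin 4) : jet2 g x l k i j = jet2 g x k l i j :=
  pd_comm hO (hg.smooth i j) hx k l

theorem IsMetricOn.contDiffOn_jet1 (hO : IsOpen O) (hg : IsMetricOn O g) (k i j : Fin 4) :
    ContDiffOn ℝ ∞ (fun x => jet1 g x k i j) O := contDiffOn_pd hO (hg.smooth i j) k

theorem IsMetricOn.contDiffOn_jet2 (hO : IsOpen O) (hg : IsMetricOn O g) (l k i j : Fin 4) :
    ContDiffOn ℝ ∞ (fun x => jet2 g x l k i j) O :=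
  contDiffOn_pd hO (hg.contDiffOn_jet1 hO k i j) l

theorem IsMetricOn.contDiffOn_chr (hO : IsOpen O) (hg : IsMetricOn O g) (a b c : Fin 4) :
    ContDiffOn ℝ ∞ (fun x => chr (jet1 g x) a b c) O :=
  contDiffOn_const.mul (((hg.contDiffOn_jet1 hO _ _ _).add (hg.contDiffOn_jet1 hO _ _ _)).sub
    (hg.contDiffOn_jet1 hO _ _ _))

theorem chr_comm {p : Fin 4 → Fin 4 → Fin 4 → ℝ} (hp : ∀ k i j, p k i j = p k j i) (a b c : Fin 4) :
    chr p a b c = chr p a c b := by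
  simp only [chr, hp a b c]; ring

/-- Metric compatibility of the Levi-Civita connection, with lowered indices. -/
theorem chr_add_chr {p : Fin 4 → Fin 4 → Fin 4 → ℝ} (hp : ∀ k i j, p k i j = p k j i)
    (a b c : Fin 4) : chr p a c b + chr p b c a = p c a b := by
  simp only [chr, hp a c b, hp b c a, hp c b a]; ring

theorem IsMetricOn.isSymbolsOn (hO : IsOpen O) (hg : IsMetricOn O g) :
    IsSymbolsOn O (leviCivita g) where
  smooth a b c := by
    simp only [leviCivita_eq]
    exact ContDiffOn.sum fun d _ => (hg.contDiffOn_inv a d).mul (hg.contDiffOn_chr hO d b c)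
  symm x hx a b c := by
    simp only [leviCivita_eq]
    exact Finset.sum_congr rfl fun d _ => by rw [chr_comm (hg.jet1_comm hO hx)]

theorem IsMetricOn.lower_leviCivita (hg : IsMetricOn O g) {x : E4} (hx : x ∈ O)
    (i b c : Fin 4) : ∑ a, g x i a * leviCivita g x a b c = chr (jet1 g x) i b c := by
  simp only [leviCivita_eq]
  have : ∀ v : Fin 4 → ℝ, ∑ a, g x i a * ∑ d, (g x)⁻¹ a d * v d = v i := fun v => by
    have : (g x *ᵥ ((g x)⁻¹ *ᵥ v)) i = v i := by rw [Matrix.mulVec_mulVec, hg.mul_inv hx, Matrix.one_mulVec]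
    exact this
  exact this _

theorem IsMetricOn.raise_eq (hg : IsMetricOn O g) {x : E4} (hx : x ∈ O) {u v : Fin 4 → ℝ}
    (h : ∀ i, ∑ a, g x i a * u a = v i) (i : Fin 4) : u i = ∑ m, (g x)⁻¹ i m * v m := by
  have h' : g x *ᵥ u = v := funext h
  have : u = (g x)⁻¹ *ᵥ v := by rw [← h', Matrix.mulVec_mulVec, hg.inv_mul hx, Matrix.one_mulVec]
  exact congrFun this i

/-- The Riemann tensor with lowered index of a metric with inverse `H`, first derivatives `p` and
second derivatives `q`. -/
def lowCurv (H : Mat4) (p : Fin 4 → Fin 4 → Fin 4 → ℝ) (q : Fin 4 → Fin 4 → Fin 4 → Fin 4 → ℝ)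
    (i j k l : Fin 4) : ℝ :=
  (1 / 2) * (q l j i k - q l i k j - q k j i l + q k i l j)
    - ∑ a, ∑ b, H a b * (chr p a l i * chr p b k j - chr p a k i * chr p b l j)

/-- Derivatives of the inverse metric are avoided by writing `g ∂Γ = ∂(gΓ) - (∂g)Γ`. Metric
compatibility splits `∂g` into two Christoffel terms, one of which cancels the quadratic part of the
curvature. -/
theorem IsMetricOn.lower_curv (hO : IsOpen O) (hg : IsMetricOn O g) {x : E4} (hx : x ∈ O)
    (i j k l : Fin 4) : ∑ a, g x i a * curv (leviCivita g) x a j k l =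
      lowCurv (g x)⁻¹ (jet1 g x) (jet2 g x) i j k l := by
  have hLC := hg.isSymbolsOn hO
  have dL : ∀ a b c, DifferentiableAt ℝ (fun y => leviCivita g y a b c) x := fun a b c =>
    differentiableAt_of_contDiffOn hO (hLC.smooth a b c) hx
  have dg : ∀ a b, DifferentiableAt ℝ (fun y => g y a b) x := fun a b =>
    differentiableAt_of_contDiffOn hO (hg.smooth a b) hx
  have dj : ∀ a b c, DifferentiableAt ℝ (fun y => jet1 g y a b c) x := fun a b c =>
    differentiableAt_of_contDiffOn hO (hg.contDiffOn_jet1 hO a b c) hx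
  have pdchr : ∀ l k j, pd l (fun y => chr (jet1 g y) i k j) x =
      (1 / 2) * (jet2 g x l k i j + jet2 g x l j i k - jet2 g x l i k j) := fun l k j => by
    simp only [chr]
    rw [pd_const_mul, pd_sub ((dj _ _ _).fun_add (dj _ _ _)) (dj _ _ _), pd_add (dj _ _ _) (dj _ _ _)]
    rfl
  have key : ∀ l k j, ∑ a, g x i a * pd l (fun y => leviCivita g y a k j) x =
      pd l (fun y => chr (jet1 g y) i k j) x - ∑ a, jet1 g x l i a * leviCivita g x a k j := by
    intro l k j
    rw [← pd_congr_of_isOpen hO hx (fun y hy => hg.lower_leviCivita hy i k j) l,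
      pd_sum _ (fun a _ => (dg i a).fun_mul (dL a k j))]
    simp only [pd_mul (dg i _) (dL _ k j), Finset.sum_add_distrib]
    simp only [jet1]; ring
  have pm : ∀ (l : Fin 4) (u : Fin 4 → ℝ), ∑ a, jet1 g x l i a * u a =
      ∑ a, chr (jet1 g x) i l a * u a + ∑ a, chr (jet1 g x) a l i * u a := fun l u => by
    rw [← Finset.sum_add_distrib]
    exact Finset.sum_congr rfl fun a _ => by rw [← chr_add_chr (hg.jet1_comm hO hx) i a l]; ring
  have quad : ∀ l k j, ∑ a, g x i a * ∑ b, leviCivita g x a l b * leviCivita g x b k j =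
      ∑ b, chr (jet1 g x) i l b * leviCivita g x b k j := fun l k j => by
    simp only [Finset.mul_sum]
    rw [Finset.sum_comm]
    refine Finset.sum_congr rfl fun b _ => ?_
    rw [← hg.lower_leviCivita hx, Finset.sum_mul]
    exact Finset.sum_congr rfl fun a _ => by ring
  have last : ∀ l k j, ∑ a, chr (jet1 g x) a l i * leviCivita g x a k j =
      ∑ a, ∑ b, (g x)⁻¹ a b * (chr (jet1 g x) a l i * chr (jet1 g x) b k j) := fun l k j => by
    refine Finset.sum_congr rfl fun a _ => ?_
    rw [leviCivita_eq, Finset.mul_sum]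
    exact Finset.sum_congr rfl fun b _ => by ring
  simp only [curv, mul_add, mul_sub, Finset.sum_add_distrib, Finset.sum_sub_distrib, quad, key, pm,
    pdchr, last, lowCurv]
  rw [hg.jet2_swap hO hx l k i j]
  ring

theorem IsMetricOn.curv_eq (hO : IsOpen O) (hg : IsMetricOn O g) {x : E4} (hx : x ∈ O)
    (i j k l : Fin 4) : curv (leviCivita g) x i j k l =
      ∑ m, (g x)⁻¹ i m * lowCurv (g x)⁻¹ (jet1 g x) (jet2 g x) m j k l :=
  hg.raise_eq hx (fun i => hg.lower_curv hO hx i j k l) i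

/-- The symmetries are visible on the 2-jet formula; pair symmetry is where the commutation of
second derivatives enters. -/
theorem isCurvatureLike_lowCurv {H : Mat4} (hH : H.IsSymm) {p : Fin 4 → Fin 4 → Fin 4 → ℝ}
    {q : Fin 4 → Fin 4 → Fin 4 → Fin 4 → ℝ} (hp : ∀ k i j, p k i j = p k j i)
    (hq : ∀ l k i j, q l k i j = q l k j i) (hq' : ∀ l k i j, q l k i j = q k l i j) :
    IsCurvatureLike (lowCurv H p q) := by
  have S : ∀ a b c d, ∑ x, ∑ y, H x y * (chr p x a b * chr p y c d) =
      ∑ x, ∑ y, H x y * (chr p x c d * chr p y a b) := fun a b c d => by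
    rw [Finset.sum_comm]
    exact Finset.sum_congr rfl fun x _ => Finset.sum_congr rfl fun y _ => by rw [hH.apply]; ring
  constructor
  · intro i j k l
    simp only [lowCurv, mul_sub, Finset.sum_sub_distrib, chr_comm hp _ l, chr_comm hp _ k]
    rw [S i l j k, S i k j l, hq l i k j, hq l j i k, hq k i l j, hq k j i l]
    ring
  · intro i j k l
    simp only [lowCurv, mul_sub, Finset.sum_sub_distrib]
    ring
  · intro i j k l
    simp only [lowCurv, mul_sub, Finset.sum_sub_distrib]
    simp only [chr_comm hp _ i l, chr_comm hp _ j k, chr_comm hp _ i k, chr_comm hp _ j l]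
    rw [S k j l i, hq' j l, hq' i l, hq' j k, hq' i k, hq l j k i, hq k i j l]
    ring

theorem IsMetricOn.isCurvatureLike (hO : IsOpen O) (hg : IsMetricOn O g) {x : E4} (hx : x ∈ O) :
    IsCurvatureLike (lowCurv (g x)⁻¹ (jet1 g x) (jet2 g x)) :=
  isCurvatureLike_lowCurv (symm_inv (hg.symm x hx)) (hg.jet1_comm hO hx) (hg.jet2_comm hO hx)
    (hg.jet2_swap hO hx)

end

/-! ## Projective invariance of the Weyl tensor -/

section

variable {O : Set E4} {g : E4 → Mat4}

theorem sum_mul_projective (G M p : Fin 4 → ℝ) (v r s : ℝ) (i j k l : Fin 4) :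
    ∑ a, (G a + kd i l * p a + kd i a * v) * (M a + kd a k * r + kd a j * s) =
      ∑ a, G a * M a + G k * r + G j * s + kd i l * (∑ a, p a * M a + p k * r + p j * s)
        + v * (M i + kd i k * r + kd i j * s) := by
  have : ∀ a, (G a + kd i l * p a + kd i a * v) * (M a + kd a k * r + kd a j * s) =
      G a * M a + (G a * kd a k) * r + (G a * kd a j) * s + kd i l * (p a * M a)
        + (kd i l * r) * (p a * kd a k) + (kd i l * s) * (p a * kd a j)
        + v * (kd i a * M a) + (v * r) * (kd i a * kd a k) + (v * s) * (kd i a * kd a j) :=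
    fun a => by ring
  simp only [this, Finset.sum_add_distrib, ← Finset.sum_mul, ← Finset.mul_sum, sum_mul_kd',
    sum_kd_mul]
  ring

/-- `Γ' = Γ + δ φ` is a projective change of the connection `Γ` on `O`. -/
def IsProjChangeOn (O : Set E4) (Γ Γ' : Symbols) (φ : E4 → Fin 4 → ℝ) : Prop :=
  ∀ x ∈ O, ∀ a b c, Γ' x a b c = Γ x a b c + kd a b * φ x c + kd a c * φ x b

theorem IsProjChangeOn.curv_eq (hO : IsOpen O) {Γ Γ' : Symbols} {φ : E4 → Fin 4 → ℝ}
    (hΓ : IsSymbolsOn O Γ) (hφ : ∀ a, ContDiffOn ℝ ∞ (fun x => φ x a) O)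
    (h : IsProjChangeOn O Γ Γ' φ) {x : E4} (hx : x ∈ O) :
    ∃ Φ : Fin 4 → Fin 4 → ℝ, ∀ i j k l, curv Γ' x i j k l =
      curv Γ x i j k l + kd i k * Φ l j - kd i l * Φ k j + kd i j * (Φ l k - Φ k l) := by
  have dφ : ∀ a, DifferentiableAt ℝ (fun y => φ y a) x := fun a =>
    differentiableAt_of_contDiffOn hO (hφ a) hx
  have dΓ : ∀ a b c, DifferentiableAt ℝ (fun y => Γ y a b c) x := fun a b c =>
    differentiableAt_of_contDiffOn hO (hΓ.smooth a b c) hx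
  have hpd : ∀ l i k j, pd l (fun y => Γ' y i k j) x = pd l (fun y => Γ y i k j) x +
      kd i k * pd l (fun y => φ y j) x + kd i j * pd l (fun y => φ y k) x := fun l i k j => by
    rw [pd_congr_of_isOpen hO hx (fun y hy => h y hy i k j) l,
      pd_add ((dΓ i k j).fun_add ((dφ j).const_mul _)) ((dφ k).const_mul _),
      pd_add (dΓ i k j) ((dφ j).const_mul _), pd_const_mul, pd_const_mul]
  -- The tensor `∇_l φ_j - φ_l φ_j`, which need not be symmetric because `φ` need not be closed.
  refine ⟨fun l j => pd l (fun y => φ y j) x - ∑ a, φ x a * Γ x a l j - φ x l * φ x j,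
    fun i j k l => ?_⟩
  simp only [curv, hpd, h x hx, Finset.sum_sub_distrib]
  rw [sum_mul_projective, sum_mul_projective, hΓ.symm x hx i l k]
  simp only [hΓ.symm x hx _ k l]
  rw [hΓ.symm x hx i l j, hΓ.symm x hx i k j]
  ring

/-- The curvature changes only by Kronecker deltas times one tensor `Φ`. The Ricci tensor determines
both symmetry types of `Φ`, with different factors, and the weights 4 and 1 in the Schouten tensor
are those that cancel both. -/
theorem IsProjChangeOn.weyl_eq (hO : IsOpen O) {Γ Γ' : Symbols} {φ : E4 → Fin 4 → ℝ}
    (hΓ : IsSymbolsOn O Γ) (hφ : ∀ a, ContDiffOn ℝ ∞ (fun x => φ x a) O)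
    (h : IsProjChangeOn O Γ Γ' φ) {x : E4} (hx : x ∈ O) : weyl Γ' x = weyl Γ x := by
  obtain ⟨Φ, hΦ⟩ := h.curv_eq hO hΓ hφ hx
  have hric : ∀ j k, ricci Γ' x j k = ricci Γ x j k - 4 * Φ k j + Φ j k := fun j k => by
    simp only [ricci, hΦ, Finset.sum_add_distrib, Finset.sum_sub_distrib, mul_sub, sum_kd_mul',
      ← Finset.sum_mul, sum_kd_self]
    ring
  funext i j k l
  simp only [weyl, schouten, hΦ, hric]
  ring

theorem IsProjChangeOn.contDiffOn {Γ Γ' : Symbols} {φ : E4 → Fin 4 → ℝ}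
    (hΓ : IsSymbolsOn O Γ) (hΓ' : IsSymbolsOn O Γ')
    (h : IsProjChangeOn O Γ Γ' φ) (a : Fin 4) : ContDiffOn ℝ ∞ (fun x => φ x a) O := by
  have e : ∀ x ∈ O, φ x a = (1 / 2) * (Γ' x a a a - Γ x a a a) := fun x hx => by
    rw [h x hx a a a]; simp only [kd, if_true]; ring
  exact ContDiffOn.congr (contDiffOn_const.mul ((hΓ'.smooth a a a).sub (hΓ.smooth a a a))) e

/-! ## Curvature identities of a metric -/

theorem IsMetricOn.ricci_eq (hO : IsOpen O) (hg : IsMetricOn O g) {x : E4} (hx : x ∈ O)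
    (j k : Fin 4) : ricci (leviCivita g) x j k =
      ∑ a, ∑ m, (g x)⁻¹ a m * lowCurv (g x)⁻¹ (jet1 g x) (jet2 g x) m j k a := by
  simp only [ricci, hg.curv_eq hO hx]

theorem IsMetricOn.inv_comm (hg : IsMetricOn O g) {x : E4} (hx : x ∈ O) (i j : Fin 4) :
    (g x)⁻¹ i j = (g x)⁻¹ j i := (symm_inv (hg.symm x hx)).apply _ _

theorem IsMetricOn.ricci_comm (hO : IsOpen O) (hg : IsMetricOn O g) {x : E4} (hx : x ∈ O)
    (j k : Fin 4) : ricci (leviCivita g) x j k = ricci (leviCivita g) x k j := by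
  have hR := hg.isCurvatureLike hO hx
  rw [hg.ricci_eq hO hx, hg.ricci_eq hO hx, Finset.sum_comm]
  refine Finset.sum_congr rfl fun a _ => Finset.sum_congr rfl fun m _ => ?_
  rw [hg.inv_comm hx, hR.pair, hR.anti_left, hR.anti_right, neg_neg]

/-- With an index raised by `g⁻¹` the curvature is skew in the first pair, so symmetrization removes
it from the left side. The remaining Ricci terms match the trace on the right. -/
theorem IsMetricOn.tractorSystem_inv (hO : IsOpen O) (hg : IsMetricOn O g) {x : E4} (hx : x ∈ O) :
    TractorSystem (weyl (leviCivita g) x) (g x)⁻¹ := by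
  have hR := hg.isCurvatureLike hO hx
  have hc := hg.inv_comm hx
  set H := (g x)⁻¹ with hH
  set R := lowCurv H (jet1 g x) (jet2 g x) with hRdef
  set Ric := ricci (leviCivita g) x with hRic
  have hW := weyl_eq_of_ricci_symm (leviCivita g) x (hg.ricci_comm hO hx)
  have hcv : ∀ i j k l, curv (leviCivita g) x i j k l = ∑ m, H i m * R m j k l :=
    fun i j k l => hg.curv_eq hO hx i j k l
  have hU : ∀ i j k l, ∑ a, H a i * curv (leviCivita g) x j a k l
      = - ∑ a, H a j * curv (leviCivita g) x i a k l := fun i j k l => by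
    simp only [hcv, Finset.mul_sum]
    rw [Finset.sum_comm, ← Finset.sum_neg_distrib]
    refine Finset.sum_congr rfl fun m _ => ?_
    rw [← Finset.sum_neg_distrib]
    refine Finset.sum_congr rfl fun a _ => ?_
    rw [hR.anti_left, hc j m, hc a i]; ring
  have hY : ∀ i l, ∑ a, ∑ b, H a b * curv (leviCivita g) x i a b l = ∑ a, H a i * Ric a l := fun i l => by
    have e : ∀ m, Ric m l = ∑ a, ∑ b, H a b * R m a b l := fun m => by
      rw [hRic, hg.ricci_eq hO hx, Finset.sum_comm]
      refine Finset.sum_congr rfl fun a _ => Finset.sum_congr rfl fun b _ => ?_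
      change H b a * R a m l b = _
      rw [hc b a, hR.anti_left, hR.anti_right, neg_neg]
    simp only [hcv, e, Finset.mul_sum]
    rw [Finset.sum_comm' (t' := Finset.univ) (s' := fun _ => Finset.univ) (by simp)]
    rw [Finset.sum_congr rfl fun b _ => Finset.sum_comm]
    rw [Finset.sum_comm]
    refine Finset.sum_congr rfl fun m _ => ?_
    rw [Finset.sum_comm]
    refine Finset.sum_congr rfl fun a _ => Finset.sum_congr rfl fun b _ => ?_
    rw [hc i m]; ring
  have hl : ∀ i j k l, ∑ a, H a i * weyl (leviCivita g) x j a k l =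
      ∑ a, H a i * curv (leviCivita g) x j a k l
        - (1 / 3) * (kd j l * ∑ a, H a i * Ric a k - kd j k * ∑ a, H a i * Ric a l) := fun i j k l => by
    simp only [hW, mul_sub, Finset.sum_sub_distrib, Finset.mul_sum]
    congr 1; congr 1 <;> exact Finset.sum_congr rfl fun a _ => by ring
  have hr : ∀ i l, ∑ a, ∑ b, H a b * weyl (leviCivita g) x i a b l =
      (4 / 3) * ∑ a, H a i * Ric a l - (1 / 3) * kd i l * ∑ a, ∑ b, H a b * Ric a b := fun i l => by
    have e : ∀ a, ∑ b, H a b * (kd i b * Ric a l) = H a i * Ric a l := fun a => by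
      simp [kd]
    have e1 : ∑ a, ∑ b, H a b * weyl (leviCivita g) x i a b l =
        ∑ a, ∑ b, H a b * curv (leviCivita g) x i a b l
          - ((1 / 3) * kd i l * ∑ a, ∑ b, H a b * Ric a b
            - (1 / 3) * ∑ a, ∑ b, H a b * (kd i b * Ric a l)) := by
      simp only [hW, mul_sub, Finset.sum_sub_distrib, Finset.mul_sum]
      congr 1; congr 1 <;>
        exact Finset.sum_congr rfl fun a _ => Finset.sum_congr rfl fun b _ => by ring
    rw [e1, hY]
    simp only [e]
    ring
  intro i j k l
  have e : ∑ a, ∑ b, H a b * (weyl (leviCivita g) x i a b l * kd j k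
        - weyl (leviCivita g) x i a b k * kd j l + weyl (leviCivita g) x j a b l * kd i k
        - weyl (leviCivita g) x j a b k * kd i l) =
      (∑ a, ∑ b, H a b * weyl (leviCivita g) x i a b l) * kd j k
        - (∑ a, ∑ b, H a b * weyl (leviCivita g) x i a b k) * kd j l
        + (∑ a, ∑ b, H a b * weyl (leviCivita g) x j a b l) * kd i k
        - (∑ a, ∑ b, H a b * weyl (leviCivita g) x j a b k) * kd i l := by
    simp only [mul_sub, mul_add, Finset.sum_sub_distrib, Finset.sum_add_distrib, Finset.sum_mul,
      mul_assoc]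
  -- The scalar curvature terms on the right cancel after symmetrizing in `i`, `j` and
  -- skew-symmetrizing in `k`, `l`.
  rw [e, hl, hl, hr, hr, hr, hr, hU i j]
  ring

theorem weyl_eq_curv_of_ricci_eq_zero {Γ : Symbols} {x : E4} (h : ∀ j k, ricci Γ x j k = 0) :
    weyl Γ x = curv Γ x := by
  funext i j k l
  simp [weyl, schouten, h]

theorem TractorSystem.smul {W : Fin 4 → Fin 4 → Fin 4 → Fin 4 → ℝ} {S : Mat4}
    (h : TractorSystem W S) (c : ℝ) : TractorSystem W (c • S) := by
  intro i j k l
  have := h i j k l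
  simp only [Matrix.smul_apply, smul_eq_mul, mul_assoc, ← Finset.mul_sum]
  rw [← this]; ring

theorem RiemannSystem.smul {W : Fin 4 → Fin 4 → Fin 4 → Fin 4 → ℝ} {h : Mat4}
    (hh : RiemannSystem W h) (c : ℝ) : RiemannSystem W (c • h) := by
  constructor
  · intro i j k m
    simp only [Matrix.smul_apply, smul_eq_mul, mul_assoc, ← Finset.mul_sum]
    rw [← mul_add, hh.1, mul_zero]
  · intro i j k m
    simp only [Matrix.smul_apply, smul_eq_mul, mul_assoc, ← Finset.mul_sum]
    rw [← mul_sub, hh.2, mul_zero]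

/-- The solutions of the Riemann system of a Ricci-flat metric with nondegenerate curvature. -/
theorem IsMetricOn.riemannSystem_iff (hO : IsOpen O) (hg : IsMetricOn O g) {x : E4} (hx : x ∈ O)
    (hric : ∀ j k, ricci (leviCivita g) x j k = 0)
    (nd : ∀ ξ : Fin 4 → ℝ, ξ ≠ 0 → ∃ j k l, ∑ a, weyl (leviCivita g) x a j k l * ξ a ≠ 0)
    {h : Mat4} (hh : h.IsSymm) :
    RiemannSystem (weyl (leviCivita g) x) h ↔ ∃ c : ℝ, h = c • g x := by
  have hR : IsCurvatureLike (fun i j k l => ∑ a, g x i a * weyl (leviCivita g) x a j k l) := by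
    rw [weyl_eq_curv_of_ricci_eq_zero hric]
    simp only [hg.lower_curv hO hx]
    exact hg.isCurvatureLike hO hx
  constructor
  · refine eq_smul_of_riemannSystem (hg.symm x hx) (hg.nondeg x hx) hh hR (fun j k => ?_) nd
    rw [weyl_eq_curv_of_ricci_eq_zero hric]
    exact hric j k
  · rintro ⟨c, rfl⟩
    refine RiemannSystem.smul ⟨fun i j k m => ?_, fun i j k m => ?_⟩ c
    · have := hR.anti_left i j k m
      linarith
    · have := hR.pair i j k m
      linarith

end

/-! ## The weighted tensor of a metric is parallel -/

section

variable {O : Set E4} {g : E4 → Mat4}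

theorem pd_prod {n : ℕ} {i : Fin 4} {f : Fin n → E4 → ℝ} {x : E4}
    (hf : ∀ a, DifferentiableAt ℝ (f a) x) :
    pd i (fun y => ∏ a, f a y) x =
      ∑ k, (∏ a ∈ Finset.univ.erase k, f a x) * pd i (f k) x := by
  have := (HasFDerivAt.finsetProd (u := Finset.univ) fun a _ => (hf a).hasFDerivAt).fderiv
  rw [pd, this]
  simp [pd]

/-- Jacobi's formula. -/
theorem pd_det (hg : ∀ a b, DifferentiableAt ℝ (fun y => g y a b) x) (i : Fin 4) :
    pd i (fun y => (g y).det) x =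
      ∑ k, ∑ a, (g x).adjugate k a * pd i (fun y => g y a k) x := by
  have e : ∀ k, ∑ a, (g x).adjugate k a * pd i (fun y => g y a k) x =
      ((g x).updateCol k fun a => pd i (fun y => g y a k) x).det := fun k => by
    rw [← Matrix.cramer_apply, Matrix.cramer_eq_adjugate_mulVec]; rfl
  simp only [e, Matrix.det_apply, Units.smul_def, zsmul_eq_mul]
  rw [pd_sum _ (fun σ _ => (HasFDerivAt.finsetProd fun a _ =>
      (hg (σ a) a).hasFDerivAt).differentiableAt.const_mul _),
    Finset.sum_comm]
  refine Finset.sum_congr rfl fun σ _ => ?_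
  rw [pd_const_mul, pd_prod (fun a => hg _ _), Finset.mul_sum]
  refine Finset.sum_congr rfl fun k _ => ?_
  rw [← Finset.mul_prod_erase Finset.univ _ (Finset.mem_univ k)]
  simp only [Matrix.updateCol_self]
  rw [mul_comm (pd _ _ _)]
  congr 2
  exact Finset.prod_congr rfl fun a ha => by rw [Matrix.updateCol_ne (Finset.ne_of_mem_erase ha)]

theorem IsMetricOn.pd_det (hO : IsOpen O) (hg : IsMetricOn O g) {x : E4} (hx : x ∈ O) (i : Fin 4) :
    pd i (fun y => (g y).det) x = (g x).det * ∑ a, ∑ b, (g x)⁻¹ a b * jet1 g x i a b := by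
  rw [ProjRec.pd_det (fun a b => differentiableAt_of_contDiffOn hO (hg.smooth a b) hx), Finset.mul_sum]
  refine Finset.sum_congr rfl fun k _ => ?_
  rw [Finset.mul_sum]
  refine Finset.sum_congr rfl fun a _ => ?_
  rw [hg.jet1_comm hO hx, Matrix.inv_def, Matrix.smul_apply, Ring.inverse_eq_inv', smul_eq_mul,
    ← mul_assoc, ← mul_assoc, mul_inv_cancel₀ (hg.nondeg x hx), one_mul]
  rfl

theorem abs_rpow_eq_exp {u : ℝ} (hu : u ≠ 0) (r : ℝ) : |u| ^ r = Real.exp (Real.log u * r) := by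
  rw [Real.rpow_def_of_pos (abs_pos.mpr hu), Real.log_abs]

/-- The density `|det g|^{1/5}`. -/
def density (g : E4 → Mat4) (x : E4) : ℝ := |(g x).det| ^ ((1 : ℝ) / 5)

theorem weighted_apply (g : E4 → Mat4) (x : E4) (b c : Fin 4) :
    weighted g x b c = density g x * (g x)⁻¹ b c := rfl

theorem IsMetricOn.density_pos (hg : IsMetricOn O g) {x : E4} (hx : x ∈ O) : 0 < density g x :=
  Real.rpow_pos_of_pos (abs_pos.mpr (hg.nondeg x hx)) _

theorem IsMetricOn.contDiffOn_density (hg : IsMetricOn O g) : ContDiffOn ℝ ∞ (density g) O := by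
  have e : ∀ x ∈ O, density g x = Real.exp (Real.log (g x).det * (1 / 5)) := fun x hx =>
    abs_rpow_eq_exp (hg.nondeg x hx) _
  exact ContDiffOn.congr ((((contDiffOn_det hg.smooth).log hg.nondeg).mul contDiffOn_const).exp) e

theorem IsMetricOn.contDiffOn_weighted (hg : IsMetricOn O g) (b c : Fin 4) :
    ContDiffOn ℝ ∞ (fun x => weighted g x b c) O :=
  hg.contDiffOn_density.mul (hg.contDiffOn_inv b c)

theorem IsMetricOn.pd_density (hO : IsOpen O) (hg : IsMetricOn O g) {x : E4} (hx : x ∈ O) (i : Fin 4) :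
    pd i (density g) x = density g x * ((1 / 5) * ∑ a, ∑ b, (g x)⁻¹ a b * jet1 g x i a b) := by
  have hd : DifferentiableAt ℝ (fun y => (g y).det) x :=
    differentiableAt_of_contDiffOn hO (contDiffOn_det hg.smooth) hx
  have e : ∀ y ∈ O, density g y = Real.exp (Real.log (g y).det * (1 / 5)) := fun x hx =>
    abs_rpow_eq_exp (hg.nondeg x hx) _
  rw [pd_congr_of_isOpen hO hx e, e x hx, pd]
  have h1 := ((hd.hasFDerivAt.log (hg.nondeg x hx)).mul_const (1 / 5)).exp
  have h2 := hg.pd_det hO hx i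
  rw [pd] at h2
  rw [h1.fderiv]
  simp only [smul_apply, smul_eq_mul, h2]
  rw [← mul_assoc ((g x).det)⁻¹, inv_mul_cancel₀ (hg.nondeg x hx), one_mul]

/-- Differentiation of `g⁻¹ g = 1`. -/
theorem IsMetricOn.pd_inv (hO : IsOpen O) (hg : IsMetricOn O g) {x : E4} (hx : x ∈ O) (a b c : Fin 4) :
    pd a (fun y => (g y)⁻¹ b c) x =
      - ∑ e, ∑ f, (g x)⁻¹ b e * (g x)⁻¹ c f * jet1 g x a e f := by
  have dg : ∀ a b, DifferentiableAt ℝ (fun y => g y a b) x := fun a b =>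
    differentiableAt_of_contDiffOn hO (hg.smooth a b) hx
  have dH : ∀ a b, DifferentiableAt ℝ (fun y => (g y)⁻¹ a b) x := fun a b =>
    differentiableAt_of_contDiffOn hO (hg.contDiffOn_inv a b) hx
  have h : ∀ f, ∑ e, g x f e * pd a (fun y => (g y)⁻¹ b e) x = - ∑ e, (g x)⁻¹ b e * jet1 g x a e f := by
    intro f
    have h0 : ∀ y ∈ O, ∑ e, (g y)⁻¹ b e * g y e f = kd b f := fun y hy => by
      rw [← one_apply_eq_kd, ← hg.inv_mul hy]; rfl
    have h1 := pd_congr_of_isOpen hO hx h0 a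
    rw [pd_const, pd_sum _ (fun e _ => (dH b e).fun_mul (dg e f))] at h1
    simp only [pd_mul (dH b _) (dg _ f), Finset.sum_add_distrib] at h1
    rw [eq_neg_iff_add_eq_zero, ← h1]
    congr 1
    exact Finset.sum_congr rfl fun e _ => by rw [hg.apply_comm hx f e, mul_comm]
  rw [hg.raise_eq hx h c, Finset.sum_comm, ← Finset.sum_neg_distrib]
  refine Finset.sum_congr rfl fun f _ => ?_
  rw [mul_neg, Finset.mul_sum]
  congr 1
  exact Finset.sum_congr rfl fun e _ => by ring

theorem IsMetricOn.sum_leviCivita (hO : IsOpen O) (hg : IsMetricOn O g) {x : E4} (hx : x ∈ O)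
    (a : Fin 4) : ∑ d, leviCivita g x d d a = (1 / 2) * ∑ d, ∑ e, (g x)⁻¹ d e * jet1 g x a d e := by
  have sw : ∑ d, ∑ e, (g x)⁻¹ d e * jet1 g x d e a = ∑ d, ∑ e, (g x)⁻¹ d e * jet1 g x e d a := by
    rw [Finset.sum_comm]
    exact Finset.sum_congr rfl fun d _ => Finset.sum_congr rfl fun e _ => by rw [hg.inv_comm hx]
  have e : ∀ d e, (g x)⁻¹ d e * chr (jet1 g x) e d a = (1 / 2) * ((g x)⁻¹ d e * jet1 g x d e a)
      + (1 / 2) * ((g x)⁻¹ d e * jet1 g x a d e) - (1 / 2) * ((g x)⁻¹ d e * jet1 g x e d a) := by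
    intro d e
    rw [chr, hg.jet1_comm hO hx a e d]; ring
  simp only [leviCivita_eq, e, Finset.sum_add_distrib, Finset.sum_sub_distrib, ← Finset.mul_sum, sw]
  ring

/-- The Christoffel terms cancel the derivative of `g⁻¹` by metric compatibility. The weight term
`2/5` cancels the derivative of `|det g|^{1/5}`, which is `(2/5) Γ^d_{da}` times the density. -/
theorem IsMetricOn.covDeriv_weighted (hO : IsOpen O) (hg : IsMetricOn O g) {x : E4} (hx : x ∈ O)
    (a b c : Fin 4) : covDeriv (leviCivita g) (weighted g) x a b c = 0 := by
  have d1 : DifferentiableAt ℝ (density g) x := differentiableAt_of_contDiffOn hO hg.contDiffOn_density hx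
  have d2 := differentiableAt_of_contDiffOn hO (hg.contDiffOn_inv b c) hx
  have e1 : ∑ d, leviCivita g x b a d * weighted g x d c + ∑ d, leviCivita g x c d a * weighted g x b d
      = density g x * ∑ e, ∑ f, (g x)⁻¹ b e * (g x)⁻¹ c f * jet1 g x a e f := by
    have s1 : ∑ d, leviCivita g x b a d * weighted g x d c =
        ∑ e, ∑ f, density g x * ((g x)⁻¹ b e * (g x)⁻¹ c f * chr (jet1 g x) e f a) := by
      rw [Finset.sum_comm]
      refine Finset.sum_congr rfl fun d _ => ?_
      rw [leviCivita_eq, weighted_apply, Finset.sum_mul]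
      exact Finset.sum_congr rfl fun e _ => by
        rw [hg.inv_comm hx d c, chr_comm (hg.jet1_comm hO hx)]; ring
    have s2 : ∑ d, leviCivita g x c d a * weighted g x b d =
        ∑ e, ∑ f, density g x * ((g x)⁻¹ b e * (g x)⁻¹ c f * chr (jet1 g x) f e a) := by
      refine Finset.sum_congr rfl fun d _ => ?_
      rw [leviCivita_eq, weighted_apply, Finset.sum_mul]
      exact Finset.sum_congr rfl fun e _ => by ring
    rw [s1, s2, ← Finset.sum_add_distrib, Finset.mul_sum]
    refine Finset.sum_congr rfl fun e _ => ?_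
    rw [← Finset.sum_add_distrib, Finset.mul_sum]
    refine Finset.sum_congr rfl fun f _ => ?_
    rw [← chr_add_chr (hg.jet1_comm hO hx) e f a, chr_comm (hg.jet1_comm hO hx) e f a,
      chr_comm (hg.jet1_comm hO hx) f e a, chr_comm (hg.jet1_comm hO hx) e a f]
    ring
  have e0 : pd a (fun y => weighted g y b c) x =
      pd a (density g) x * (g x)⁻¹ b c + density g x * pd a (fun y => (g y)⁻¹ b c) x := pd_mul d1 d2
  rw [covDeriv, add_assoc (pd a _ x), e1, e0, hg.pd_density hO hx, hg.pd_inv hO hx,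
    hg.sum_leviCivita hO hx, weighted_apply]
  ring

/-! ## Metrizability equations and projective changes -/

theorem covDeriv_sub (Γ Γ' : Symbols) (σ : E4 → Mat4) (x : E4) (a b c : Fin 4) :
    covDeriv Γ' σ x a b c = covDeriv Γ σ x a b c
      + (∑ d, (Γ' x b a d - Γ x b a d) * σ x d c + ∑ d, (Γ' x c d a - Γ x c d a) * σ x b d
        - (2 / 5) * (∑ d, (Γ' x d d a - Γ x d d a)) * σ x b c) := by
  simp only [covDeriv, sub_mul, Finset.sum_sub_distrib]
  ring

/-- The difference tensor of the metrizability equations. -/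
def diffTerm (D : Fin 4 → Fin 4 → Fin 4 → ℝ) (A : Mat4) (a b c : Fin 4) : ℝ :=
  ∑ d, D b a d * A d c + ∑ d, D c d a * A b d - (2 / 5) * (∑ d, D d d a) * A b c

/-- The terms `φ_a A^{bc}` cancel: two come from the tensor indices, and the weight contributes
`-(2/5)·5`. -/
theorem diffTerm_projective {A : Mat4} (hA : A.IsSymm) (φ : Fin 4 → ℝ) (a b c : Fin 4) :
    diffTerm (fun a b c => kd a b * φ c + kd a c * φ b) A a b c =
      kd b a * ∑ d, φ d * A d c + kd c a * ∑ d, φ d * A d b := by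
  have e1 : ∑ d, (kd b a * φ d + kd b d * φ a) * A d c = kd b a * ∑ d, φ d * A d c + φ a * A b c := by
    simp only [add_mul, Finset.sum_add_distrib, Finset.mul_sum, mul_assoc, sum_kd_mul]
  have e2 : ∑ d, (kd c d * φ a + kd c a * φ d) * A b d = kd c a * ∑ d, φ d * A d b + φ a * A b c := by
    simp only [add_mul, Finset.sum_add_distrib, Finset.mul_sum, mul_assoc, sum_kd_mul, hA.apply b]
    ring
  have e3 : ∑ d, (kd d d * φ a + kd d a * φ d) = 5 * φ a := by
    rw [Finset.sum_add_distrib, ← Finset.sum_mul, sum_kd_self, sum_kd_mul']; ring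
  rw [diffTerm, e1, e2, e3]; ring

/-- As in the uniqueness of the Levi-Civita connection, a torsion-free difference is recovered from
its action on a nondegenerate symmetric tensor. The result is a projective change plus a term
`G_{aq} n^b`, and a trace shows `n = 0`. -/
theorem eq_projective_of_diffTerm {A : Mat4} (hA : A.IsSymm) (hdet : A.det ≠ 0)
    {D : Fin 4 → Fin 4 → Fin 4 → ℝ} (hD : ∀ a b c, D a b c = D a c b) {μ : Fin 4 → ℝ}
    (h : ∀ a b c, diffTerm D A a b c = μ b * kd c a + μ c * kd b a) :
    ∃ φ : Fin 4 → ℝ, ∀ a b c, D a b c = kd a b * φ c + kd a c * φ b := by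
  have hu : IsUnit A.det := isUnit_iff_ne_zero.mpr hdet
  set G := A⁻¹ with hG
  have HS : Gᵀ = G := symm_inv hA
  have gs : ∀ i j, G i j = G j i := fun i j => congrFun (congrFun HS j) i
  have AG : A * G = 1 := Matrix.mul_nonsing_inv _ hu
  have GA : G * A = 1 := Matrix.nonsing_inv_mul _ hu
  set τ : Fin 4 → ℝ := fun a => ∑ d, D d d a with hτ
  let Dm : Fin 4 → Mat4 := fun a => Matrix.of fun b d => D b a d
  set m := G *ᵥ μ with hm
  -- The hypothesis with both upper indices lowered by `G`: it prescribes the symmetrization of the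
  -- lowered difference in its first and last slots.
  have low : ∀ a p q, (G * Dm a) p q + (G * Dm a) q p - (2 / 5) * τ a * G p q
      = m p * G a q + G p a * m q := by
    intro a p q
    have hE : Dm a * A + A * (Dm a)ᵀ - (2 / 5 * τ a) • A = Matrix.of fun b c => diffTerm D A a b c := by
      ext b c
      simp only [Matrix.sub_apply, Matrix.add_apply, Matrix.mul_apply, Matrix.smul_apply, smul_eq_mul,
        Matrix.transpose_apply, diffTerm, Dm, Matrix.of_apply, hD c _ a, hτ]
      congr 2
      exact Finset.sum_congr rfl fun d _ => mul_comm _ _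
    have hE' := congrFun (congrFun (congrArg (fun M => G * M * G) hE) p) q
    have l : G * (Dm a * A + A * (Dm a)ᵀ - (2 / 5 * τ a) • A) * G =
        G * Dm a + (G * Dm a)ᵀ - (2 / 5 * τ a) • G := by
      rw [mul_sub, sub_mul, mul_add, add_mul, mul_assoc G (Dm a * A), mul_assoc (Dm a), AG, mul_one,
        ← mul_assoc G A, GA, one_mul, mul_smul_comm, GA, smul_mul_assoc, one_mul,
        Matrix.transpose_mul, HS]
    rw [l] at hE'
    have r : (G * (Matrix.of fun b c => diffTerm D A a b c) * G) p q = m p * G a q + G p a * m q := by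
      have r0 : (Matrix.of fun b c => diffTerm D A a b c) =
          Matrix.vecMulVec μ (Pi.single a 1) + Matrix.vecMulVec (Pi.single a 1) μ := by
        ext b c
        simp [h, Matrix.vecMulVec_apply, kd, Pi.single_apply, mul_comm]
      rw [r0, mul_add, add_mul, Matrix.mul_vecMulVec, Matrix.mul_vecMulVec, Matrix.vecMulVec_mul,
        Matrix.vecMulVec_mul, Matrix.add_apply, Matrix.vecMulVec_apply, Matrix.vecMulVec_apply]
      have v1 : μ ᵥ* G = m := by rw [hm, ← Matrix.vecMul_transpose, HS]
      rw [v1]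
      simp [hm]
    rw [← r, ← hE']
    rfl
  have Xs : ∀ p a q, (G * Dm a) p q = (G * Dm q) p a := fun p a q => by
    rw [Matrix.mul_apply, Matrix.mul_apply]
    exact Finset.sum_congr rfl fun b _ => congrArg (G p b * ·) (hD b a q)
  -- Koszul's alternating sum of three permutations, using the symmetry `Xs` in the last two slots.
  have X : ∀ p a q, (G * Dm a) p q = (1 / 5) * (τ a * G p q + τ q * G p a - τ p * G a q)
      + G a q * m p := by
    intro p a q
    have l1 := low a p q
    have l2 := low q p a
    have l3 := low p a q
    rw [Xs p q a, Xs a q p] at l2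
    rw [Xs q p a] at l3
    rw [gs p a, gs p q] at *
    rw [gs a q] at *
    linarith
  set n : Fin 4 → ℝ := fun b => μ b - (1 / 5) * (A *ᵥ τ) b with hn
  have R : ∀ b a q, D b a q = (1 / 5) * (kd b q * τ a + kd b a * τ q) + G a q * n b := by
    intro b a q
    have e : D b a q = ∑ p, A b p * (G * Dm a) p q := by
      have : (A * (G * Dm a)) b q = D b a q := by rw [← mul_assoc, AG, one_mul]; rfl
      exact this.symm
    have k : ∀ q, ∑ p, A b p * G p q = kd b q := fun q => by
      rw [← one_apply_eq_kd, ← AG]; rfl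
    have k2 : ∑ p, A b p * m p = μ b := by
      have : (A *ᵥ m) b = μ b := by rw [hm, Matrix.mulVec_mulVec, AG, Matrix.one_mulVec]
      exact this
    have k3 : ∑ p, A b p * τ p = (A *ᵥ τ) b := rfl
    have s : ∀ p, A b p * (G * Dm a) p q = (1 / 5 * τ a) * (A b p * G p q)
        + (1 / 5 * τ q) * (A b p * G p a) - (1 / 5 * G a q) * (A b p * τ p) + G a q * (A b p * m p) :=
      fun p => by rw [X]; ring
    rw [e]
    simp only [s, Finset.sum_add_distrib, Finset.sum_sub_distrib, ← Finset.mul_sum, k, k2, k3, hn]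
    ring
  -- Tracing `R` over the upper and the first lower index reproduces `τ` exactly, leaving `G n = 0`.
  have hn0 : n = 0 := by
    have t : G *ᵥ n = 0 := by
      ext q
      have h1 : τ q = (1 / 5) * (τ q + 4 * τ q) + (G *ᵥ n) q := by
        have : τ q = ∑ a, ((1 / 5) * (kd a q * τ a + kd a a * τ q) + G q a * n a) :=
          Finset.sum_congr rfl fun a _ => by rw [R, gs a q]
        refine this.trans ?_
        simp only [Finset.sum_add_distrib, ← Finset.mul_sum, sum_kd_mul', ← Finset.sum_mul, sum_kd_self]
        rfl
      simp only [Pi.zero_apply]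
      linarith
    have := congrArg (fun v => A *ᵥ v) t
    simpa [Matrix.mulVec_mulVec, AG] using this
  refine ⟨fun c => (1 / 5) * τ c, fun a b c => ?_⟩
  rw [R, hn0]
  simp only [Pi.zero_apply]
  ring

theorem weighted_isSymm (hg : IsMetricOn O g) {x : E4} (hx : x ∈ O) : (weighted g x).IsSymm := by
  rw [Matrix.IsSymm, weighted, Matrix.transpose_smul, symm_inv (hg.symm x hx)]

theorem IsMetricOn.det_weighted_ne_zero (hg : IsMetricOn O g) {x : E4} (hx : x ∈ O) :
    (weighted g x).det ≠ 0 := by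
  rw [weighted, Matrix.det_smul]
  refine mul_ne_zero (pow_ne_zero _ (hg.density_pos hx).ne') ?_
  rw [Matrix.det_nonsing_inv, Ring.inverse_eq_inv']
  exact inv_ne_zero (hg.nondeg x hx)

theorem IsMetricOn.covDeriv_eq_diffTerm (hO : IsOpen O) (hg : IsMetricOn O g) (Γ : Symbols) {x : E4}
    (hx : x ∈ O) (a b c : Fin 4) : covDeriv Γ (weighted g) x a b c =
      diffTerm (fun a b c => Γ x a b c - leviCivita g x a b c) (weighted g x) a b c := by
  rw [covDeriv_sub (leviCivita g) Γ, hg.covDeriv_weighted hO hx, zero_add]; rfl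

/-- As the weighted tensor is parallel for `g`, only the difference of the connections acts on it;
the metrizability equations say that this action is pure trace. -/
theorem IsMetricOn.metrizability_eq_zero_iff (hO : IsOpen O) (hg : IsMetricOn O g) {Γ : Symbols}
    (hΓ : IsSymbolsOn O Γ) {x : E4} (hx : x ∈ O) :
    (∀ a b c, metrizability Γ (weighted g) x a b c = 0) ↔
      ∃ φ : Fin 4 → ℝ, ∀ a b c, Γ x a b c = leviCivita g x a b c + kd a b * φ c + kd a c * φ b := by
  have hcov := hg.covDeriv_eq_diffTerm hO Γ hx
  have hs := (hg.isSymbolsOn hO).symm x hx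
  constructor
  · intro h
    obtain ⟨φ, hφ⟩ := eq_projective_of_diffTerm (weighted_isSymm hg hx) (hg.det_weighted_ne_zero hx)
      (D := fun a b c => Γ x a b c - leviCivita g x a b c)
      (μ := fun b => (1 / 5) * ∑ i, covDeriv Γ (weighted g) x i i b)
      (fun a b c => by rw [hΓ.symm x hx, hs]) (fun a b c => by
        rw [← hcov, eq_of_sub_eq_zero (h a b c), Finset.sum_add_distrib, ← Finset.sum_mul, ← Finset.sum_mul]
        ring)
    exact ⟨φ, fun a b c => by have := hφ a b c; linarith⟩
  · rintro ⟨φ, hφ⟩ a b c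
    have e : (fun a b c => Γ x a b c - leviCivita g x a b c) =
        fun a b c => kd a b * φ c + kd a c * φ b := by
      funext a b c; rw [hφ]; ring
    rw [e] at hcov
    simp only [diffTerm_projective (weighted_isSymm hg hx)] at hcov
    have t : ∀ b, ∑ i, covDeriv Γ (weighted g) x i i b = 5 * ∑ d, φ d * weighted g x d b := fun b => by
      simp only [hcov, Finset.sum_add_distrib, ← Finset.sum_mul, sum_kd_self, sum_kd_mul]
      ring
    rw [metrizability, Finset.sum_add_distrib, ← Finset.sum_mul, ← Finset.sum_mul, t, t, hcov]
    ring

end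

/-! ## Existence of geodesics -/

/-- The vector field on the tangent bundle whose integral curves are the geodesics. -/
def geodesicField (Γ : Symbols) (p : E4 × E4) : E4 × E4 :=
  (p.2, WithLp.toLp 2 fun a => - ∑ b, ∑ c, Γ p.1 a b c * p.2 b * p.2 c)

theorem contDiffAt_geodesicField {O : Set E4} (hO : IsOpen O) {Γ : Symbols} (hΓ : IsSymbolsOn O Γ)
    {p : E4 × E4} (hp : p.1 ∈ O) : ContDiffAt ℝ 1 (geodesicField Γ) p := by
  have hv : ∀ b, ContDiffAt ℝ 1 (fun p : E4 × E4 => p.2 b) p := fun b =>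
    contDiffAt_euclidean.1 contDiffAt_snd b
  have hΓ' : ∀ a b c, ContDiffAt ℝ 1 (fun p : E4 × E4 => Γ p.1 a b c) p := fun a b c =>
    (((hΓ.smooth a b c).contDiffAt (hO.mem_nhds hp)).of_le (by simp)).comp
      (f := Prod.fst) p contDiffAt_fst
  refine contDiffAt_snd.prodMk (contDiffAt_euclidean.2 fun a => ?_)
  exact (ContDiffAt.sum fun b _ => ContDiffAt.sum fun c _ =>
    ((hΓ' a b c).mul (hv b)).mul (hv c)).neg

/-- Picard–Lindelöf for the first-order system on positions and velocities, with the interval shrunk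
so that the curve stays in `O`. -/
theorem exists_isGeodesic {O : Set E4} (hO : IsOpen O) {Γ : Symbols} (hΓ : IsSymbolsOn O Γ)
    {x : E4} (hx : x ∈ O) (v : E4) :
    ∃ (γ : ℝ → E4) (ε : ℝ), 0 < ε ∧ IsGeodesic O Γ γ (-ε) ε ∧ γ 0 = x ∧ deriv γ 0 = v := by
  obtain ⟨α, hα0, ε₁, hε₁, hα⟩ := (contDiffAt_geodesicField (p := (x, v)) hO hΓ hx)
    |>.exists_forall_mem_closedBall_exists_eq_forall_mem_Ioo_hasDerivAt₀ 0
  simp only [zero_sub, zero_add] at hα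
  have hc : ContinuousAt (fun t => (α t).1) 0 :=
    (hα 0 ⟨by linarith, hε₁⟩).continuousAt.fst
  have hmem : ∀ᶠ t in nhds 0, (α t).1 ∈ O :=
    hc.eventually_mem (hO.mem_nhds (by rw [hα0]; exact hx))
  obtain ⟨ε₂, hε₂, hball⟩ := Metric.eventually_nhds_iff.1 hmem
  set ε := min ε₁ ε₂ with hε
  have hεpos : 0 < ε := lt_min hε₁ hε₂
  have hO' : ∀ t ∈ Set.Ioo (-ε) ε, (α t).1 ∈ O := fun t ht => hball (by
    rw [Real.dist_eq, sub_zero, abs_lt]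
    exact ⟨by linarith [ht.1, min_le_right ε₁ ε₂], by linarith [ht.2, min_le_right ε₁ ε₂]⟩)
  have hd : ∀ t ∈ Set.Ioo (-ε) ε, HasDerivAt α (geodesicField Γ (α t)) t := fun t ht =>
    hα t ⟨by linarith [ht.1, min_le_left ε₁ ε₂], by linarith [ht.2, min_le_left ε₁ ε₂]⟩
  have h1 : ∀ t ∈ Set.Ioo (-ε) ε, HasDerivAt (fun t => (α t).1) (α t).2 t := fun t ht => (hd t ht).fst
  have h2 : ∀ t ∈ Set.Ioo (-ε) ε, HasDerivAt (fun t => (α t).2) (geodesicField Γ (α t)).2 t :=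
    fun t ht => (hd t ht).snd
  have e1 : ∀ t ∈ Set.Ioo (-ε) ε, deriv (fun t => (α t).1) t = (α t).2 := fun t ht => (h1 t ht).deriv
  have e2 : ∀ t ∈ Set.Ioo (-ε) ε, deriv (deriv fun t => (α t).1) t = (geodesicField Γ (α t)).2 :=
    fun t ht => by
      rw [← (h2 t ht).deriv]
      exact (Filter.eventuallyEq_of_mem (isOpen_Ioo.mem_nhds ht) e1).deriv_eq
  have h0 : (0 : ℝ) ∈ Set.Ioo (-ε) ε := ⟨by linarith, hεpos⟩
  refine ⟨fun t => (α t).1, ε, hεpos, ⟨?_, fun t ht => ⟨hO' t ht, fun a => ?_⟩⟩, congrArg Prod.fst hα0, by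
    rw [e1 0 h0, hα0]⟩
  -- Twice differentiability is not enough: the second derivative is continuous because it is the
  -- geodesic field along a continuous curve.
  · have two : (2 : WithTop ℕ∞) = 1 + 1 := by norm_num
    rw [two, contDiffOn_succ_iff_deriv_of_isOpen isOpen_Ioo]
    refine ⟨fun t ht => (h1 t ht).differentiableAt.differentiableWithinAt, by simp, ?_⟩
    refine ContDiffOn.congr (f := fun t => (α t).2) ?_ e1
    rw [show (1 : WithTop ℕ∞) = 0 + 1 by norm_num, contDiffOn_succ_iff_deriv_of_isOpen isOpen_Ioo]
    refine ⟨fun t ht => (h2 t ht).differentiableAt.differentiableWithinAt, by simp, ?_⟩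
    rw [contDiffOn_zero]
    intro t ht
    refine ContinuousAt.continuousWithinAt ?_
    have : ContinuousAt (fun t => (geodesicField Γ (α t)).2) t :=
      ((contDiffAt_geodesicField hO hΓ (hO' t ht)).continuousAt.snd).comp (hd t ht).continuousAt
    exact this.congr (Filter.eventuallyEq_of_mem (isOpen_Ioo.mem_nhds ht) fun s hs => ((h2 s hs).deriv).symm)
  · rw [e2 t ht, e1 t ht]
    simp [geodesicField]

/-! ## The projective class -/

section

variable {O : Set E4} {g : E4 → Mat4} {Γ : Symbols}

theorem inProjClassOn_iff_projective (hO : IsOpen O) (hg : IsMetricOn O g) (hΓ : IsSymbolsOn O Γ) :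
    InProjClassOn O Γ g ↔ ∃ φ, IsProjChangeOn O (leviCivita g) Γ φ := by
  have hL := hg.isSymbolsOn hO
  constructor
  · intro h
    have : ∀ x, ∃ φ : Fin 4 → ℝ, x ∈ O → ∀ a b c,
        Γ x a b c = leviCivita g x a b c + kd a b * φ c + kd a c * φ b := by
      intro x
      by_cases hx : x ∈ O
      -- The covector is half the diagonal coefficients of the difference, as dictated by
      -- `eq_kd_of_parallel`.
      · refine ⟨fun c => (Γ x c c c - leviCivita g x c c c) / 2, fun _ a b c => ?_⟩
        have := eq_kd_of_parallel (fun a b c => Γ x a b c - leviCivita g x a b c)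
          (fun a b c => by rw [hΓ.symm x hx, hL.symm x hx]) (fun v => ?_) a b c
        · linarith
        -- Subtracting the two geodesic equations at time `0` eliminates the acceleration and leaves
        -- `D(v,v) = f v`.
        · obtain ⟨γ, ε, hε, hγ, rfl, hv⟩ := exists_isGeodesic hO hL hx (WithLp.toLp 2 v)
          have h0 : (0 : ℝ) ∈ Set.Ioo (-ε) ε := ⟨by linarith, hε⟩
          obtain ⟨-, f, hf⟩ := (h γ _ _ hγ).2 0 h0
          have hg0 := (hγ.2 0 h0).2
          rw [hv] at hf hg0
          refine ⟨f, fun a => ?_⟩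
          have e1 := hf a
          have e2 := hg0 a
          simp only [sub_mul, Finset.sum_sub_distrib] at e1 e2 ⊢
          linarith
      · exact ⟨0, fun h => absurd h hx⟩
    choose φ hφ using this
    exact ⟨φ, hφ⟩
  · rintro ⟨φ, hφ⟩ γ α β hγ
    refine ⟨hγ.1, fun t ht => ⟨(hγ.2 t ht).1, 2 * ∑ b, φ (γ t) b * deriv γ t b, fun a => ?_⟩⟩
    obtain ⟨hx, h⟩ := hγ.2 t ht
    have s : ∀ b c, Γ (γ t) a b c * deriv γ t b * deriv γ t c =
        leviCivita g (γ t) a b c * deriv γ t b * deriv γ t c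
        + (kd a b * deriv γ t b) * (φ (γ t) c * deriv γ t c)
        + (φ (γ t) b * deriv γ t b) * (kd a c * deriv γ t c) := fun b c => by
      rw [hφ _ hx]; ring
    simp only [s, Finset.sum_add_distrib, ← Finset.mul_sum, ← Finset.sum_mul, sum_kd_mul]
    linarith [h a]

theorem inProjClassOn_iff_solvesMetrizabilityOn (hO : IsOpen O) (hg : IsMetricOn O g)
    (hΓ : IsSymbolsOn O Γ) : InProjClassOn O Γ g ↔ SolvesMetrizabilityOn O Γ (weighted g) := by
  rw [inProjClassOn_iff_projective hO hg hΓ]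
  constructor
  · rintro ⟨φ, hφ⟩ x hx
    exact (hg.metrizability_eq_zero_iff hO hΓ hx).2 ⟨φ x, hφ x hx⟩
  · intro h
    have : ∀ x, ∃ φ : Fin 4 → ℝ, x ∈ O → ∀ a b c,
        Γ x a b c = leviCivita g x a b c + kd a b * φ c + kd a c * φ b := fun x => by
      by_cases hx : x ∈ O
      · obtain ⟨φ, hφ⟩ := (hg.metrizability_eq_zero_iff hO hΓ hx).1 (h x hx)
        exact ⟨φ, fun _ => hφ⟩
      · exact ⟨0, fun h => absurd h hx⟩
    choose φ hφ using this
    exact ⟨φ, hφ⟩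

theorem InProjClassOn.weyl_eq (hO : IsOpen O) (hg : IsMetricOn O g) (hΓ : IsSymbolsOn O Γ)
    (h : InProjClassOn O Γ g) {x : E4} (hx : x ∈ O) : weyl Γ x = weyl (leviCivita g) x := by
  obtain ⟨φ, hφ⟩ := (inProjClassOn_iff_projective hO hg hΓ).1 h
  have hL := hg.isSymbolsOn hO
  exact hφ.weyl_eq hO hL (hφ.contDiffOn hL hΓ) hx

theorem leviCivita_const_smul (hO : IsOpen O) {g' : E4 → Mat4} {s : ℝ} (hs : s ≠ 0)
    (h : ∀ x ∈ O, g' x = s • g x) {x : E4} (hx : x ∈ O) : leviCivita g' x = leviCivita g x := by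
  have hp : ∀ k i j, pd k (fun y => g' y i j) x = s * pd k (fun y => g y i j) x := fun k i j => by
    rw [← pd_const_mul]
    exact pd_congr_of_isOpen hO hx (fun y hy => by rw [h y hy]; rfl) k
  have hi : (g' x)⁻¹ = s⁻¹ • (g x)⁻¹ := by
    rw [h x hx]
    -- `g` is not assumed invertible here; in the singular case both inverses are `0` by convention.
    by_cases hd : IsUnit (g x).det
    · rw [show s • g x = (Units.mk0 s hs) • g x from rfl, Matrix.inv_smul' _ _ hd]
      rfl
    · rw [Matrix.nonsing_inv_apply_not_isUnit _ hd, smul_zero, Matrix.nonsing_inv_apply_not_isUnit]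
      rwa [Matrix.det_smul, isUnit_iff_ne_zero, mul_ne_zero_iff_left (pow_ne_zero _ hs), ← isUnit_iff_ne_zero]
  funext a b c
  simp only [leviCivita, hp, hi, Matrix.smul_apply, smul_eq_mul]
  congr 1
  refine Finset.sum_congr rfl fun d _ => ?_
  field_simp

theorem inProjClassOn_const_smul_iff (hO : IsOpen O) {g' : E4 → Mat4} {s : ℝ} (hs : s ≠ 0)
    (h : ∀ x ∈ O, g' x = s • g x) : InProjClassOn O Γ g' ↔ InProjClassOn O Γ g := by
  have : ∀ γ α β, IsGeodesic O (leviCivita g') γ α β ↔ IsGeodesic O (leviCivita g) γ α β := by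
    intro γ α β
    refine and_congr_right fun _ => forall_congr' fun t => forall_congr' fun _ =>
      and_congr_right fun hx => ?_
    rw [leviCivita_const_smul hO hs h hx]
  simp only [InProjClassOn, this]

/-! ## The conformal factor -/

theorem metrizability_exp_smul {A : E4 → Mat4} {lam : E4 → ℝ} {x : E4}
    (hA : ∀ b c, DifferentiableAt ℝ (fun y => A y b c) x) (hl : DifferentiableAt ℝ lam x)
    (a b c : Fin 4) : metrizability Γ (fun y => Real.exp (lam y) • A y) x a b c =
      Real.exp (lam x) * (pd a lam x * A x b c
        - (1 / 5) * ∑ i, (pd i lam x * A x i b * kd c a + pd i lam x * A x i c * kd b a)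
        + metrizability Γ A x a b c) := by
  have he : ∀ a, pd a (fun y => Real.exp (lam y)) x = Real.exp (lam x) * pd a lam x := fun a => by
    rw [pd, hl.hasFDerivAt.exp.fderiv]; rfl
  have hc : ∀ a b c, covDeriv Γ (fun y => Real.exp (lam y) • A y) x a b c =
      Real.exp (lam x) * (pd a lam x * A x b c + covDeriv Γ A x a b c) := fun a b c => by
    have : pd a (fun y => (Real.exp (lam y) • A y) b c) x =
        Real.exp (lam x) * pd a lam x * A x b c + Real.exp (lam x) * pd a (fun y => A y b c) x := by
      rw [← he]; exact pd_mul hl.exp (hA b c)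
    have s1 : ∀ v : Fin 4 → ℝ, ∑ d, v d * (Real.exp (lam x) • A x) d c =
        Real.exp (lam x) * ∑ d, v d * A x d c := fun v => by
      rw [Finset.mul_sum]
      exact Finset.sum_congr rfl fun d _ => by rw [Matrix.smul_apply, smul_eq_mul]; ring
    have s2 : ∀ v : Fin 4 → ℝ, ∑ d, v d * (Real.exp (lam x) • A x) b d =
        Real.exp (lam x) * ∑ d, v d * A x b d := fun v => by
      rw [Finset.mul_sum]
      exact Finset.sum_congr rfl fun d _ => by rw [Matrix.smul_apply, smul_eq_mul]; ring
    rw [covDeriv, this, s1, s2, covDeriv, Matrix.smul_apply, smul_eq_mul]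
    ring
  simp only [metrizability, hc, Finset.sum_add_distrib, mul_add, add_mul, Finset.mul_sum, mul_sub]
  simp only [mul_assoc, mul_left_comm (Real.exp (lam x))]
  ring

theorem solvesFactorOn_iff (hO : IsOpen O) {A : E4 → Mat4} {lam : E4 → ℝ}
    (hA : ∀ b c, ContDiffOn ℝ ∞ (fun y => A y b c) O) (hl : ContDiffOn ℝ ∞ lam O) :
    SolvesFactorOn O Γ A lam ↔
      SolvesMetrizabilityOn O Γ (fun y => Real.exp (lam y) • A y) := by
  refine forall_congr' fun x => forall_congr' fun hx => forall_congr' fun a => forall_congr' fun b =>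
    forall_congr' fun c => ?_
  rw [metrizability_exp_smul (fun b c => differentiableAt_of_contDiffOn hO (hA b c) hx)
    (differentiableAt_of_contDiffOn hO hl hx), mul_eq_zero_iff_left (Real.exp_ne_zero _)]
  exact eq_neg_iff_add_eq_zero

theorem IsMetricOn.exp_smul {a : E4 → Mat4} (ha : IsMetricOn O a) {lam : E4 → ℝ}
    (hl : ContDiffOn ℝ ∞ lam O) : IsMetricOn O (fun x => Real.exp (-5 * lam x) • a x) where
  smooth i j := ((contDiffOn_const.mul hl).exp).mul (ha.smooth i j)
  symm x hx := by rw [Matrix.IsSymm, Matrix.transpose_smul, ha.symm x hx]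
  nondeg x hx := by
    rw [Matrix.det_smul]
    exact mul_ne_zero (pow_ne_zero _ (Real.exp_ne_zero _)) (ha.nondeg x hx)

/-- In dimension four the determinant scales by `e^{-20λ}`, its fifth root by `e^{-4λ}`, and the
inverse by `e^{5λ}`. The product is `e^λ`, which explains the factor `-5`. -/
theorem IsMetricOn.weighted_exp_smul {a : E4 → Mat4} (ha : IsMetricOn O a) (lam : E4 → ℝ) {x : E4}
    (hx : x ∈ O) : weighted (fun y => Real.exp (-5 * lam y) • a y) x =
      Real.exp (lam x) • weighted a x := by
  have hi : (Real.exp (-5 * lam x) • a x)⁻¹ = Real.exp (5 * lam x) • (a x)⁻¹ := by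
    rw [show Real.exp (-5 * lam x) • a x = (Units.mk0 _ (Real.exp_ne_zero (-5 * lam x))) • a x from rfl,
      Matrix.inv_smul' _ _ (ha.isUnit_det hx), Units.smul_def, Units.val_inv_eq_inv_val, Units.val_mk0,
      ← Real.exp_neg]
    ring_nf
  have hd : |(Real.exp (-5 * lam x) • a x).det| ^ ((1 : ℝ) / 5) =
      Real.exp (-4 * lam x) * |(a x).det| ^ ((1 : ℝ) / 5) := by
    rw [Matrix.det_smul, abs_mul, abs_pow, Real.abs_exp, Real.mul_rpow (by positivity) (abs_nonneg _),
      ← Real.exp_nat_mul, ← Real.exp_mul]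
    congr 2
    simp only [Fintype.card_fin]
    push_cast; ring
  rw [weighted, hi, hd, weighted, smul_smul, smul_smul]
  congr 1
  rw [show lam x = -4 * lam x + 5 * lam x by ring, Real.exp_add]
  ring_nf

theorem SolvesMetrizabilityOn.congr (hO : IsOpen O) {σ σ' : E4 → Mat4} (h : ∀ x ∈ O, σ x = σ' x) :
    SolvesMetrizabilityOn O Γ σ ↔ SolvesMetrizabilityOn O Γ σ' := by
  refine forall_congr' fun x => forall_congr' fun hx => ?_
  have hc : covDeriv Γ σ x = covDeriv Γ σ' x := by
    funext a b c
    simp only [covDeriv, h x hx, pd_congr_of_isOpen hO hx (f := fun y => σ y b c)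
      (f' := fun y => σ' y b c) (fun y hy => by rw [h y hy]) a]
  simp only [metrizability, hc]

theorem solvesFactorOn_iff_inProjClassOn (hO : IsOpen O) {a : E4 → Mat4} (ha : IsMetricOn O a)
    (hΓ : IsSymbolsOn O Γ) {lam : E4 → ℝ} (hl : ContDiffOn ℝ ∞ lam O) :
    SolvesFactorOn O Γ (weighted a) lam ↔
      InProjClassOn O Γ (fun x => Real.exp (-5 * lam x) • a x) := by
  rw [solvesFactorOn_iff hO ha.contDiffOn_weighted hl,
    inProjClassOn_iff_solvesMetrizabilityOn hO (ha.exp_smul hl) hΓ]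
  exact SolvesMetrizabilityOn.congr hO fun x hx => (ha.weighted_exp_smul lam hx).symm

/-- Contracting the homogeneous system with `A⁻¹` in the two upper indices gives `4 m_a = (2/5)
m_a`. -/
theorem FactorSystem.unique {A : E4 → Mat4} {x : E4} (hA : (A x).IsSymm) (hdet : (A x).det ≠ 0)
    {ℓ ℓ' : Fin 4 → ℝ} (h : FactorSystem Γ A x ℓ) (h' : FactorSystem Γ A x ℓ') : ℓ = ℓ' := by
  set m : Fin 4 → ℝ := ℓ - ℓ' with hm
  have hd : ∀ a b c, m a * A x b c = (1 / 5) * ∑ i, (m i * A x i b * kd c a + m i * A x i c * kd b a) := by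
    intro a b c
    have e1 := h a b c
    have e2 := h' a b c
    simp only [hm, Pi.sub_apply, sub_mul, Finset.sum_add_distrib, Finset.sum_sub_distrib] at e1 e2 ⊢
    linarith
  have hAH : A x * (A x)⁻¹ = 1 := Matrix.mul_nonsing_inv _ (isUnit_iff_ne_zero.mpr hdet)
  have hHs := symm_inv hA
  have contr : ∀ b b', ∑ c, A x b c * (A x)⁻¹ c b' = kd b b' := fun b b' => by
    rw [← one_apply_eq_kd, ← hAH]; rfl
  have key : ∀ a, m a = 0 := by
    intro a
    have e : ∑ b, ∑ c, m a * A x b c * (A x)⁻¹ c b = 4 * m a := by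
      simp only [mul_assoc, ← Finset.mul_sum, contr, sum_kd_self]; ring
    have n : ∀ b, ∑ i, m i * A x i b = (m ᵥ* A x) b := fun b => rfl
    have e' : ∑ b, ∑ c, m a * A x b c * (A x)⁻¹ c b = (2 / 5) * m a := by
      have t : ∀ b c, m a * A x b c * (A x)⁻¹ c b = (1 / 5) * (kd c a * ((m ᵥ* A x) b * (A x)⁻¹ c b))
          + (1 / 5) * (kd b a * ((m ᵥ* A x) c * (A x)⁻¹ c b)) := fun b c => by
        rw [hd]
        simp only [Finset.sum_add_distrib, ← Finset.sum_mul, n]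
        ring
      have u : ∑ b, (m ᵥ* A x) b * (A x)⁻¹ b a = m a := by
        have : (m ᵥ* A x ᵥ* (A x)⁻¹) a = m a := by rw [Matrix.vecMul_vecMul, hAH, Matrix.vecMul_one]
        exact this
      have u' : ∑ b, (m ᵥ* A x) b * (A x)⁻¹ a b = m a := by
        rw [← u]; exact Finset.sum_congr rfl fun b _ => by rw [hHs.apply]
      simp only [t, Finset.sum_add_distrib, ← Finset.mul_sum, sum_kd_mul', u', u]
      ring
    linarith
  funext a
  have := key a
  rwa [hm, Pi.sub_apply, sub_eq_zero] at this

theorem fderiv_eq_of_pd_eq {f f' : E4 → ℝ} {x : E4} (h : ∀ i, pd i f x = pd i f' x) :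
    fderiv ℝ f x = fderiv ℝ f' x := by
  refine ContinuousLinearMap.coe_injective ((EuclideanSpace.basisFun (Fin 4) ℝ).toBasis.ext fun i => ?_)
  simpa [pd, coordVec] using h i

theorem SolvesFactorOn.fderiv_eq {a : E4 → Mat4} (ha : IsMetricOn O a) {lam lam' : E4 → ℝ}
    (h : SolvesFactorOn O Γ (weighted a) lam) (h' : SolvesFactorOn O Γ (weighted a) lam') {x : E4}
    (hx : x ∈ O) : fderiv ℝ lam x = fderiv ℝ lam' x :=
  fderiv_eq_of_pd_eq fun i => congrFun
    ((h x hx).unique (weighted_isSymm ha hx) (ha.det_weighted_ne_zero hx) (h' x hx)) i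

/-- The logarithm of the conformal factor `f` of `g = f a` solves the factor system of `a`. -/
theorem solvesFactorOn_log (hO : IsOpen O) {a : E4 → Mat4} (ha : IsMetricOn O a)
    (hΓ : IsSymbolsOn O Γ) (hc : InProjClassOn O Γ g) {f : E4 → ℝ} (hf : ContDiffOn ℝ ∞ f O)
    {s : ℝ} (hs : s ≠ 0) (hfs : ∀ x ∈ O, f x ≠ 0 ∧ |f x| = s * f x) (hfa : ∀ x ∈ O, g x = f x • a x) :
    ContDiffOn ℝ ∞ (fun x => -(1 / 5) * Real.log (f x)) O ∧
      SolvesFactorOn O Γ (weighted a) (fun x => -(1 / 5) * Real.log (f x)) := by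
  have hl : ContDiffOn ℝ ∞ (fun x => -(1 / 5) * Real.log (f x)) O :=
    contDiffOn_const.mul (hf.log fun x hx => (hfs x hx).1)
  refine ⟨hl, (solvesFactorOn_iff_inProjClassOn hO ha hΓ hl).2 ?_⟩
  -- `e^{-5λ} a = |f| a = s g`: the sign of `f` is absorbed in a constant multiple, which does not
  -- affect the geodesics.
  refine (inProjClassOn_const_smul_iff hO hs fun x hx => ?_).2 hc
  rw [show -5 * (-(1 / 5) * Real.log (f x)) = Real.log (f x) by ring, ← Real.log_abs,
    Real.exp_log (abs_pos.mpr (hfs x hx).1), (hfs x hx).2, hfa x hx, smul_smul]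

end

/-! ## The Weyl tensor as a function of the 2-jet of the metric -/

abbrev Arr2 := Fin 4 → Fin 4 → ℝ
abbrev Arr3 := Fin 4 → Fin 4 → Fin 4 → ℝ
abbrev Arr4 := Fin 4 → Fin 4 → Fin 4 → Fin 4 → ℝ

/-- The curvature tensor with raised first index. -/
def upCurv (H : Mat4) (p : Arr3) (q : Arr4) (i j k l : Fin 4) : ℝ :=
  ∑ m, H i m * lowCurv H p q m j k l

/-- The Weyl tensor of a metric with inverse `H` and derivatives `p`, `q`. -/
def weylExpr (H : Mat4) (p : Arr3) (q : Arr4) (i j k l : Fin 4) : ℝ :=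
  upCurv H p q i j k l
    - (1 / 3) * (kd i l * ∑ a, upCurv H p q a j k a - kd i k * ∑ a, upCurv H p q a j l a)

theorem IsMetricOn.weyl_eq {O : Set E4} {g : E4 → Mat4} (hO : IsOpen O) (hg : IsMetricOn O g)
    {x : E4} (hx : x ∈ O) : weyl (leviCivita g) x = weylExpr (g x)⁻¹ (jet1 g x) (jet2 g x) := by
  funext i j k l
  have h : ∀ i j k l, curv (leviCivita g) x i j k l = upCurv (g x)⁻¹ (jet1 g x) (jet2 g x) i j k l :=
    fun i j k l => hg.curv_eq hO hx i j k l
  rw [weyl_eq_of_ricci_symm _ _ (hg.ricci_comm hO hx)]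
  simp only [ricci, h, weylExpr]

theorem lowCurv_smul (d : ℝ) (H : Mat4) (p : Arr3) (q : Arr4) (i j k l : Fin 4) :
    lowCurv (d • H) p (fun l k i j => d * q l k i j) i j k l = d * lowCurv H p q i j k l := by
  simp only [lowCurv, Matrix.smul_apply, smul_eq_mul, mul_assoc, ← Finset.mul_sum]
  ring

/-- Scaling the inverse and the second derivatives, but not the first, scales the lowered curvature
once; raising an index scales it again. With `d` the determinant, this clears all denominators. -/
theorem weylExpr_smul (d : ℝ) (H : Mat4) (p : Arr3) (q : Arr4) (i j k l : Fin 4) :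
    weylExpr (d • H) p (fun l k i j => d * q l k i j) i j k l = d ^ 2 * weylExpr H p q i j k l := by
  have h : ∀ i j k l, upCurv (d • H) p (fun l k i j => d * q l k i j) i j k l =
      d ^ 2 * upCurv H p q i j k l := fun i j k l => by
    simp only [upCurv, lowCurv_smul, Matrix.smul_apply, smul_eq_mul, Finset.mul_sum]
    exact Finset.sum_congr rfl fun m _ => by ring
  simp only [weylExpr, h, ← Finset.mul_sum]
  ring

/-- A polynomial in the 2-jet, proportional to the Weyl tensor. -/
def polyWeyl (G : Mat4) (p : Arr3) (q : Arr4) : Arr4 :=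
  weylExpr G.adjugate p (fun l k i j => G.det * q l k i j)

theorem polyWeyl_eq {G : Mat4} (hG : G.det ≠ 0) (p : Arr3) (q : Arr4) (i j k l : Fin 4) :
    polyWeyl G p q i j k l = G.det ^ 2 * weylExpr G⁻¹ p q i j k l := by
  have : G.adjugate = G.det • G⁻¹ := by
    rw [Matrix.inv_def, Ring.inverse_eq_inv', smul_smul, mul_inv_cancel₀ hG, one_smul]
  rw [polyWeyl, this, weylExpr_smul]

/-! ## The tractor system in a gauge, as a matrix -/

/-- The coefficients of the tractor system. -/
def tractorCoeff (W : Arr4) (i j k l p q : Fin 4) : ℝ :=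
  4 * (kd q i * W j p k l + kd q j * W i p k l)
    - (W i p q l * kd j k - W i p q k * kd j l + W j p q l * kd i k - W j p q k * kd i l)

theorem tractorSystem_iff (W : Arr4) (S : Mat4) :
    TractorSystem W S ↔ ∀ i j k l, ∑ p, ∑ q, tractorCoeff W i j k l p q * S p q = 0 := by
  refine forall_congr' fun i => forall_congr' fun j => forall_congr' fun k => forall_congr' fun l => ?_
  rw [← sub_eq_zero]
  have e : ∀ i (v : Fin 4 → ℝ), ∑ p, ∑ q, kd q i * v p * S p q = ∑ a, S a i * v a := fun i v =>
    Finset.sum_congr rfl fun p _ => by simp only [mul_assoc, sum_kd_mul']; ring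
  have : ∑ p, ∑ q, tractorCoeff W i j k l p q * S p q =
      4 * (∑ p, ∑ q, kd q i * W j p k l * S p q + ∑ p, ∑ q, kd q j * W i p k l * S p q)
      - ∑ a, ∑ b, S a b * (W i a b l * kd j k - W i a b k * kd j l
        + W j a b l * kd i k - W j a b k * kd i l) := by
    simp only [tractorCoeff, sub_mul, Finset.sum_sub_distrib, mul_add, add_mul, Finset.sum_add_distrib,
      Finset.mul_sum, mul_sub]
    simp only [mul_comm, mul_left_comm]
  rw [this, e i (fun p => W j p k l), e j (fun p => W i p k l)]

/-- The tractor system together with the symmetry and a trace condition. -/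
def gaugedSystem (W : Arr4) :
    Matrix ((Fin 4 × Fin 4 × Fin 4 × Fin 4) ⊕ (Fin 4 × Fin 4) ⊕ Unit) (Fin 4 × Fin 4) ℝ :=
  Matrix.of fun r c => match r with
    | .inl (i, j, k, l) => tractorCoeff W i j k l c.1 c.2
    | .inr (.inl (i, j)) => kd i c.1 * kd j c.2 - kd j c.1 * kd i c.2
    | .inr (.inr _) => kd c.1 c.2

theorem gaugedSystem_mulVec_eq_zero_iff (W : Arr4) (S : Mat4) :
    gaugedSystem W *ᵥ (fun c => S c.1 c.2) = 0 ↔ TractorSystem W S ∧ S.IsSymm ∧ S.trace = 0 := by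
  have s2 : ∀ i j, ∑ p, ∑ q, (kd i p * kd j q - kd j p * kd i q) * S p q = S i j - S j i := fun i j => by
    simp only [sub_mul, Finset.sum_sub_distrib, mul_assoc, ← Finset.mul_sum, sum_kd_mul]
  have s3 : ∑ p, ∑ q, kd p q * S p q = S.trace := by
    simp only [sum_kd_mul]; rfl
  rw [tractorSystem_iff, funext_iff, Sum.forall, Sum.forall, Matrix.IsSymm.ext_iff]
  simp only [Matrix.mulVec, dotProduct, gaugedSystem, Matrix.of_apply, Fintype.sum_prod_type,
    Pi.zero_apply, Prod.forall, s2, s3, sub_eq_zero]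
  constructor
  · rintro ⟨h1, h2, h3⟩
    exact ⟨h1, fun i j => (h2 i j).symm, h3 ()⟩
  · rintro ⟨h1, h2, h3⟩
    exact ⟨h1, fun i j => (h2 i j).symm, fun _ => h3⟩

/-- A polynomial in the 2-jet of a metric which does not vanish iff the gauged tractor system has
only the trivial solution. -/
def genericity (G : Mat4) (p : Arr3) (q : Arr4) : ℝ :=
  ((gaugedSystem (polyWeyl G p q))ᵀ * gaugedSystem (polyWeyl G p q)).det

theorem det_transpose_mul_self_ne_zero_iff {m n : Type*} [Fintype m] [Fintype n] [DecidableEq n]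
    (A : Matrix m n ℝ) : (Aᵀ * A).det ≠ 0 ↔ ∀ v, A *ᵥ v = 0 → v = 0 := by
  rw [← not_iff_not, not_not, ← Matrix.exists_mulVec_eq_zero_iff]
  push Not
  refine exists_congr fun v => ?_
  rw [and_comm]
  refine and_congr_left fun _ => ⟨fun h => ?_, fun h => by rw [← Matrix.mulVec_mulVec, h, Matrix.mulVec_zero]⟩
  have : (A *ᵥ v) ⬝ᵥ (A *ᵥ v) = 0 := by
    rw [Matrix.dotProduct_mulVec, ← Matrix.mulVec_transpose, Matrix.mulVec_mulVec, h, zero_dotProduct]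
  exact dotProduct_self_eq_zero.1 this

theorem genericity_ne_zero_iff (G : Mat4) (p : Arr3) (q : Arr4) : genericity G p q ≠ 0 ↔
    ∀ S : Mat4, TractorSystem (polyWeyl G p q) S → S.IsSymm → S.trace = 0 → S = 0 := by
  rw [genericity, det_transpose_mul_self_ne_zero_iff]
  constructor
  · intro h S h1 h2 h3
    have := h _ ((gaugedSystem_mulVec_eq_zero_iff _ S).2 ⟨h1, h2, h3⟩)
    ext i j
    exact congrFun this (i, j)
  · intro h v hv
    have := (gaugedSystem_mulVec_eq_zero_iff (polyWeyl G p q) (Matrix.of fun i j => v (i, j))).1 hv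
    have := h _ this.1 this.2.1 this.2.2
    funext ⟨i, j⟩
    exact congrFun (congrFun this i) j

theorem TractorSystem.const_mul {W W' : Arr4} {S : Mat4} (h : TractorSystem W S) (c : ℝ)
    (hW : ∀ i j k l, W' i j k l = c * W i j k l) : TractorSystem W' S := by
  rw [tractorSystem_iff] at h ⊢
  intro i j k l
  have : ∀ p q, tractorCoeff W' i j k l p q * S p q = c * (tractorCoeff W i j k l p q * S p q) :=
    fun p q => by simp only [tractorCoeff, hW]; ring
  simp only [this, ← Finset.mul_sum, h, mul_zero]

theorem TractorSystem.sub {W : Arr4} {S T : Mat4} (h : TractorSystem W S) (h' : TractorSystem W T) :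
    TractorSystem W (S - T) := by
  rw [tractorSystem_iff] at *
  intro i j k l
  simp only [Matrix.sub_apply, mul_sub, Finset.sum_sub_distrib, h, h', sub_zero]

theorem IsMetricOn.tractorSystem_iff_of_genericity {O : Set E4} {g : E4 → Mat4} (hO : IsOpen O)
    (hg : IsMetricOn O g) {x : E4} (hx : x ∈ O) (hgen : genericity (g x) (jet1 g x) (jet2 g x) ≠ 0)
    {S : Mat4} (hS : S.IsSymm) :
    TractorSystem (weyl (leviCivita g) x) S ↔ ∃ c : ℝ, S = c • (g x)⁻¹ := by
  have hsol := hg.tractorSystem_inv hO hx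
  have hdet := hg.nondeg x hx
  rw [genericity_ne_zero_iff] at hgen
  have key : ∀ T : Mat4, TractorSystem (weyl (leviCivita g) x) T → T.IsSymm → T.trace = 0 → T = 0 :=
    fun T h1 h2 h3 => hgen T (h1.const_mul ((g x).det ^ 2) fun i j k l => by
      rw [polyWeyl_eq hdet, hg.weyl_eq hO hx]) h2 h3
  constructor
  · intro h
    -- The Euclidean trace used as a gauge could vanish on the inverse of an indefinite metric;
    -- genericity excludes this, since `g⁻¹` would then be a nonzero gauged solution.
    have ht : ((g x)⁻¹).trace ≠ 0 := fun h0 => by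
      have h1 := key _ hsol (symm_inv (hg.symm x hx)) h0
      have h2 := hg.mul_inv hx
      rw [h1, mul_zero] at h2
      exact zero_ne_one h2
    refine ⟨S.trace / ((g x)⁻¹).trace, ?_⟩
    rw [← sub_eq_zero]
    refine key _ (h.sub (hsol.smul _)) (hS.sub ((symm_inv (hg.symm x hx)).smul _)) ?_
    rw [Matrix.trace_sub, Matrix.trace_smul, smul_eq_mul, div_mul_cancel₀ _ ht, sub_self]
  · rintro ⟨c, rfl⟩
    exact hsol.smul c

/-! ## A metric for which the polynomial does not vanish -/

/-- Sectional curvatures of a Ricci-flat curvature tensor. -/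
def modelCurv : Mat4 := !![0, 1, 2, -3; 1, 0, -3, 2; 2, -3, 0, 1; -3, 2, 1, 0]

/-- The second derivatives at the base point of the model metric. -/
def modelJet2 (l k i j : Fin 4) : ℝ := kd l k * kd i j * modelCurv i k

/-- First derivatives vanish and the determinant is 1. The rows of `modelCurv` sum to zero, so the
Ricci tensor vanishes and the Weyl tensor is the curvature. -/
theorem polyWeyl_model (i j k l : Fin 4) : polyWeyl 1 0 modelJet2 i j k l =
    modelCurv i j * (kd i k * kd j l - kd i l * kd j k) := by
  have hs : ∀ i j, modelCurv i j = modelCurv j i := fun i j => by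
    fin_cases i <;> fin_cases j <;> simp [modelCurv]
  have hsw : ∀ (a b : Fin 4) (f : Fin 4 → ℝ), kd a b * f a = kd a b * f b := fun a b f => by
    by_cases h : a = b
    · rw [h]
    · simp [kd, h]
  have hlow : ∀ i j k l, lowCurv 1 0 modelJet2 i j k l =
      modelCurv i j * (kd i k * kd j l - kd i l * kd j k) := fun i j k l => by
    have hz : ∀ a b c, chr 0 a b c = 0 := fun a b c => by simp [chr]
    simp only [lowCurv, hz, mul_zero, sub_zero, Finset.sum_const_zero, modelJet2]
    rw [kd_comm l j, kd_comm l i, kd_comm k j, kd_comm k i, hs k i]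
    have a1 : kd j k * modelCurv i k = kd j k * modelCurv i j := (hsw j k (modelCurv i)).symm
    have a2 : kd j l * modelCurv l i = kd j l * modelCurv i j := by
      rw [hs l i]; exact (hsw j l (modelCurv i)).symm
    linear_combination (-1 / 2 * kd i l) * a1 + (1 / 2 * kd i k) * a2
  have hup : ∀ i j k l, upCurv 1 0 modelJet2 i j k l =
      modelCurv i j * (kd i k * kd j l - kd i l * kd j k) := fun i j k l => by
    simp only [upCurv, one_apply_eq_kd, sum_kd_mul, hlow]
  have hric : ∀ j k, ∑ a, upCurv 1 0 modelJet2 a j k a = 0 := fun j k => by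
    simp only [hup]
    fin_cases j <;> fin_cases k <;> simp [modelCurv, kd, Fin.sum_univ_four] <;> norm_num
  simp only [polyWeyl, Matrix.adjugate_one, Matrix.det_one, one_mul]
  change weylExpr 1 0 modelJet2 i j k l = _
  rw [weylExpr, hric, hric, hup]
  ring

/-- For a curvature tensor diagonal on coordinate planes the system decouples: nonzero plane
curvatures kill the off-diagonal part of `S`, and their particular values make the diagonal a
multiple of the identity, which the trace condition kills. -/
theorem genericity_model : genericity 1 0 modelJet2 ≠ 0 := by
  rw [genericity_ne_zero_iff]
  intro S h hs ht
  have hW : polyWeyl 1 0 modelJet2 = fun i j k l =>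
      modelCurv i j * (kd i k * kd j l - kd i l * kd j k) := by
    funext i j k l; exact polyWeyl_model i j k l
  rw [hW] at h
  -- The equation with `i = j = k` reads `8 K S_{kl} = 2 K S_{kl}`, where `K` is the entry `k`, `l`
  -- of `modelCurv`.
  have off : ∀ k l : Fin 4, k ≠ l → S k l = 0 := by
    intro k l hkl
    have := h k k k l
    fin_cases k <;> fin_cases l <;> first | exact absurd rfl hkl | skip
    all_goals
      simp [modelCurv, kd, Fin.sum_univ_four] at this
      have := hs.apply 0 1
      have := hs.apply 0 2
      have := hs.apply 0 3
      have := hs.apply 1 2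
      have := hs.apply 1 3
      have := hs.apply 2 3
      simp only [Fin.isValue, Fin.reduceFinMk, Fin.zero_eta, Fin.mk_one]
      linarith
  -- Opposite planes in pairs: with `u = S₁₁ - S₀₀`, `v = S₂₂ - S₃₃` the first two equations say `3u
  -- = 5v`, `3v = 5u`; the other two have the same shape with `3` and `2`.
  have d1 := h 1 0 0 1
  have d2 := h 3 2 2 3
  have d3 := h 2 0 0 2
  have d4 := h 3 1 1 3
  simp [modelCurv, kd, Fin.sum_univ_four] at d1 d2 d3 d4
  simp [Matrix.trace, Fin.sum_univ_four] at ht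
  have t0 : S 0 0 = 0 := by linarith
  have t1 : S 1 1 = 0 := by linarith
  have t2 : S 2 2 = 0 := by linarith
  have t3 : S 3 3 = 0 := by linarith
  ext i j
  rcases eq_or_ne i j with rfl | hij
  · fin_cases i
    exacts [t0, t1, t2, t3]
  · exact off i j hij

/-! ## Analyticity of the polynomial -/

theorem _root_.AnalyticAt.apply {E F ι : Type*} [NormedAddCommGroup E] [NormedSpace ℝ E]
    [NormedAddCommGroup F] [NormedSpace ℝ F] [Fintype ι] {f : E → ι → F} {t : E}
    (h : AnalyticAt ℝ f t) (i : ι) : AnalyticAt ℝ (fun x => f x i) t :=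
  ((ContinuousLinearMap.proj (R := ℝ) (φ := fun _ : ι => F) i).analyticAt _).comp h

theorem analyticAt_det {E : Type*} [NormedAddCommGroup E] [NormedSpace ℝ E] {n : Type*} [Fintype n]
    [DecidableEq n] {A : E → Matrix n n ℝ} {t : E} (hA : ∀ i j, AnalyticAt ℝ (fun t => A t i j) t) :
    AnalyticAt ℝ (fun t => (A t).det) t := by
  simp only [Matrix.det_apply, Units.smul_def, zsmul_eq_mul]
  exact Finset.analyticAt_fun_sum _ fun σ _ =>
    analyticAt_const.mul (Finset.analyticAt_fun_prod _ fun i _ => hA _ _)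

theorem analyticAt_genericity {E : Type*} [NormedAddCommGroup E] [NormedSpace ℝ E] {t : E}
    {G : E → Mat4} {p : E → Arr3} {q : E → Arr4} (hG : ∀ i j, AnalyticAt ℝ (fun t => G t i j) t)
    (hp : ∀ k i j, AnalyticAt ℝ (fun t => p t k i j) t)
    (hq : ∀ l k i j, AnalyticAt ℝ (fun t => q t l k i j) t) :
    AnalyticAt ℝ (fun t => genericity (G t) (p t) (q t)) t := by
  have hdet : AnalyticAt ℝ (fun t => (G t).det) t := analyticAt_det hG
  have hadj : ∀ i j, AnalyticAt ℝ (fun t => (G t).adjugate i j) t := fun i j => by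
    simp only [Matrix.adjugate_apply]
    refine analyticAt_det fun a b => ?_
    simp only [Matrix.updateRow_apply]
    split_ifs
    · exact analyticAt_const
    · exact hG a b
  have hchr : ∀ a b c, AnalyticAt ℝ (fun t => chr (p t) a b c) t := fun a b c => by
    simp only [chr]
    exact analyticAt_const.mul (((hp _ _ _).add (hp _ _ _)).sub (hp _ _ _))
  have hq' : ∀ l k i j, AnalyticAt ℝ (fun t => (G t).det * q t l k i j) t := fun l k i j =>
    hdet.mul (hq l k i j)
  have hlow : ∀ i j k l, AnalyticAt ℝ (fun t => lowCurv (G t).adjugate (p t)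
      (fun l k i j => (G t).det * q t l k i j) i j k l) t := fun i j k l => by
    simp only [lowCurv]
    exact (analyticAt_const.mul ((((hq' _ _ _ _).sub (hq' _ _ _ _)).sub (hq' _ _ _ _)).add
      (hq' _ _ _ _))).sub (Finset.analyticAt_fun_sum _ fun a _ => Finset.analyticAt_fun_sum _ fun b _ =>
        (hadj a b).mul (((hchr _ _ _).mul (hchr _ _ _)).sub ((hchr _ _ _).mul (hchr _ _ _))))
  have hup : ∀ i j k l, AnalyticAt ℝ (fun t => upCurv (G t).adjugate (p t)
      (fun l k i j => (G t).det * q t l k i j) i j k l) t := fun i j k l =>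
    Finset.analyticAt_fun_sum _ fun m _ => (hadj i m).mul (hlow m j k l)
  have hW : ∀ i j k l, AnalyticAt ℝ (fun t => polyWeyl (G t) (p t) (q t) i j k l) t := fun i j k l => by
    simp only [polyWeyl, weylExpr]
    exact (hup _ _ _ _).sub (analyticAt_const.mul
      ((analyticAt_const.mul (Finset.analyticAt_fun_sum _ fun a _ => hup _ _ _ _)).sub
        (analyticAt_const.mul (Finset.analyticAt_fun_sum _ fun a _ => hup _ _ _ _))))
  have hsys : ∀ r c, AnalyticAt ℝ (fun t => gaugedSystem (polyWeyl (G t) (p t) (q t)) r c) t := by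
    rintro (⟨i, j, k, l⟩ | ⟨i, j⟩ | u) c
    · simp only [gaugedSystem, Matrix.of_apply, tractorCoeff]
      exact (analyticAt_const.mul ((analyticAt_const.mul (hW _ _ _ _)).add
        (analyticAt_const.mul (hW _ _ _ _)))).sub (((((hW _ _ _ _).mul analyticAt_const).sub
          ((hW _ _ _ _).mul analyticAt_const)).add ((hW _ _ _ _).mul analyticAt_const)).sub
          ((hW _ _ _ _).mul analyticAt_const))
    · exact analyticAt_const
    · exact analyticAt_const
  refine analyticAt_det fun c c' => ?_
  simp only [Matrix.mul_apply, Matrix.transpose_apply]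
  exact Finset.analyticAt_fun_sum _ fun r _ => (hsys r c).mul (hsys r c')

/-! ## Perturbation to a generic metric -/

/-- A metric near `x₀` with flat value, vanishing first derivatives and given curvature at `x₀`. -/
def modelMetric (x₀ : E4) (x : E4) (i j : Fin 4) : ℝ :=
  kd i j * (1 + (1 / 2) * ∑ k, modelCurv i k * (x k - x₀ k) ^ 2)

theorem contDiff_coord (k : Fin 4) (x₀ : E4) : ContDiff ℝ ∞ (fun x : E4 => x k - x₀ k) :=
  (contDiff_euclidean.1 contDiff_id k).sub contDiff_const

theorem contDiff_modelMetric (x₀ : E4) (i j : Fin 4) :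
    ContDiff ℝ ∞ (fun x => modelMetric x₀ x i j) :=
  contDiff_const.mul (contDiff_const.add (contDiff_const.mul
    (ContDiff.sum fun k _ => contDiff_const.mul ((contDiff_coord k x₀).pow 2))))

theorem pd_coord (l k : Fin 4) (x₀ x : E4) : pd l (fun x : E4 => x k - x₀ k) x = kd l k := by
  have h : HasFDerivAt (fun x : E4 => x k - x₀ k) (EuclideanSpace.proj k : E4 →L[ℝ] ℝ) x :=
    (EuclideanSpace.proj k : E4 →L[ℝ] ℝ).hasFDerivAt.sub_const _
  rw [pd, h.fderiv]
  simp [coordVec, kd, eq_comm]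

theorem pd_modelMetric (x₀ x : E4) (k i j : Fin 4) : pd k (fun y => modelMetric x₀ y i j) x =
    (kd i j * modelCurv i k) * (x k - x₀ k) := by
  have dc : ∀ k, DifferentiableAt ℝ (fun x : E4 => x k - x₀ k) x := fun k =>
    (contDiff_coord k x₀).contDiffAt.differentiableAt (by simp)
  have d2 : ∀ k, DifferentiableAt ℝ (fun x : E4 => (x k - x₀ k) ^ 2) x := fun k => (dc k).fun_pow 2
  have hs : DifferentiableAt ℝ (fun x : E4 => ∑ k, modelCurv i k * (x k - x₀ k) ^ 2) x :=
    DifferentiableAt.fun_sum fun k _ => (d2 k).const_mul _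
  have hp : ∀ m, pd k (fun x : E4 => (x m - x₀ m) ^ 2) x = kd k m * (2 * (x m - x₀ m)) := fun m => by
    simp only [pow_two]
    rw [pd_mul (dc m) (dc m), pd_coord]; ring
  simp only [modelMetric]
  rw [pd_const_mul, pd_add (differentiableAt_const _) (hs.const_mul _), pd_const, pd_const_mul,
    pd_sum _ (fun m _ => (d2 m).const_mul _)]
  simp only [pd_const_mul, hp]
  have : ∀ m, modelCurv i m * (kd k m * (2 * (x m - x₀ m))) =
      kd k m * (modelCurv i m * (2 * (x m - x₀ m))) := fun m => by ring
  simp only [this, sum_kd_mul]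
  ring

theorem exists_bound_pd {f : E4 → ℝ} (hf : ContDiff ℝ ∞ f) (hc : HasCompactSupport f) :
    ContDiff ℝ ∞ f ∧ HasCompactSupport f ∧ (∀ k, ContDiff ℝ ∞ (pd k f) ∧ HasCompactSupport (pd k f)) ∧
      ∃ B : ℝ, 0 < B ∧ ∀ x, |f x| < B := by
  refine ⟨hf, hc, fun k => ⟨?_, ?_⟩, ?_⟩
  · exact contDiffOn_univ.1 (contDiffOn_pd isOpen_univ hf.contDiffOn k)
  · exact hc.fderiv_apply ℝ (coordVec k)
  · obtain ⟨C, hC⟩ := hc.exists_bound_of_continuous hf.continuous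
    refine ⟨|C| + 1, by positivity, fun x => ?_⟩
    have := hC x
    rw [Real.norm_eq_abs] at this
    linarith [le_abs_self C]

theorem exists_uniform_bound {ι : Type*} [Finite ι] {f : ι → E4 → ℝ}
    (h : ∀ i, ∃ B : ℝ, 0 < B ∧ ∀ x, |f i x| < B) : ∃ B : ℝ, 0 < B ∧ ∀ i x, |f i x| < B := by
  cases nonempty_fintype ι
  choose B hB hf using h
  refine ⟨1 + ∑ i, B i, by have := Finset.sum_nonneg (s := Finset.univ) fun i _ => (hB i).le; linarith,
    fun i x => ?_⟩
  have := Finset.single_le_sum (f := B) (fun i _ => (hB i).le) (Finset.mem_univ i)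
  linarith [hf i x]

/-- Along `g₀ + η χ (model - g₀)` the 2-jet at `x₀` runs affinely from that of `g₀` to the model
jet. Degenerate values on the way are harmless because the genericity function is polynomial; only
small `η` is used for the metric. -/
theorem exists_generic_perturbation {U : Set E4} (hU : IsOpen U) {x₀ : E4} (hx₀ : x₀ ∈ U)
    {g₀ : E4 → Mat4} (hg₀ : IsMetricOn U g₀) {ε : ℝ} (hε : 0 < ε) :
    ∃ g₁ : E4 → Mat4, IsMetricOn U g₁ ∧ C2CloseOn U ε g₁ g₀ ∧
      genericity (g₁ x₀) (jet1 g₁ x₀) (jet2 g₁ x₀) ≠ 0 := by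
  obtain ⟨r, hr, hrU⟩ := Metric.isOpen_iff.1 hU x₀ hx₀
  let χ : ContDiffBump x₀ := ⟨r / 4, r / 2, by positivity, by linarith⟩
  have hK : Metric.closedBall x₀ (r / 2) ⊆ U := (Metric.closedBall_subset_ball (by linarith)).trans hrU
  set f : Fin 4 → Fin 4 → E4 → ℝ := fun i j x => χ x * (modelMetric x₀ x i j - g₀ x i j) with hf
  -- Outside `U` the values of `g₀` are arbitrary, but there the bump factor is zero, so `f` is
  -- smooth on the whole space.
  have f0 : ∀ i j x, x ∉ Metric.closedBall x₀ (r / 2) → f i j x = 0 := fun i j x hx => by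
    have : χ x = 0 := χ.zero_of_le_dist (by
      rw [Metric.mem_closedBall, not_le] at hx; exact hx.le)
    rw [hf]; simp only [this, zero_mul]
  have fU : ∀ i j, ContDiffOn ℝ ∞ (f i j) U := fun i j =>
    χ.contDiff.contDiffOn.mul ((contDiff_modelMetric x₀ i j).contDiffOn.sub (hg₀.smooth i j))
  have fs : ∀ i j, ContDiff ℝ ∞ (f i j) := fun i j => by
    rw [contDiff_iff_contDiffAt]
    intro x
    by_cases hx : x ∈ U
    · exact (fU i j).contDiffAt (hU.mem_nhds hx)
    · have hx' : x ∈ (Metric.closedBall x₀ (r / 2))ᶜ := fun h => hx (hK h)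
      exact (contDiffAt_const (c := (0 : ℝ))).congr_of_eventuallyEq (Filter.eventuallyEq_of_mem
        (Metric.isClosed_closedBall.isOpen_compl.mem_nhds hx') fun y hy => f0 i j y hy)
  have fc : ∀ i j, HasCompactSupport (f i j) := fun i j =>
    HasCompactSupport.intro (isCompact_closedBall x₀ (r / 2)) fun x hx => f0 i j x hx
  have b0 := fun i j => exists_bound_pd (fs i j) (fc i j)
  have b1 := fun i j k => exists_bound_pd ((b0 i j).2.2.1 k).1 ((b0 i j).2.2.1 k).2
  have b2 := fun i j k l => exists_bound_pd ((b1 i j k).2.2.1 l).1 ((b1 i j k).2.2.1 l).2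
  obtain ⟨B0, hB0, hb0⟩ := exists_uniform_bound (f := fun s : Fin 4 × Fin 4 => f s.1 s.2)
    fun s => (b0 s.1 s.2).2.2.2
  obtain ⟨B1, hB1, hb1⟩ := exists_uniform_bound
    (f := fun s : Fin 4 × Fin 4 × Fin 4 => pd s.2.2 (f s.1 s.2.1))
    fun s => (b1 s.1 s.2.1 s.2.2).2.2.2
  obtain ⟨B2, hB2, hb2⟩ := exists_uniform_bound
    (f := fun s : Fin 4 × Fin 4 × Fin 4 × Fin 4 => pd s.2.2.2 (pd s.2.2.1 (f s.1 s.2.1)))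
    fun s => (b2 s.1 s.2.1 s.2.2.1 s.2.2.2).2.2.2
  let G : ℝ → E4 → Mat4 := fun η x => Matrix.of fun i j => g₀ x i j + η * f i j x
  have Gs : ∀ η i j, ContDiffOn ℝ ∞ (fun x => G η x i j) U := fun η i j =>
    (hg₀.smooth i j).add (contDiffOn_const.mul (fU i j))
  -- nondegeneracy
  have ev1 : ∀ᶠ η in nhds (0 : ℝ), ∀ x ∈ U, (G η x).det ≠ 0 := by
    have : ∀ᶠ η in nhds (0 : ℝ), ∀ x ∈ Metric.closedBall x₀ (r / 2), (G η x).det ≠ 0 := by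
      refine (isCompact_closedBall x₀ (r / 2)).eventually_forall_of_forall_eventually fun x hx => ?_
      have hc : ContinuousAt (fun z : ℝ × E4 => (G z.1 z.2).det) (0, x) := by
        have hent : ∀ i j, ContinuousAt (fun z : ℝ × E4 => G z.1 z.2 i j) (0, x) := fun i j =>
          (((hg₀.smooth i j).continuousOn.continuousAt (hU.mem_nhds (hK hx))).comp (f := Prod.snd)
            (x := ((0 : ℝ), x)) continuousAt_snd).add (continuousAt_fst.mul
              ((fs i j).continuous.continuousAt.comp (f := Prod.snd) continuousAt_snd))
        simp only [Matrix.det_apply]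
        exact tendsto_finsetSum _ fun σ _ => (tendsto_finsetProd _ fun i _ => hent _ _).const_smul _
      refine hc.eventually_ne ?_
      have : G 0 x = g₀ x := by ext i j; simp [G]
      simp only [this]
      exact hg₀.nondeg x (hK hx)
    refine this.mono fun η h x hx => ?_
    by_cases hxK : x ∈ Metric.closedBall x₀ (r / 2)
    · exact h x hxK
    · have : G η x = g₀ x := by ext i j; simp [G, f0 i j x hxK]
      rw [this]
      exact hg₀.nondeg x hx
  -- closeness
  have evB : ∀ B : ℝ, 0 < B → ∀ᶠ η in nhds (0 : ℝ), |η| * B < ε := fun B hB => by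
    have : Filter.Tendsto (fun η : ℝ => |η| * B) (nhds 0) (nhds (|0| * B)) :=
      (continuous_abs.mul continuous_const).tendsto 0
    rw [abs_zero, zero_mul] at this
    exact this.eventually (gt_mem_nhds hε)
  have Gpd : ∀ η i j k, ∀ x ∈ U, pd k (fun y => G η y i j) x =
      pd k (fun y => g₀ y i j) x + η * pd k (f i j) x := fun η i j k x hx => by
    rw [← pd_const_mul, ← pd_add (differentiableAt_of_contDiffOn hU (hg₀.smooth i j) hx)
      (((fs i j).contDiffAt.differentiableAt (by simp)).const_mul η)]
    rfl
  have Gpd2 : ∀ η i j k l, ∀ x ∈ U, pd l (fun z => pd k (fun y => G η y i j) z) x =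
      pd l (fun z => pd k (fun y => g₀ y i j) z) x + η * pd l (pd k (f i j)) x := fun η i j k l x hx => by
    rw [pd_congr_of_isOpen hU hx (Gpd η i j k) l, pd_add (differentiableAt_of_contDiffOn hU
      (contDiffOn_pd hU (hg₀.smooth i j) k) hx)
      (((b1 i j k).1.contDiffAt.differentiableAt (by simp)).const_mul η), pd_const_mul]
  have ev2 : ∀ᶠ η in nhds (0 : ℝ), C2CloseOn U ε (G η) g₀ := by
    filter_upwards [evB B0 hB0, evB B1 hB1, evB B2 hB2] with η h0 h1 h2 x hx i j
    have small : ∀ {a b B : ℝ}, |b| < B → |η| * B < ε → |a + η * b - a| < ε := fun {a b B} hb hB => by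
      rw [add_sub_cancel_left, abs_mul]
      exact (mul_le_mul_of_nonneg_left hb.le (abs_nonneg η)).trans_lt hB
    refine ⟨small (hb0 (i, j) x) h0, fun k => ?_, fun k l => ?_⟩
    · rw [Gpd η i j k x hx]
      exact small (hb1 (i, j, k) x) h1
    · rw [Gpd2 η i j k l x hx]
      exact small (hb2 (i, j, k, l) x) h2
  -- genericity
  have χ1 : ∀ᶠ x in nhds x₀, ∀ i j, f i j x = modelMetric x₀ x i j - g₀ x i j := by
    filter_upwards [χ.eventuallyEq_one] with x hx i j
    rw [hf]; simp only [hx, Pi.one_apply, one_mul]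
  have dm : ∀ i j x, DifferentiableAt ℝ (fun y => modelMetric x₀ y i j) x := fun i j x =>
    (contDiff_modelMetric x₀ i j).contDiffAt.differentiableAt (by simp)
  have fpd : ∀ᶠ x in nhds x₀, ∀ i j k, pd k (f i j) x =
      (kd i j * modelCurv i k) * (x k - x₀ k) - pd k (fun y => g₀ y i j) x := by
    filter_upwards [χ1.eventually_nhds, hU.mem_nhds hx₀] with x hx hxU i j k
    have hxe : f i j =ᶠ[nhds x] fun y => modelMetric x₀ y i j - g₀ y i j := hx.mono fun y hy => hy i j
    rw [pd_congr hxe, pd_sub (dm i j x)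
      (differentiableAt_of_contDiffOn hU (hg₀.smooth i j) hxU), pd_modelMetric]
  have f2 : ∀ i j k l, pd l (pd k (f i j)) x₀ =
      modelJet2 l k i j - pd l (fun z => pd k (fun y => g₀ y i j) z) x₀ := fun i j k l => by
    have hxe : pd k (f i j) =ᶠ[nhds x₀] fun x => (kd i j * modelCurv i k) * (x k - x₀ k) -
      pd k (fun y => g₀ y i j) x := fpd.mono fun y hy => hy i j k
    rw [pd_congr hxe, pd_sub (((contDiff_coord k x₀).contDiffAt.differentiableAt (by simp)).const_mul _)
      (differentiableAt_of_contDiffOn hU (contDiffOn_pd hU (hg₀.smooth i j) k) hx₀), pd_const_mul,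
      pd_coord, modelJet2]
    ring
  have f1 : ∀ i j k, pd k (f i j) x₀ = - pd k (fun y => g₀ y i j) x₀ := fun i j k => by
    rw [fpd.self_of_nhds i j k, sub_self, mul_zero, zero_sub]
  have fv : ∀ i j, f i j x₀ = kd i j - g₀ x₀ i j := fun i j => by
    rw [χ1.self_of_nhds i j]
    simp [modelMetric]
  set P : ℝ → ℝ := fun η => genericity (Matrix.of fun i j => g₀ x₀ i j + η * (kd i j - g₀ x₀ i j))
    (fun k i j => jet1 g₀ x₀ k i j + η * (- jet1 g₀ x₀ k i j))
    (fun l k i j => jet2 g₀ x₀ l k i j + η * (modelJet2 l k i j - jet2 g₀ x₀ l k i j)) with hP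
  have hPG : ∀ η, genericity (G η x₀) (jet1 (G η) x₀) (jet2 (G η) x₀) = P η := fun η => by
    rw [hP]
    congr 1
    · ext i j; simp only [G, Matrix.of_apply, fv]
    · funext k i j
      rw [jet1, Gpd η i j k x₀ hx₀, f1]; rfl
    · funext l k i j
      rw [jet2, Gpd2 η i j k l x₀ hx₀, f2]; rfl
  have hP1 : P 1 ≠ 0 := by
    have := genericity_model
    rw [hP]
    simp only [one_mul, add_sub_cancel, add_neg_cancel]
    convert this
    · ext i j
      rw [Matrix.of_apply, one_apply_eq_kd]
    · rfl
  have hPan : AnalyticOnNhd ℝ P Set.univ := fun η _ => by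
    have aff : ∀ a b : ℝ, AnalyticAt ℝ (fun η : ℝ => a + η * b) η := fun a b =>
      analyticAt_const.add (analyticAt_id.mul analyticAt_const)
    exact analyticAt_genericity (fun i j => aff _ _) (fun k i j => aff _ _) (fun l k i j => aff _ _)
  -- A real analytic function on the line that is nonzero at `1` cannot vanish identically near `0`.
  have ev3 : ∀ᶠ η in nhdsWithin (0 : ℝ) {0}ᶜ, P η ≠ 0 := by
    rcases (hPan 0 trivial).eventually_eq_zero_or_eventually_ne_zero with h | h
    · exact absurd (hPan.eqOn_zero_of_preconnected_of_eventuallyEq_zero isPreconnected_univ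
        (Set.mem_univ 0) h (Set.mem_univ 1)) hP1
    · exact h
  obtain ⟨η, ⟨h1, h2⟩, h3⟩ := (((ev1.and ev2).filter_mono nhdsWithin_le_nhds).and ev3).exists
  refine ⟨G η, ⟨⟨Gs η, fun x hx => ?_⟩, h1⟩, h2, by rw [hPG]; exact h3⟩
  refine Matrix.IsSymm.ext fun i j => ?_
  have hm : modelMetric x₀ x j i = modelMetric x₀ x i j := by
    rcases eq_or_ne i j with rfl | hij
    · rfl
    · simp [modelMetric, kd, hij, hij.symm]
  simp only [G, Matrix.of_apply, hf, hm, hg₀.apply_comm hx j i]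

/-! ## Genericity is an open condition -/

/-- The 2-jet of a metric. -/
def jet (g : E4 → Mat4) (x : E4) : Arr2 × Arr3 × Arr4 := (fun i j => g x i j, jet1 g x, jet2 g x)

/-- `genericity` as a function on the space of 2-jets. -/
def jetGenericity (z : Arr2 × Arr3 × Arr4) : ℝ := genericity (Matrix.of z.1) z.2.1 z.2.2

theorem analyticAt_jetGenericity (z : Arr2 × Arr3 × Arr4) : AnalyticAt ℝ jetGenericity z := by
  have h1 : AnalyticAt ℝ (fun z : Arr2 × Arr3 × Arr4 => z.1) z := analyticAt_fst
  have h2 : AnalyticAt ℝ (fun z : Arr2 × Arr3 × Arr4 => z.2.1) z :=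
    (analyticAt_fst (p := z.2)).comp analyticAt_snd
  have h3 : AnalyticAt ℝ (fun z : Arr2 × Arr3 × Arr4 => z.2.2) z :=
    (analyticAt_snd (p := z.2)).comp analyticAt_snd
  exact analyticAt_genericity (G := fun z : Arr2 × Arr3 × Arr4 => Matrix.of z.1)
    (p := fun z => z.2.1) (q := fun z => z.2.2)
    (fun i j => (h1.apply i).apply j) (fun k i j => ((h2.apply k).apply i).apply j)
    (fun l k i j => (((h3.apply l).apply k).apply i).apply j)

/-- `C²`-closeness is the sup distance of 2-jets, so half of the radius `δ` is spent on moving `g`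
to `g₁` and half on moving the point to `x₀`. -/
theorem exists_generic_nhd {U : Set E4} (hU : IsOpen U) {x₀ : E4} (hx₀ : x₀ ∈ U)
    {g₁ : E4 → Mat4} (hg₁ : IsMetricOn U g₁)
    (hgen : genericity (g₁ x₀) (jet1 g₁ x₀) (jet2 g₁ x₀) ≠ 0) :
    ∃ (V : Set E4) (ε' : ℝ), IsOpen V ∧ IsConnected V ∧ x₀ ∈ V ∧ V ⊆ U ∧ 0 < ε' ∧
      ∀ g : E4 → Mat4, C2CloseOn V ε' g g₁ → ∀ x ∈ V,
        genericity (g x) (jet1 g x) (jet2 g x) ≠ 0 := by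
  have hFc := (analyticAt_jetGenericity (jet g₁ x₀)).continuousAt
  obtain ⟨δ, hδ, hball⟩ := Metric.eventually_nhds_iff.1 (hFc.eventually_ne hgen)
  have hjc : ContinuousAt (jet g₁) x₀ := by
    have c : ∀ {f : E4 → ℝ}, ContDiffOn ℝ ∞ f U → ContinuousAt f x₀ := fun h =>
      h.continuousOn.continuousAt (hU.mem_nhds hx₀)
    refine ContinuousAt.prodMk ?_ (ContinuousAt.prodMk ?_ ?_)
    · exact continuousAt_pi.2 fun i => continuousAt_pi.2 fun j => c (hg₁.smooth i j)
    · exact continuousAt_pi.2 fun k => continuousAt_pi.2 fun i => continuousAt_pi.2 fun j =>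
        c (hg₁.contDiffOn_jet1 hU k i j)
    · exact continuousAt_pi.2 fun l => continuousAt_pi.2 fun k => continuousAt_pi.2 fun i =>
        continuousAt_pi.2 fun j => c (hg₁.contDiffOn_jet2 hU l k i j)
  obtain ⟨ρ, hρ, hρball⟩ := Metric.eventually_nhds_iff.1
    ((hjc.eventually (Metric.ball_mem_nhds _ (half_pos hδ))).and (hU.mem_nhds hx₀))
  refine ⟨Metric.ball x₀ ρ, δ / 2, Metric.isOpen_ball, (convex_ball x₀ ρ).isConnected ⟨x₀, Metric.mem_ball_self hρ⟩, Metric.mem_ball_self hρ,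
    fun x hx => (hρball hx).2, half_pos hδ, fun g hg x hx => ?_⟩
  have h1 : dist (jet g x) (jet g₁ x) < δ / 2 := by
    have hd := half_pos hδ
    rw [Prod.dist_eq, Prod.dist_eq, max_lt_iff, max_lt_iff]
    refine ⟨?_, ?_, ?_⟩
    · exact (dist_pi_lt_iff hd).2 fun i => (dist_pi_lt_iff hd).2 fun j => (hg x hx i j).1
    · exact (dist_pi_lt_iff hd).2 fun k => (dist_pi_lt_iff hd).2 fun i => (dist_pi_lt_iff hd).2
        fun j => (hg x hx i j).2.1 k
    · exact (dist_pi_lt_iff hd).2 fun l => (dist_pi_lt_iff hd).2 fun k => (dist_pi_lt_iff hd).2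
        fun i => (dist_pi_lt_iff hd).2 fun j => (hg x hx i j).2.2 k l
  have h2 : dist (jet g₁ x) (jet g₁ x₀) < δ / 2 := (hρball hx).1
  exact hball (y := jet g x) (lt_of_le_of_lt (dist_triangle _ (jet g₁ x) _) (by linarith))

/-! ## Reconstruction of a generic metric -/

/-- `Real.log` sees only `|f|`, so the sign of the conformal factor must be a single constant on a
connected domain. -/
theorem exists_sign {X : Type*} [TopologicalSpace X] {V : Set X} (hV : IsPreconnected V) {f : X → ℝ}
    (hf : ContinuousOn f V) (h0 : ∀ x ∈ V, f x ≠ 0) : ∃ s : ℝ, s ≠ 0 ∧ ∀ x ∈ V, |f x| = s * f x := by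
  by_cases hpos : ∀ x ∈ V, 0 < f x
  · exact ⟨1, one_ne_zero, fun x hx => by rw [abs_of_pos (hpos x hx), one_mul]⟩
  · push Not at hpos
    obtain ⟨y, hy, hy0⟩ := hpos
    refine ⟨-1, by norm_num, fun x hx => ?_⟩
    have : f x ≤ 0 := by
      by_contra hx0
      obtain ⟨z, hz, hz0⟩ := hV.intermediate_value hy hx hf ⟨hy0, (not_le.1 hx0).le⟩
      exact h0 z hz hz0
    rw [abs_of_nonpos this]; ring

/-- Recovers the conformal factor from its logarithm up to a constant. -/
theorem conformal_factor_eq {f s k lam : ℝ} (hf : f ≠ 0) (hs : s ≠ 0) (hfs : |f| = s * f)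
    (hlam : lam - -(1 / 5) * Real.log f = k) :
    f = (s⁻¹ * Real.exp (5 * k)) * Real.exp (-5 * lam) := by
  have h : Real.exp (5 * k) * Real.exp (-5 * lam) = |f| := by
    rw [← Real.exp_add, ← hlam, ← Real.exp_log (abs_pos.mpr hf), Real.log_abs]
    ring_nf
  rw [mul_assoc, h, hfs, ← mul_assoc, inv_mul_cancel₀ hs, one_mul]

section

variable {V : Set E4} {g : E4 → Mat4} {Γ : Symbols}

/-- One solution of (4) is the logarithm of the known factor; any other has the same differential,
and connectedness makes the difference constant. -/
theorem reconstruct_of_conformal (hV : IsOpen V) (hVc : IsConnected V)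
    (hΓ : IsSymbolsOn V Γ) (hc : InProjClassOn V Γ g) {a : E4 → Mat4} (ha : IsMetricOn V a)
    {f : E4 → ℝ} (hf : ContDiffOn ℝ ∞ f V) (hfa : ∀ x ∈ V, f x ≠ 0 ∧ g x = f x • a x) :
    (∀ x ∈ V, ∃! ℓ : Fin 4 → ℝ, FactorSystem Γ (weighted a) x ℓ) ∧
    (∃ lam : E4 → ℝ, ContDiffOn ℝ ∞ lam V ∧ SolvesFactorOn V Γ (weighted a) lam) ∧
    (∀ lam : E4 → ℝ, ContDiffOn ℝ ∞ lam V → SolvesFactorOn V Γ (weighted a) lam →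
      ∃ c : ℝ, c ≠ 0 ∧ ∀ x ∈ V, g x = (c * Real.exp (-5 * lam x)) • a x) := by
  obtain ⟨s, hs, hfs⟩ := exists_sign hVc.isPreconnected hf.continuousOn fun x hx => (hfa x hx).1
  obtain ⟨hl, hsol⟩ := solvesFactorOn_log hV ha hΓ hc hf hs
    (fun x hx => ⟨(hfa x hx).1, hfs x hx⟩) fun x hx => (hfa x hx).2
  refine ⟨fun x hx => ⟨_, hsol x hx, fun ℓ hℓ =>
    FactorSystem.unique (weighted_isSymm ha hx) (ha.det_weighted_ne_zero hx) hℓ (hsol x hx)⟩,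
    ⟨_, hl, hsol⟩, fun lam hlam hlsol => ?_⟩
  have dl : ∀ {u : E4 → ℝ}, ContDiffOn ℝ ∞ u V → DifferentiableOn ℝ u V := fun hu =>
    hu.differentiableOn (by simp)
  obtain ⟨k, hk⟩ := hV.exists_is_const_of_fderiv_eq_zero hVc.isPreconnected ((dl hlam).sub (dl hl))
    fun x hx => by
      rw [fderiv_sub (((dl hlam) x hx).differentiableAt (hV.mem_nhds hx))
        (((dl hl) x hx).differentiableAt (hV.mem_nhds hx)), hlsol.fderiv_eq ha hsol hx, sub_self]
      rfl
  refine ⟨s⁻¹ * Real.exp (5 * k), mul_ne_zero (inv_ne_zero hs) (Real.exp_ne_zero _), fun x hx => ?_⟩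
  rw [← conformal_factor_eq (hfa x hx).1 hs (hfs x hx) (hk x hx), (hfa x hx).2]

theorem contDiffOn_trace_mul {S T : E4 → Mat4} (hS : ∀ i j, ContDiffOn ℝ ∞ (fun x => S x i j) V)
    (hT : ∀ i j, ContDiffOn ℝ ∞ (fun x => T x i j) V) :
    ContDiffOn ℝ ∞ (fun x => (S x * T x).trace) V := by
  simp only [Matrix.trace, Matrix.diag_apply, Matrix.mul_apply]
  exact ContDiffOn.sum fun i _ => ContDiffOn.sum fun j _ => (hS i j).mul (hT j i)

/-- The trace formula for `c` is what makes the pointwise factor depend smoothly on the point. -/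
theorem smul_inv_of_eq_smul {G S : Mat4} {c : ℝ} (hG : G.det ≠ 0) (hc : c ≠ 0) (h : S = c • G⁻¹) :
    S.det ≠ 0 ∧ (S * G).trace / 4 = c ∧ G = c • S⁻¹ := by
  have hu : IsUnit G.det := isUnit_iff_ne_zero.mpr hG
  have hdet : S.det ≠ 0 := by
    rw [h, Matrix.det_smul, Matrix.det_nonsing_inv, Ring.inverse_eq_inv']
    exact mul_ne_zero (pow_ne_zero _ hc) (inv_ne_zero hG)
  have hSG : S * G = c • (1 : Mat4) := by rw [h, smul_mul_assoc, Matrix.nonsing_inv_mul _ hu]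
  refine ⟨hdet, ?_, ?_⟩
  · rw [hSG, Matrix.trace_smul, Matrix.trace_one]; simp
  · calc G = S⁻¹ * (S * G) := by
          rw [← mul_assoc, Matrix.nonsing_inv_mul _ (isUnit_iff_ne_zero.mpr hdet), one_mul]
      _ = _ := by rw [hSG, mul_smul_comm, mul_one]

theorem isMetricOn_inv {S : E4 → Mat4} (hS : IsSymFieldOn V S) (hdet : ∀ x ∈ V, (S x).det ≠ 0) :
    IsMetricOn V (fun x => (S x)⁻¹) where
  smooth := ProjRec.contDiffOn_inv hS.smooth hdet
  symm x hx := symm_inv (hS.symm x hx)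
  nondeg x hx := by
    rw [Matrix.det_nonsing_inv, Ring.inverse_eq_inv']
    exact inv_ne_zero (hdet x hx)

theorem reconstruct_of_tractorSystem (hV : IsOpen V) (hVc : IsConnected V) (hg : IsMetricOn V g)
    (hΓ : IsSymbolsOn V Γ) (hc : InProjClassOn V Γ g)
    (hker : ∀ x ∈ V, ∀ S : Mat4, S.IsSymm → (TractorSystem (weyl Γ x) S ↔ ∃ c : ℝ, S = c • (g x)⁻¹))
    {S : E4 → Mat4} (hS : IsSymFieldOn V S) (hS0 : ∀ x ∈ V, S x ≠ 0)
    (hsol : ∀ x ∈ V, TractorSystem (weyl Γ x) (S x)) :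
    IsMetricOn V (fun x => (S x)⁻¹) ∧
    (∃ f : E4 → ℝ, ContDiffOn ℝ ∞ f V ∧ ∀ x ∈ V, f x ≠ 0 ∧ g x = f x • (S x)⁻¹) ∧
    (∀ x ∈ V, ∃! ℓ : Fin 4 → ℝ, FactorSystem Γ (weighted (fun y => (S y)⁻¹)) x ℓ) ∧
    (∃ lam : E4 → ℝ, ContDiffOn ℝ ∞ lam V ∧ SolvesFactorOn V Γ (weighted (fun y => (S y)⁻¹)) lam) ∧
    (∀ lam : E4 → ℝ, ContDiffOn ℝ ∞ lam V → SolvesFactorOn V Γ (weighted (fun y => (S y)⁻¹)) lam →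
      ∃ c : ℝ, c ≠ 0 ∧ ∀ x ∈ V, g x = (c * Real.exp (-5 * lam x)) • (S x)⁻¹) := by
  have key : ∀ x ∈ V, (S x).det ≠ 0 ∧ (S x * g x).trace / 4 ≠ 0 ∧
      g x = ((S x * g x).trace / 4) • (S x)⁻¹ := fun x hx => by
    obtain ⟨c, hcx⟩ := (hker x hx (S x) (hS.symm x hx)).1 (hsol x hx)
    have hc0 : c ≠ 0 := by
      rintro rfl
      exact hS0 x hx (by rw [hcx, zero_smul])
    obtain ⟨h1, h2, h3⟩ := smul_inv_of_eq_smul (hg.nondeg x hx) hc0 hcx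
    rw [h2]
    exact ⟨h1, hc0, h3⟩
  have ha := isMetricOn_inv hS fun x hx => (key x hx).1
  have hf : ContDiffOn ℝ ∞ (fun x => (S x * g x).trace / 4) V :=
    (contDiffOn_trace_mul hS.smooth hg.smooth).div_const _
  exact ⟨ha, ⟨_, hf, fun x hx => (key x hx).2⟩,
    reconstruct_of_conformal hV hVc hΓ hc ha hf fun x hx => (key x hx).2⟩

/-- The inverse of any other metric in the class also solves (2), by projective invariance of the
Weyl tensor, so it can serve as the field `S` in the reconstruction. -/
theorem eq_smul_of_inProjClassOn (hV : IsOpen V) (hVc : IsConnected V) (hg : IsMetricOn V g)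
    (hΓ : IsSymbolsOn V Γ) (hc : InProjClassOn V Γ g)
    (hker : ∀ x ∈ V, ∀ S : Mat4, S.IsSymm → (TractorSystem (weyl Γ x) S ↔ ∃ c : ℝ, S = c • (g x)⁻¹))
    {g' : E4 → Mat4} (hg' : IsMetricOn V g') (hc' : InProjClassOn V Γ g') :
    ∃ c : ℝ, c ≠ 0 ∧ ∀ x ∈ V, g' x = c • g x := by
  have hdet : ∀ x ∈ V, ((g' x)⁻¹).det ≠ 0 := fun x hx => by
    rw [Matrix.det_nonsing_inv, Ring.inverse_eq_inv']
    exact inv_ne_zero (hg'.nondeg x hx)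
  have hinv : ∀ x ∈ V, ((g' x)⁻¹)⁻¹ = g' x := fun x hx =>
    Matrix.nonsing_inv_nonsing_inv _ (hg'.isUnit_det hx)
  have hS : IsSymFieldOn V (fun x => (g' x)⁻¹) :=
    ⟨hg'.contDiffOn_inv, fun x hx => symm_inv (hg'.symm x hx)⟩
  obtain ⟨ha, -, -, -, h⟩ := reconstruct_of_tractorSystem hV hVc hg hΓ hc hker hS
    (fun x hx h0 => hdet x hx (by rw [h0]; exact Matrix.det_zero))
    (fun x hx => by
      rw [hc'.weyl_eq hV hg' hΓ hx]
      exact hg'.tractorSystem_inv hV hx)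
  -- With `a = g'` already in the projective class, the zero function solves (4), so no conformal
  -- factor remains.
  obtain ⟨c, hc0, hcx⟩ := h (fun _ => 0) contDiffOn_const
    ((solvesFactorOn_iff_inProjClassOn hV ha hΓ contDiffOn_const).2
      ((inProjClassOn_const_smul_iff hV one_ne_zero fun x hx => by simp [hinv x hx]).2 hc'))
  refine ⟨c⁻¹, inv_ne_zero hc0, fun x hx => ?_⟩
  rw [hcx x hx, hinv x hx, mul_zero, Real.exp_zero, mul_one, smul_smul, inv_mul_cancel₀ hc0, one_smul]

end

/-! ## Charts -/

section Manifold

variable {M : Type*} [TopologicalSpace M] [ChartedSpace E4 M]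

/-- The differential of a chart is invertible, so its coordinate fields form a frame; this transfers
identities of components to identities of tensors. -/
theorem exists_coordField_eq {e : OpenPartialHomeomorph M E4} (he : e ∈ charts M) {p : M}
    (hp : p ∈ e.source) : ∃ L : TangentSpace (𝓡 4) p ≃L[ℝ] E4,
      ∀ i, coordField e i p = L.symm (coordVec i) := by
  have hd : e.MDifferentiable (𝓡 4) 𝓘(ℝ, E4) :=
    ⟨(contMDiffOn_of_mem_maximalAtlas he).mdifferentiableOn (by simp),
      (contMDiffOn_symm_of_mem_maximalAtlas he).mdifferentiableOn (by simp)⟩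
  let L : TangentSpace (𝓡 4) p ≃L[ℝ] E4 := hd.mfderiv hp
  refine ⟨L, fun i => ?_⟩
  have : (L : TangentSpace (𝓡 4) p →L[ℝ] E4).inverse = L.symm := ContinuousLinearMap.inverse_equiv _
  exact congrArg (fun T : E4 →L[ℝ] TangentSpace (𝓡 4) p => T (coordVec i)) this

theorem sum_coordVec (v : E4) : v = ∑ i, v i • coordVec i := by
  have := (EuclideanSpace.basisFun (Fin 4) ℝ).sum_repr v
  simpa [coordVec] using this.symm

theorem bilin_ext_coordField {e : OpenPartialHomeomorph M E4} (he : e ∈ charts M) {p : M}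
    (hp : p ∈ e.source) {F : Type*} [AddCommGroup F] [Module ℝ F] [TopologicalSpace F]
    {A B : TangentSpace (𝓡 4) p →L[ℝ] F} (h : ∀ i, A (coordField e i p) = B (coordField e i p)) :
    A = B := by
  obtain ⟨L, hL⟩ := exists_coordField_eq he hp
  ext v
  obtain ⟨u, rfl⟩ := L.symm.surjective v
  rw [sum_coordVec u]
  simp only [map_sum, map_smul, ← hL, h]

theorem eq_smul_of_comp_eq_smul {g a : BilinField M} {e : OpenPartialHomeomorph M E4}
    (he : e ∈ charts M) {x : E4} (hx : x ∈ e.target) {c : ℝ}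
    (h : comp g e x = c • comp a e x) : g (e.symm x) = c • a (e.symm x) := by
  have hp := e.map_target hx
  refine bilin_ext_coordField he hp fun i => bilin_ext_coordField he hp fun j => ?_
  exact congrFun (congrFun h i) j

theorem IsMetric.isMetricOn {g : BilinField M} (hg : IsMetric g) {e : OpenPartialHomeomorph M E4}
    (he : e ∈ charts M) : IsMetricOn e.target (comp g e) := by
  refine ⟨hg.1.2 e he, fun x hx h0 => ?_⟩
  obtain ⟨v, hv, hv0⟩ := Matrix.exists_mulVec_eq_zero_iff.2 h0
  have hp := e.map_target hx
  obtain ⟨L, hL⟩ := exists_coordField_eq he hp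
  set X : TangentSpace (𝓡 4) (e.symm x) := L.symm (WithLp.toLp 2 v) with hX
  have hXs : X = ∑ j, v j • coordField e j (e.symm x) := by
    rw [hX, sum_coordVec (WithLp.toLp 2 v)]
    simp only [map_sum, map_smul, ← hL]
  have hz : g (e.symm x) X = 0 := by
    refine bilin_ext_coordField he hp fun i => ?_
    rw [hg.1.1, hXs]
    simp only [map_sum, map_smul, smul_eq_mul, zero_apply]
    have := congrFun hv0 i
    rw [Pi.zero_apply] at this
    rw [← this]
    exact Finset.sum_congr rfl fun j _ => mul_comm _ _
  have hX0 : X = 0 := hg.2 _ X fun w => by rw [hz]; rfl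
  rw [hX, map_eq_zero_iff _ L.symm.injective] at hX0
  exact hv (by simpa using congrArg WithLp.ofLp hX0)

theorem contDiffOn_comp_symm {f : M → ℝ} (hf : ContMDiff (𝓡 4) 𝓘(ℝ, ℝ) ∞ f)
    {e : OpenPartialHomeomorph M E4} (he : e ∈ charts M) :
    ContDiffOn ℝ ∞ (fun x => f (e.symm x)) e.target :=
  contMDiffOn_iff_contDiffOn.1 (hf.comp_contMDiffOn (contMDiffOn_symm_of_mem_maximalAtlas he))

theorem comp_exp_smul (a : BilinField M) (lam : M → ℝ) (e : OpenPartialHomeomorph M E4) :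
    comp (fun p => Real.exp (-5 * lam p) • a p) e =
      fun x => Real.exp (-5 * lam (e.symm x)) • comp a e x := rfl

variable [IsManifold (𝓡 4) ∞ M]

theorem contMDiff_of_charts {f : M → ℝ}
    (h : ∀ e ∈ charts M, ContDiffOn ℝ ∞ (fun x => f (e.symm x)) e.target) :
    ContMDiff (𝓡 4) 𝓘(ℝ, ℝ) ∞ f := by
  intro p
  have he : chartAt E4 p ∈ charts M := IsManifold.chart_mem_maximalAtlas p
  have hp := mem_chart_source E4 p
  have h1 := (contMDiffOn_iff_contDiffOn.2 (h _ he)).comp (contMDiffOn_of_mem_maximalAtlas he)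
    fun q hq => (chartAt E4 p).map_source hq
  refine (h1.contMDiffAt ((chartAt E4 p).open_source.mem_nhds hp)).congr_of_eventuallyEq ?_
  filter_upwards [(chartAt E4 p).open_source.mem_nhds hp] with q hq
  simp [(chartAt E4 p).left_inv hq]

theorem exists_chart (p : M) : ∃ e ∈ charts M, ∃ x ∈ e.target, e.symm x = p :=
  ⟨chartAt E4 p, IsManifold.chart_mem_maximalAtlas p, chartAt E4 p p, mem_chart_target E4 p,
    (chartAt E4 p).left_inv (mem_chart_source E4 p)⟩

/-! ## The conformal factor on a manifold -/

theorem solvesFactor_iff {cov : Connection M} {a : BilinField M} {lam : M → ℝ}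
    (hcov : IsSymmConnection cov) (ha : IsMetric a) (hl : ContMDiff (𝓡 4) 𝓘(ℝ, ℝ) ∞ lam) :
    (SolvesFactor cov a lam ↔ SolvesMetrizability cov a lam) ∧
    (SolvesFactor cov a lam ↔ InProjClass cov (fun p => Real.exp (-5 * lam p) • a p)) := by
  constructor
  · exact forall_congr' fun e => forall_congr' fun he => solvesFactorOn_iff e.open_target
      (ha.isMetricOn he).contDiffOn_weighted (contDiffOn_comp_symm hl he)
  · refine forall_congr' fun e => forall_congr' fun he => ?_
    rw [comp_exp_smul]
    exact solvesFactorOn_iff_inProjClassOn e.open_target (ha.isMetricOn he) (hcov e he)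
      (contDiffOn_comp_symm hl he)

theorem exists_const_of_fderiv_eq [PreconnectedSpace M] [Nonempty M] {f f' : M → ℝ}
    (hf : ContMDiff (𝓡 4) 𝓘(ℝ, ℝ) ∞ f) (hf' : ContMDiff (𝓡 4) 𝓘(ℝ, ℝ) ∞ f')
    (h : ∀ e ∈ charts M, ∀ x ∈ e.target,
      fderiv ℝ (fun x => f (e.symm x)) x = fderiv ℝ (fun x => f' (e.symm x)) x) :
    ∃ k : ℝ, ∀ p, f p - f' p = k := by
  -- In a chart the difference has zero derivative on a ball, which is connected; global
  -- connectedness is used only afterwards.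
  have hloc : IsLocallyConstant (fun p => f p - f' p) := by
    rw [IsLocallyConstant.iff_eventually_eq]
    intro p
    set e := chartAt E4 p with he_def
    have he : e ∈ charts M := IsManifold.chart_mem_maximalAtlas p
    have hp : p ∈ e.source := mem_chart_source E4 p
    obtain ⟨r, hr, hball⟩ := Metric.isOpen_iff.1 e.open_target (e p) (e.map_source hp)
    have d : ∀ {u : M → ℝ}, ContMDiff (𝓡 4) 𝓘(ℝ, ℝ) ∞ u → ∀ x ∈ e.target,
        DifferentiableAt ℝ (fun x => u (e.symm x)) x := fun hu x hx =>
      differentiableAt_of_contDiffOn e.open_target (contDiffOn_comp_symm hu he) hx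
    obtain ⟨k, hk⟩ := Metric.isOpen_ball.exists_is_const_of_fderiv_eq_zero
      (f := fun x => f (e.symm x) - f' (e.symm x))
      (convex_ball (e p) r).isPreconnected
      (fun x hx => ((d hf x (hball hx)).fun_sub (d hf' x (hball hx))).differentiableWithinAt)
      (fun x hx => by
        rw [fderiv_fun_sub (d hf x (hball hx)) (d hf' x (hball hx)), h e he x (hball hx), sub_self]
        rfl)
    have hev : ∀ᶠ q in nhds p, q ∈ e.source ∧ e q ∈ Metric.ball (e p) r :=
      Filter.Eventually.and (e.open_source.mem_nhds hp)
        ((e.continuousAt hp).eventually_mem (Metric.ball_mem_nhds _ hr))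
    filter_upwards [hev] with q hq
    have e1 := hk (e q) hq.2
    have e2 := hk (e p) (Metric.mem_ball_self hr)
    rw [e.left_inv hq.1] at e1
    rw [e.left_inv hp] at e2
    rw [e1, e2]
  obtain ⟨p₀⟩ := ‹Nonempty M›
  exact ⟨f p₀ - f' p₀, fun p => hloc.apply_eq_of_isPreconnected isPreconnected_univ trivial trivial⟩

/-- A tensor whose components are pointwise multiples of those of a metric is conformal to it. -/
theorem exists_conformal_factor {g a : BilinField M} (hg : IsMetric g) (ha : IsSymTensor a)
    (ha0 : ∀ p, a p ≠ 0)
    (h : ∀ e ∈ charts M, ∀ x ∈ e.target, ∃ c : ℝ, comp a e x = c • comp g e x) :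
    IsMetric a ∧ ∃ f : M → ℝ, ContMDiff (𝓡 4) 𝓘(ℝ, ℝ) ∞ f ∧ ∀ p, f p ≠ 0 ∧ g p = f p • a p := by
  have hc : ∀ p, ∃ c : ℝ, c ≠ 0 ∧ a p = c • g p := fun p => by
    obtain ⟨e, he, x, hx, rfl⟩ := exists_chart p
    obtain ⟨c, hcx⟩ := h e he x hx
    have := eq_smul_of_comp_eq_smul he hx hcx
    refine ⟨c, ?_, this⟩
    rintro rfl
    exact ha0 _ (this.trans (by ext v w; exact zero_mul _))
  choose c hc0 hc using hc
  have hgf : ∀ p, g p = (c p)⁻¹ • a p := fun p => by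
    rw [hc p, smul_smul, inv_mul_cancel₀ (hc0 p), one_smul]
  refine ⟨⟨ha, fun p v hv => hg.2 p v fun w => ?_⟩, fun p => (c p)⁻¹,
    contMDiff_of_charts fun e he => ?_, fun p => ⟨inv_ne_zero (hc0 p), hgf p⟩⟩
  · rw [hgf p]
    change (c p)⁻¹ * a p v w = 0
    rw [hv w, mul_zero]
  · have hm := hg.isMetricOn he
    -- The factor was chosen pointwise; the trace formula in a chart shows that it is smooth.
    have e1 : ∀ x ∈ e.target, c (e.symm x) = (comp a e x * (comp g e x)⁻¹).trace / 4 := fun x hx => by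
      have : comp a e x = c (e.symm x) • comp g e x := by
        ext i j
        change a (e.symm x) _ _ = c (e.symm x) * g (e.symm x) _ _
        rw [hc (e.symm x)]; rfl
      rw [this, smul_mul_assoc, hm.mul_inv hx, Matrix.trace_smul, Matrix.trace_one]
      simp
    have e2 : ContDiffOn ℝ ∞ (fun x => c (e.symm x)) e.target :=
      ContDiffOn.congr ((contDiffOn_trace_mul (ha.2 e he).smooth hm.contDiffOn_inv).div_const _) e1
    exact e2.inv fun x _ => hc0 _

theorem reconstruct_of_conformal_manifold [ConnectedSpace M] {cov : Connection M}
    {g a : BilinField M} (hcov : IsSymmConnection cov) (hc : InProjClass cov g)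
    (ha : IsMetric a) {f : M → ℝ} (hf : ContMDiff (𝓡 4) 𝓘(ℝ, ℝ) ∞ f)
    (hfa : ∀ p, f p ≠ 0 ∧ g p = f p • a p) :
    (∀ e ∈ charts M, ∀ x ∈ e.target, ∃! ℓ : Fin 4 → ℝ,
      FactorSystem (christoffel cov e) (weighted (comp a e)) x ℓ) ∧
    (∃ lam : M → ℝ, ContMDiff (𝓡 4) 𝓘(ℝ, ℝ) ∞ lam ∧ SolvesFactor cov a lam) ∧
    (∀ lam : M → ℝ, ContMDiff (𝓡 4) 𝓘(ℝ, ℝ) ∞ lam → SolvesFactor cov a lam →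
      ∃ c : ℝ, c ≠ 0 ∧ ∀ p, g p = (c * Real.exp (-5 * lam p)) • a p) := by
  obtain ⟨s, hs, hfs⟩ := exists_sign isPreconnected_univ hf.continuous.continuousOn
    fun p _ => (hfa p).1
  set lam₀ : M → ℝ := fun p => -(1 / 5) * Real.log (f p) with hlam₀
  have hloc : ∀ e ∈ charts M, ContDiffOn ℝ ∞ (fun x => lam₀ (e.symm x)) e.target ∧
      SolvesFactorOn e.target (christoffel cov e) (weighted (comp a e)) (fun x => lam₀ (e.symm x)) :=
    fun e he => solvesFactorOn_log e.open_target (ha.isMetricOn he) (hcov e he) (hc e he)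
      (contDiffOn_comp_symm hf he) hs (fun x _ => ⟨(hfa _).1, hfs _ trivial⟩) fun x _ => by
        ext i j
        change g (e.symm x) _ _ = f (e.symm x) * a (e.symm x) _ _
        rw [(hfa (e.symm x)).2]; rfl
  have hl₀ : ContMDiff (𝓡 4) 𝓘(ℝ, ℝ) ∞ lam₀ := contMDiff_of_charts fun e he => (hloc e he).1
  refine ⟨fun e he x hx => ⟨_, (hloc e he).2 x hx, fun ℓ hℓ =>
    FactorSystem.unique (weighted_isSymm (ha.isMetricOn he) hx)
      ((ha.isMetricOn he).det_weighted_ne_zero hx) hℓ ((hloc e he).2 x hx)⟩,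
    ⟨lam₀, hl₀, fun e he => (hloc e he).2⟩, fun lam hlam hsol => ?_⟩
  obtain ⟨k, hk⟩ := exists_const_of_fderiv_eq hlam hl₀ fun e he x hx =>
    (hsol e he).fderiv_eq (ha.isMetricOn he) (hloc e he).2 hx
  refine ⟨s⁻¹ * Real.exp (5 * k), mul_ne_zero (inv_ne_zero hs) (Real.exp_ne_zero _), fun p => ?_⟩
  rw [← conformal_factor_eq (hfa p).1 hs (hfs p trivial) (hk p), (hfa p).2]

end Manifold

end ProjRec

end

/-! ### Assembly of the three parts -/

theorem mainTheorem4 :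
    -- the ansatz `σ = e^lam A` in the metrizability equations
    (∀ (M : Type*) [TopologicalSpace M] [ChartedSpace ProjRec.E4 M]
        [IsManifold (𝓡 4) ∞ M]
        (cov : ProjRec.Connection M)
        (a : ProjRec.BilinField M) (lam : M → ℝ),
      ProjRec.IsSymmConnection cov → ProjRec.IsMetric a →
      ContMDiff (𝓡 4) 𝓘(ℝ, ℝ) ∞ lam →
        (ProjRec.SolvesFactor cov a lam ↔ ProjRec.SolvesMetrizability cov a lam) ∧
        (ProjRec.SolvesFactor cov a lam ↔
          ProjRec.InProjClass cov (fun p => Real.exp (-5 * lam p) • a p))) ∧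
    -- reconstruction of a Ricci-flat metric
    (∀ (M : Type*) [TopologicalSpace M] [ChartedSpace ProjRec.E4 M]
        [IsManifold (𝓡 4) ∞ M] [ConnectedSpace M]
        (cov : ProjRec.Connection M)
        (g : ProjRec.BilinField M),
      ProjRec.IsSymmConnection cov → ProjRec.WeylNondegenerate cov →
      ProjRec.IsMetric g → ProjRec.IsRicciFlat g → ProjRec.InProjClass cov g →
        (∀ e ∈ ProjRec.charts M, ∀ x ∈ e.target, ∀ h : ProjRec.Mat4, h.IsSymm →
          (ProjRec.RiemannSystem (ProjRec.weyl (ProjRec.christoffel cov e) x) h ↔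
            ∃ c : ℝ, h = c • ProjRec.comp g e x)) ∧
        (∀ a : ProjRec.BilinField M, ProjRec.IsSymTensor a → (∀ p, a p ≠ 0) →
          ProjRec.SolvesRiemann cov a →
            ProjRec.IsMetric a ∧
            (∃ f : M → ℝ, ContMDiff (𝓡 4) 𝓘(ℝ, ℝ) ∞ f ∧ ∀ p, f p ≠ 0 ∧ g p = f p • a p) ∧
            (∀ e ∈ ProjRec.charts M, ∀ x ∈ e.target, ∃! ℓ : Fin 4 → ℝ,
              ProjRec.FactorSystem (ProjRec.christoffel cov e)
                (ProjRec.weighted (ProjRec.comp a e)) x ℓ) ∧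
            (∃ lam : M → ℝ, ContMDiff (𝓡 4) 𝓘(ℝ, ℝ) ∞ lam ∧ ProjRec.SolvesFactor cov a lam) ∧
            (∀ lam : M → ℝ, ContMDiff (𝓡 4) 𝓘(ℝ, ℝ) ∞ lam → ProjRec.SolvesFactor cov a lam →
              ∃ c : ℝ, c ≠ 0 ∧ ∀ p, g p = (c * Real.exp (-5 * lam p)) • a p))) ∧
    -- reconstruction of a generic metric near a point
    (∀ (U : Set ProjRec.E4) (x₀ : ProjRec.E4) (g₀ : ProjRec.E4 → ProjRec.Mat4) (ε : ℝ),
      IsOpen U → x₀ ∈ U → ProjRec.IsMetricOn U g₀ → 0 < ε →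
      ∃ g₁ : ProjRec.E4 → ProjRec.Mat4,
        ProjRec.IsMetricOn U g₁ ∧ ProjRec.C2CloseOn U ε g₁ g₀ ∧
        ∃ (V : Set ProjRec.E4) (ε' : ℝ),
          IsOpen V ∧ IsConnected V ∧ x₀ ∈ V ∧ V ⊆ U ∧ 0 < ε' ∧
          ∀ g : ProjRec.E4 → ProjRec.Mat4,
            ProjRec.IsMetricOn V g → ProjRec.C2CloseOn V ε' g g₁ →
          ∀ Γ : ProjRec.Symbols, ProjRec.IsSymbolsOn V Γ → ProjRec.InProjClassOn V Γ g →
            (∀ x ∈ V, ∀ S : ProjRec.Mat4, S.IsSymm →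
              (ProjRec.TractorSystem (ProjRec.weyl Γ x) S ↔ ∃ c : ℝ, S = c • (g x)⁻¹)) ∧
            (∀ g' : ProjRec.E4 → ProjRec.Mat4,
              ProjRec.IsMetricOn V g' → ProjRec.InProjClassOn V Γ g' →
                ∃ c : ℝ, c ≠ 0 ∧ ∀ x ∈ V, g' x = c • g x) ∧
            (∀ S : ProjRec.E4 → ProjRec.Mat4, ProjRec.IsSymFieldOn V S →
              (∀ x ∈ V, S x ≠ 0) →
              (∀ x ∈ V, ProjRec.TractorSystem (ProjRec.weyl Γ x) (S x)) →
                ProjRec.IsMetricOn V (fun x => (S x)⁻¹) ∧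
                (∃ f : ProjRec.E4 → ℝ, ContDiffOn ℝ ∞ f V ∧
                  ∀ x ∈ V, f x ≠ 0 ∧ g x = f x • (S x)⁻¹) ∧
                (∀ x ∈ V, ∃! ℓ : Fin 4 → ℝ,
                  ProjRec.FactorSystem Γ (ProjRec.weighted (fun y => (S y)⁻¹)) x ℓ) ∧
                (∃ lam : ProjRec.E4 → ℝ, ContDiffOn ℝ ∞ lam V ∧
                  ProjRec.SolvesFactorOn V Γ (ProjRec.weighted (fun y => (S y)⁻¹)) lam) ∧
                (∀ lam : ProjRec.E4 → ℝ, ContDiffOn ℝ ∞ lam V →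
                  ProjRec.SolvesFactorOn V Γ (ProjRec.weighted (fun y => (S y)⁻¹)) lam →
                  ∃ c : ℝ, c ≠ 0 ∧ ∀ x ∈ V,
                    g x = (c * Real.exp (-5 * lam x)) • (S x)⁻¹))) := by
  refine ⟨fun M _ _ _ cov a lam hcov ha hl => ProjRec.solvesFactor_iff hcov ha hl,
    fun M _ _ _ _ cov g hcov hnd hg hric hc => ?_, fun U x₀ g₀ ε hU hx₀ hg₀ hε => ?_⟩
  · have hker : ∀ e ∈ ProjRec.charts M, ∀ x ∈ e.target, ∀ h : ProjRec.Mat4, h.IsSymm →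
        (ProjRec.RiemannSystem (ProjRec.weyl (ProjRec.christoffel cov e) x) h ↔
          ∃ c : ℝ, h = c • ProjRec.comp g e x) := fun e he x hx h hh => by
      have hW := (hc e he).weyl_eq e.open_target (hg.isMetricOn he) (hcov e he) hx
      have hn := hnd e he x hx
      -- Both the system and the nondegeneracy hypothesis involve only the Weyl tensor, so they pass
      -- to the Levi-Civita connection of `g`.
      rw [hW] at hn ⊢
      exact (hg.isMetricOn he).riemannSystem_iff e.open_target hx (hric e he x hx) hn hh
    refine ⟨hker, fun a ha ha0 hsol => ?_⟩
    obtain ⟨ham, f, hf, hfa⟩ := ProjRec.exists_conformal_factor hg ha ha0 fun e he x hx =>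
      (hker e he x hx _ ((ha.2 e he).symm x hx)).1 (hsol e he x hx)
    exact ⟨ham, ⟨f, hf, hfa⟩, ProjRec.reconstruct_of_conformal_manifold hcov hc ham hf hfa⟩
  · obtain ⟨g₁, hg₁, hclose, hgen⟩ := ProjRec.exists_generic_perturbation hU hx₀ hg₀ hε
    obtain ⟨V, ε', hV, hVc, hxV, hVU, hε', hV'⟩ := ProjRec.exists_generic_nhd hU hx₀ hg₁ hgen
    refine ⟨g₁, hg₁, hclose, V, ε', hV, hVc, hxV, hVU, hε', fun g hg hgc Γ hΓ hc => ?_⟩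
    have hker : ∀ x ∈ V, ∀ S : ProjRec.Mat4, S.IsSymm →
        (ProjRec.TractorSystem (ProjRec.weyl Γ x) S ↔ ∃ c : ℝ, S = c • (g x)⁻¹) :=
      fun x hx S hS => by
        rw [hc.weyl_eq hV hg hΓ hx]
        exact hg.tractorSystem_iff_of_genericity hV hx (hV' g hgc x hx) hS
    exact ⟨hker,
      fun g' hg' hc' => ProjRec.eq_smul_of_inProjClassOn hV hVc hg hΓ hc hker hg' hc',
      fun S hS hS0 hsol => ProjRec.reconstruct_of_tractorSystem hV hVc hg hΓ hc hker hS hS0 hsol⟩
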